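/- For an $n\times n$ real matrix $M$ with real eigenvalues $\lambda_1,\dots,\lambda_n$ (with multiplicity) let $F^{M}(x)=\frac1n\#\{i:\lambda_i\le x\}$ be its empirical spectral distribution function. For $c>0$ let $F_c$ be the distribution function of the Marchenko–Pastur law with parameter $c$, which has density $\frac{\sqrt{(x-a)(b-x)}}{2\pi x}$ on $[a,b]$, with $a=(1-\sqrt c)^2$, $b=(1+\sqrt c)^2$, and zero density elsewhere, and in addition a point mass $1-c$ at $0$ if $c<1$. Let $A_n=(\zeta^{(n)}_{ij})_{1\le i\le n,\,1\le j\le N}$, $n\ge1$, $N=N(n)$, be real random matrices on a common probability space, with rows $r^{(n)}_1,\dots,r^{(n)}_n$, and let $\mathbb E_k$ denote the conditional expectation given all the rows of $A_n$ other than $r^{(n)}_k$. Suppose that $(A_n)$ satisfies condition **C0**: 1. $\mathbb E_k[\zeta^{(n)}_{ki}]=0$ a.s. for all $i,k,n$. 2. $\sup_k\frac1n\sum_{i=1}^N\mathbb E\big|\mathbb E_k[(\zeta^{(n)}_{ki})^2]-1\big|\to0$ as $n\to\infty$. 3. There is a sequence $\gamma_n\to0$ such that $\sup_{k,\,i\ne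 j}|\mathbb E_k[\zeta^{(n)}_{ki}\zeta^{(n)}_{kj}]|+\sup_{k,\,i,\,j\ne l}|\mathbb E_k[(\zeta^{(n)}_{ki})^2\zeta^{(n)}_{kj}\zeta^{(n)}_{kl}]|=O(n^{-1/2}|\gamma_n|)$ a.s., and 4. with the same $\gamma_n$, $\sup|\mathbb E_k[\zeta^{(n)}_{ki}\zeta^{(n)}_{kj}\zeta^{(n)}_{kl}\zeta^{(n)}_{km}]|=O(n^{-1}|\gamma_n|)$ a.s., the supremum being over all $k$ and all distinct $i,j,l,m$. (The constants in both bounds $O(\cdot)$ are non-random.) 5. $\sup_{n,i,j}\mathbb E|\zeta^{(n)}_{ij}|^4<\infty$. 6. $\sup_k\frac1{n^2}\sum_{1\le i,j\le N}\mathbb E\big|\mathbb E_k[(\zeta^{(n)}_{ki})^2(\zeta^{(n)}_{kj})^2]-1\big|\to0$ as $n\to\infty$. 7. $(\beta_n)$ is a sequence of non-negative integers with $\beta_n=o(\sqrt n)$ such that, for every $n$ and all index sets $I,J\subseteq\{1,\dots,n\}$ with $|i-j|>\beta_n$ for all $i\in I$, $j\in J$, the $\sigma$-algebras $\sigma(r^{(n)}_i:i\in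 I)$ and $\sigma(r^{(n)}_j:j\in J)$ are independent. Assume that $N/n\to c\in(0,\infty)$. Then $$\sup_{x\in\mathbb R}\Big|\mathbb E F^{\frac1nA_nA_n^{\mathrm T}}(x)-F_c(x)\Big|\longrightarrow0\qquad(n\to\infty).$$ Moreover, if there exists $p>1$ such that $\sum_{n=1}^\infty\frac{(\beta_n+1)^p}{n^{p/2}}<\infty$, then, almost surely, $$\sup_{x\in\mathbb R}\Big|F^{\frac1nA_nA_n^{\mathrm T}}(x)-F_c(x)\Big|\longrightarrow0\qquad(n\to\infty).$$ -/

import Mathlib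

open MeasureTheory ProbabilityTheory Filter Topology Asymptotics

open scoped ENNReal

noncomputable section

namespace MarchenkoPastur

/-- The empirical spectral distribution function of an `n × n` real matrix with real eigenvalues:
the proportion of eigenvalues (roots of the characteristic polynomial, counted with algebraic
multiplicity) that are at most `x`. -/
def esd {n : ℕ} (M : Matrix (Fin n) (Fin n) ℝ) (x : ℝ) : ℝ :=
  ((M.charpoly.roots.filter (fun t : ℝ => t ≤ x)).card : ℝ) / n

/-- The matrix `(1/n) A Aᵀ` of an `n × N` matrix `A`. -/
def normGram {n N : ℕ} (A : Matrix (Fin n) (Fin N) ℝ) : Matrix (Fin n) (Fin n) ℝ :=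
  (1 / (n : ℝ)) • (A * A.transpose)

/-- The density `√((x - a)(b - x)) / (2πx)` on `[a, b]`, where `a = (1 - √c)²` and
`b = (1 + √c)²`, extended by zero. -/
def mpDensity (c x : ℝ) : ℝ :=
  if (1 - √c) ^ 2 ≤ x ∧ x ≤ (1 + √c) ^ 2 then
    √((x - (1 - √c) ^ 2) * ((1 + √c) ^ 2 - x)) / (2 * Real.pi * x)
  else 0

/-- The Marchenko–Pastur law with parameter `c > 0`: it has density `mpDensity c`, and a point
mass `1 - c` at the origin if `c < 1` (`ENNReal.ofReal (1 - c)` is zero if `c ≥ 1`). -/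
def mpLaw (c : ℝ) : Measure ℝ :=
  volume.withDensity (fun x => ENNReal.ofReal (mpDensity c x)) +
    ENNReal.ofReal (1 - c) • Measure.dirac 0

/-- The distribution function `F_c` of the Marchenko–Pastur law. -/
def mpCDF (c x : ℝ) : ℝ := (mpLaw c).real (Set.Iic x)

/-- The uniform distance `sup_x |F x - G x|`, as an extended nonnegative real. -/
def supDist (F G : ℝ → ℝ) : ℝ≥0∞ := ⨆ x : ℝ, ENNReal.ofReal |F x - G x|

variable {Ω : Type*}

/-- The σ-algebra generated by the rows `r_i`, `i ∈ I`, of a random matrix. -/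
@[reducible] def rowSigma {n N : ℕ} (A : Ω → Matrix (Fin n) (Fin N) ℝ) (I : Set (Fin n)) : MeasurableSpace Ω :=
  ⨆ i ∈ I, MeasurableSpace.comap (fun ω => (fun j => A ω i j : Fin N → ℝ)) inferInstance

/-- The conditional expectation `𝔼_k[X]` with respect to the σ-algebra generated by all the rows
other than row `k`. -/
def rowCondExp [MeasurableSpace Ω] (μ : Measure Ω) {n N : ℕ}
    (A : Ω → Matrix (Fin n) (Fin N) ℝ) (k : Fin n) (X : Ω → ℝ) : Ω → ℝ :=
  μ[X | rowSigma A {k}ᶜ]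

/-- Condition **C0** for a sequence of `n × N(n)` real random matrices `A n`, with dependency
range `β n`. -/
structure ConditionC0 [MeasurableSpace Ω] (μ : Measure Ω) {N : ℕ → ℕ}
    (A : (n : ℕ) → Ω → Matrix (Fin n) (Fin (N n)) ℝ) (β : ℕ → ℕ) : Prop where
  /-- The entries are random variables. -/
  measurable : ∀ n (i : Fin n) (j : Fin (N n)), Measurable (fun ω => A n ω i j)
  /-- The rows are centered given the other rows. -/
  centered : ∀ n (k : Fin n) (i : Fin (N n)),
    rowCondExp μ (A n) k (fun ω => A n ω k i) =ᵐ[μ] 0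
  /-- `q_n → 0`. -/
  variance : Tendsto
    (fun n : ℕ => ⨆ k : Fin n, (1 / (n : ℝ)) * ∑ i : Fin (N n),
      ∫ ω, |rowCondExp μ (A n) k (fun ω' => A n ω' k i ^ 2) ω - 1| ∂μ)
    atTop (𝓝 0)
  /-- The mixed conditional moments within a row are small, almost surely, with a common
  rate `γ_n → 0`. -/
  weakCorrelation : ∃ γ : ℕ → ℝ, Tendsto γ atTop (𝓝 0) ∧
    (∃ C : ℝ, ∀ᶠ n : ℕ in atTop, ∀ᵐ ω ∂μ,
      (∀ (k : Fin n) (i j : Fin (N n)), i ≠ j →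
        |rowCondExp μ (A n) k (fun ω' => A n ω' k i * A n ω' k j) ω| ≤ C * (|γ n| / √n)) ∧
      (∀ (k : Fin n) (i j l : Fin (N n)), j ≠ l →
        |rowCondExp μ (A n) k (fun ω' => A n ω' k i ^ 2 * A n ω' k j * A n ω' k l) ω|
          ≤ C * (|γ n| / √n))) ∧
    (∃ C : ℝ, ∀ᶠ n : ℕ in atTop, ∀ᵐ ω ∂μ,
      ∀ (k : Fin n) (i j l m : Fin (N n)), [i, j, l, m].Nodup →
        |rowCondExp μ (A n) k
            (fun ω' => A n ω' k i * A n ω' k j * A n ω' k l * A n ω' k m) ω|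
          ≤ C * (|γ n| / n))
  /-- The fourth moments are uniformly bounded. -/
  fourthMoment : ∃ M : ℝ, ∀ n (i : Fin n) (j : Fin (N n)),
    Integrable (fun ω => |A n ω i j| ^ 4) μ ∧ ∫ ω, |A n ω i j| ^ 4 ∂μ ≤ M
  /-- `ρ_n → 0`. -/
  rowVariance : Tendsto
    (fun n : ℕ => ⨆ k : Fin n, (1 / (n : ℝ) ^ 2) * ∑ i : Fin (N n), ∑ j : Fin (N n),
      ∫ ω, |rowCondExp μ (A n) k (fun ω' => A n ω' k i ^ 2 * A n ω' k j ^ 2) ω - 1| ∂μ)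
    atTop (𝓝 0)
  /-- `β_n = o(√n)`. -/
  range_isLittleO : (fun n : ℕ => (β n : ℝ)) =o[atTop] (fun n : ℕ => √(n : ℝ))
  /-- Groups of rows that are more than `β_n` apart are independent. -/
  range_indep : ∀ n (I J : Set (Fin n)),
    (∀ i ∈ I, ∀ j ∈ J, (β n : ℤ) < |((i : ℕ) : ℤ) - ((j : ℕ) : ℤ)|) →
      Indep (rowSigma (A n) I) (rowSigma (A n) J) μ

end MarchenkoPastur

end

/-!
The spectrum is tested through the resolvent at real points `-t`, `t > 0`, only; there all
inverses exist, all bounds are elementary, and no complex analysis is needed.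

For an `n × N` matrix with rows `r_k` let `G = (t + (1/n) ∑_k r_k r_kᵀ)⁻¹`, let `G_k` be the same
inverse with `r_k` left out, and put `ξ_k = (1/n) r_kᵀ G_k r_k`. The Sherman–Morrison formula gives
the exact identity `N = t tr G + ∑_k (1 - 1 / (1 + ξ_k))` (`card_eq_trace_inv_add_sum`), and shows
that leaving out a row changes `tr G` by at most `1 / t`. Three facts turn the identity into a closed
equation for `h_n = 𝔼 (1/n) tr G`.

* `ξ_k` is close to `(1/n) tr G_k` in mean square (`integral_sq_rowForm_sub_le`): since `G_k` is a
  function of the other rows, the conditional moment hypotheses apply to the square of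
  `r_kᵀ G_k r_k - tr G_k`, and the resulting sums are controlled by `|(G_k)ᵢⱼ| ≤ 1 / t` and
  `∑ⱼ (G_k)ᵢⱼ² ≤ 1 / t²` (`quadForm_moment_le`).
* `(1/n) tr G_k` is close to `(1/n) tr G`.
* `(1/n) tr G` is close to its mean (`integral_exp_rowTrace_sub_le`): reveal the rows one at a time.
  The trace without the rows `k, …, k + β` depends only on rows that are revealed already and on rows
  independent of those and of row `k`, so its conditional expectation does not change in step `k`
  (`condExp_eq_of_indep`). The martingale increments are therefore at most `2 (β + 1) / (t n)`, and
  Azuma's inequality applies because `β = o(√n)`.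

Hence `(t h_n + 1 - N/n) (1 + h_n) → 1`, an equation that is stable on `h ≥ 0`, and `h_n` converges to
`(c - u) / t`, where `u` is the smaller root of `u² - (1 + c + t) u + c = 0`
(`tendsto_integral_rowTrace`). Azuma's inequality and the Borel–Cantelli lemma yield the same limit
almost surely under the summability condition (`ae_tendsto_rowTrace_sub`). On the other side, the
substitution `x = 1 + c + 2√c cos θ` and the integral
`∫₀^π sin² θ / (1 + q² + 2 q cos θ) dθ = π / 2` give `∫ 1 / (x + t) = (1 - u) / t` for the
Marchenko–Pastur law (`mpMean_resolventFun`), the same value.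

In the coordinate `y = 1 / (1 + x)` the functions `1 / (x + t)` become `y / (1 - (1 - t) y)`. For a
sequence of points `t → 1` they span, together with the constants, a dense subspace of `C([0, 1])`
(`eq_top_of_resolventFun_mem`), so that all continuous test functions converge. The limiting
distribution function is continuous on `[0, ∞)`, and no mass is lost at the possible atom `0`, because
the rank of the matrix is at most `N`; a Pólya-type argument upgrades the convergence to uniform
convergence (`tendsto_supDist_zero`).
-/

namespace MarchenkoPastur

/-! ### Inverses of regularized Gram matrices -/

section Resolvent

open Matrix

variable {ι κ : Type*}

/-- A symmetric real matrix whose quadratic form is at least `t ‖x‖²`. -/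
def Coercive [Fintype ι] (t : ℝ) (M : Matrix ι ι ℝ) : Prop :=
  Mᵀ = M ∧ ∀ x : ι → ℝ, t * (x ⬝ᵥ x) ≤ x ⬝ᵥ (M *ᵥ x)

lemma zero_le_dotProduct_self [Fintype ι] (x : ι → ℝ) : 0 ≤ x ⬝ᵥ x :=
  Finset.sum_nonneg fun i _ => mul_self_nonneg (x i)

lemma Coercive.add_vecMulVec [Fintype ι] {t : ℝ} {M : Matrix ι ι ℝ} (hM : Coercive t M)
    {s : ℝ} (hs : 0 ≤ s) (v : ι → ℝ) : Coercive t (M + s • vecMulVec v v) := by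
  refine ⟨by rw [transpose_add, hM.1, transpose_smul, transpose_vecMulVec], fun x => ?_⟩
  have h := hM.2 x
  have h2 : x ⬝ᵥ ((M + s • vecMulVec v v) *ᵥ x) = x ⬝ᵥ (M *ᵥ x) + s * (v ⬝ᵥ x) ^ 2 := by
    rw [add_mulVec, smul_mulVec, vecMulVec_mulVec, dotProduct_add, dotProduct_smul]
    simp only [op_smul_eq_smul, dotProduct_smul, smul_eq_mul, dotProduct_comm x v]
    ring
  rw [h2]
  have : 0 ≤ s * (v ⬝ᵥ x) ^ 2 := by positivity
  linarith

variable [DecidableEq ι]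

/-- The regularized Gram matrix `t + s ∑_{k ∈ I} r_k r_kᵀ` of the vectors `r_k`, `k ∈ I`. -/
def regGram (s t : ℝ) (r : κ → ι → ℝ) (I : Finset κ) : Matrix ι ι ℝ :=
  t • 1 + s • ∑ k ∈ I, vecMulVec (r k) (r k)

lemma regGram_insert [DecidableEq κ] (s t : ℝ) (r : κ → ι → ℝ) {I : Finset κ} {k : κ} (hk : k ∉ I) :
    regGram s t r (insert k I) = regGram s t r I + s • vecMulVec (r k) (r k) := by
  rw [regGram, regGram, Finset.sum_insert hk, smul_add]
  abel

lemma regGram_univ [Fintype κ] (s t : ℝ) (A : Matrix κ ι ℝ) :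
    regGram s t (fun k j => A k j) Finset.univ = t • 1 + s • (Aᵀ * A) := by
  rw [regGram]
  congr 2
  ext i j
  simp [Matrix.sum_apply, vecMulVec_apply, mul_apply]

variable [Fintype ι]

lemma coercive_smul_one (t : ℝ) : Coercive t (t • (1 : Matrix ι ι ℝ)) := by
  refine ⟨by simp, fun x => ?_⟩
  simp [smul_mulVec]

lemma Coercive.isUnit_det {t : ℝ} {M : Matrix ι ι ℝ} (hM : Coercive t M) (ht : 0 < t) :
    IsUnit M.det := by
  have h : M.PosDef := by
    refine PosDef.of_dotProduct_mulVec_pos (by simpa [IsHermitian] using hM.1) fun x hx => ?_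
    have h1 := hM.2 x
    have h2 : 0 < x ⬝ᵥ x := by
      rcases (zero_le_dotProduct_self x).lt_or_eq with h | h
      · exact h
      · exact absurd (dotProduct_self_eq_zero.1 h.symm) hx
    have : 0 < t * (x ⬝ᵥ x) := by positivity
    simpa using lt_of_lt_of_le this h1
  exact isUnit_iff_ne_zero.2 h.det_pos.ne'

lemma Coercive.transpose_inv {t : ℝ} {M : Matrix ι ι ℝ} (hM : Coercive t M) :
    (M⁻¹)ᵀ = M⁻¹ := by rw [transpose_nonsing_inv, hM.1]

lemma Coercive.mulVec_inv {t : ℝ} {M : Matrix ι ι ℝ} (hM : Coercive t M) (ht : 0 < t)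
    (x : ι → ℝ) : M *ᵥ (M⁻¹ *ᵥ x) = x := by
  rw [mulVec_mulVec, mul_nonsing_inv _ (hM.isUnit_det ht), one_mulVec]

lemma Coercive.dotProduct_inv_le {t : ℝ} {M : Matrix ι ι ℝ} (hM : Coercive t M) (ht : 0 < t)
    (x : ι → ℝ) : t * ((M⁻¹ *ᵥ x) ⬝ᵥ (M⁻¹ *ᵥ x)) ≤ x ⬝ᵥ (M⁻¹ *ᵥ x) := by
  have h := hM.2 (M⁻¹ *ᵥ x)
  rwa [hM.mulVec_inv ht, dotProduct_comm _ x] at h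

lemma Coercive.dotProduct_inv_nonneg {t : ℝ} {M : Matrix ι ι ℝ} (hM : Coercive t M) (ht : 0 < t)
    (x : ι → ℝ) : 0 ≤ x ⬝ᵥ (M⁻¹ *ᵥ x) :=
  le_trans (mul_nonneg ht.le (zero_le_dotProduct_self _)) (hM.dotProduct_inv_le ht x)

lemma Coercive.norm_inv_le {t : ℝ} {M : Matrix ι ι ℝ} (hM : Coercive t M) (ht : 0 < t)
    (x : ι → ℝ) : (M⁻¹ *ᵥ x) ⬝ᵥ (M⁻¹ *ᵥ x) ≤ (1 / t) ^ 2 * (x ⬝ᵥ x) := by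
  set y := M⁻¹ *ᵥ x
  have h1 : t * (y ⬝ᵥ y) ≤ x ⬝ᵥ y := hM.dotProduct_inv_le ht x
  -- `0 ≤ ‖x - t y‖²` together with `t ‖y‖² ≤ ⟨x, y⟩`
  have h2 : (x ⬝ᵥ y) ^ 2 ≤ (x ⬝ᵥ x) * (y ⬝ᵥ y) := by
    have := Finset.sum_mul_sq_le_sq_mul_sq Finset.univ x y
    simpa [dotProduct, sq] using this
  have hy := zero_le_dotProduct_self y
  have h3 : t ^ 2 * (y ⬝ᵥ y) ≤ x ⬝ᵥ x := by
    rcases hy.lt_or_eq with h | h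
    · have h4 : (t * (y ⬝ᵥ y)) ^ 2 ≤ (x ⬝ᵥ x) * (y ⬝ᵥ y) :=
        le_trans (pow_le_pow_left₀ (by positivity) h1 2) h2
      refine le_of_mul_le_mul_right ?_ h
      nlinarith
    · rw [← h]; simpa using zero_le_dotProduct_self x
  rw [div_pow, one_pow, div_mul_eq_mul_div, one_mul, le_div_iff₀ (by positivity)]
  linarith

lemma Coercive.sum_sq_inv_le {t : ℝ} {M : Matrix ι ι ℝ} (hM : Coercive t M) (ht : 0 < t)
    (i : ι) : ∑ j, (M⁻¹ i j) ^ 2 ≤ (1 / t) ^ 2 := by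
  have h := hM.norm_inv_le ht (Pi.single i 1)
  have h2 : ∀ j, M⁻¹ j i = M⁻¹ i j := fun j => congrFun (congrFun hM.transpose_inv i) j
  rw [mulVec_single_one, single_dotProduct, one_mul, Pi.single_eq_same, mul_one] at h
  simpa only [dotProduct, col_apply, h2, ← sq] using h

lemma Coercive.abs_inv_le {t : ℝ} {M : Matrix ι ι ℝ} (hM : Coercive t M) (ht : 0 < t)
    (i j : ι) : |M⁻¹ i j| ≤ 1 / t := by
  refine abs_le_of_sq_le_sq ?_ (by positivity)
  exact le_trans (Finset.single_le_sum (f := fun j => (M⁻¹ i j) ^ 2)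
    (fun _ _ => sq_nonneg _) (Finset.mem_univ j)) (hM.sum_sq_inv_le ht i)

lemma Coercive.inv_apply_self_nonneg {t : ℝ} {M : Matrix ι ι ℝ} (hM : Coercive t M) (ht : 0 < t)
    (i : ι) : 0 ≤ M⁻¹ i i := by
  simpa using hM.dotProduct_inv_nonneg ht (Pi.single i 1)

/-- The **Sherman–Morrison formula** for a symmetric rank-one update of a coercive matrix. -/
lemma Coercive.inv_add_vecMulVec {t : ℝ} {M : Matrix ι ι ℝ} (hM : Coercive t M) (ht : 0 < t)
    {s : ℝ} (hs : 0 ≤ s) (v : ι → ℝ) :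
    (M + s • vecMulVec v v)⁻¹ =
      M⁻¹ - (s / (1 + s * (v ⬝ᵥ (M⁻¹ *ᵥ v)))) • vecMulVec (M⁻¹ *ᵥ v) (M⁻¹ *ᵥ v) := by
  set q := v ⬝ᵥ (M⁻¹ *ᵥ v) with hq
  have hq0 : 0 ≤ q := hM.dotProduct_inv_nonneg ht v
  have hd : 1 + s * q ≠ 0 := by positivity
  apply inv_eq_right_inv
  have h1 : M * M⁻¹ = 1 := mul_nonsing_inv _ (hM.isUnit_det ht)
  have h2 : v ᵥ* M⁻¹ = M⁻¹ *ᵥ v := by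
    rw [← mulVec_transpose, hM.transpose_inv]
  rw [mul_sub, add_mul, add_mul, h1, Matrix.smul_mul, vecMulVec_mul, h2, Matrix.mul_smul,
      Matrix.smul_mul,
    Matrix.mul_smul, mul_vecMulVec, hM.mulVec_inv ht, vecMulVec_mul_vecMulVec, ← hq]
  ext i j
  simp only [Matrix.sub_apply, Matrix.add_apply, Matrix.smul_apply, vecMulVec_apply, smul_eq_mul,
    Pi.smul_apply]
  field_simp
  ring

lemma Coercive.trace_inv_add_vecMulVec {t : ℝ} {M : Matrix ι ι ℝ} (hM : Coercive t M) (ht : 0 < t)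
    {s : ℝ} (hs : 0 ≤ s) (v : ι → ℝ) :
    (M + s • vecMulVec v v)⁻¹.trace ≤ M⁻¹.trace ∧
      M⁻¹.trace ≤ (M + s • vecMulVec v v)⁻¹.trace + 1 / t := by
  rw [hM.inv_add_vecMulVec ht hs, trace_sub, trace_smul, trace_vecMulVec, smul_eq_mul]
  have h1 := hM.dotProduct_inv_le ht v
  have h2 := zero_le_dotProduct_self (M⁻¹ *ᵥ v)
  set q := v ⬝ᵥ (M⁻¹ *ᵥ v)
  set w := (M⁻¹ *ᵥ v) ⬝ᵥ (M⁻¹ *ᵥ v)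
  have hq : 0 ≤ q := le_trans (by positivity) h1
  have h3 : 0 ≤ s / (1 + s * q) * w := by positivity
  have h4 : s / (1 + s * q) * w ≤ 1 / t := by
    rw [div_mul_eq_mul_div, div_le_div_iff₀ (by positivity) ht]
    nlinarith [mul_le_mul_of_nonneg_left h1 hs]
  constructor <;> linarith

lemma Coercive.dotProduct_inv_add_vecMulVec {t : ℝ} {M : Matrix ι ι ℝ} (hM : Coercive t M)
    (ht : 0 < t) {s : ℝ} (hs : 0 ≤ s) (v : ι → ℝ) :
    s * (v ⬝ᵥ ((M + s • vecMulVec v v)⁻¹ *ᵥ v)) = 1 - 1 / (1 + s * (v ⬝ᵥ (M⁻¹ *ᵥ v))) := by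
  have hq0 : 0 ≤ v ⬝ᵥ (M⁻¹ *ᵥ v) := hM.dotProduct_inv_nonneg ht v
  have hd : 1 + s * (v ⬝ᵥ (M⁻¹ *ᵥ v)) ≠ 0 := by positivity
  rw [hM.inv_add_vecMulVec ht hs, sub_mulVec, smul_mulVec, vecMulVec_mulVec, dotProduct_sub,
    dotProduct_smul]
  simp only [op_smul_eq_smul, dotProduct_smul, smul_eq_mul, dotProduct_comm (M⁻¹ *ᵥ v) v]
  field_simp
  ring

variable [DecidableEq κ]

lemma coercive_regGram {s : ℝ} (hs : 0 ≤ s) (t : ℝ) (r : κ → ι → ℝ) (I : Finset κ) :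
    Coercive t (regGram s t r I) := by
  induction I using Finset.induction_on with
  | empty => simpa [regGram] using coercive_smul_one t
  | insert k I hk ih =>
    rw [regGram_insert s t r hk]
    exact ih.add_vecMulVec hs _

/-- Deleting `m` vectors from a regularized Gram matrix increases the trace of its inverse,
by at most `m / t`. -/
lemma trace_inv_regGram_union {s t : ℝ} (hs : 0 ≤ s) (ht : 0 < t) (r : κ → ι → ℝ)
    (I J : Finset κ) :
    (regGram s t r (I ∪ J))⁻¹.trace ≤ (regGram s t r I)⁻¹.trace ∧
    (regGram s t r I)⁻¹.trace ≤ (regGram s t r (I ∪ J))⁻¹.trace + J.card / t := by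
  induction J using Finset.induction_on with
  | empty => simp
  | insert k J hk ih =>
    rw [Finset.union_insert, Finset.card_insert_of_notMem hk]
    have hkt : ((J.card + 1 : ℕ) : ℝ) / t = J.card / t + 1 / t := by push_cast; ring
    rw [hkt]
    by_cases h : k ∈ I ∪ J
    · rw [Finset.insert_eq_of_mem h]
      have : 0 < 1 / t := by positivity
      constructor <;> linarith [ih.1, ih.2]
    · rw [regGram_insert s t r h]
      have := (coercive_regGram hs t r (I ∪ J)).trace_inv_add_vecMulVec ht hs (r k)
      constructor <;> linarith [ih.1, ih.2, this.1, this.2]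

/-- The trace identity `N = t tr G + ∑_k (1 - 1 / (1 + ξ_k))`, where `G` is the inverse of the full
regularized Gram matrix and `ξ_k` is the quadratic form at `r_k` of the inverse without `r_k`. -/
lemma card_eq_trace_inv_add_sum [Fintype κ] {s t : ℝ} (hs : 0 ≤ s) (ht : 0 < t) (r : κ → ι → ℝ) :
    (Fintype.card ι : ℝ) = t * (regGram s t r Finset.univ)⁻¹.trace +
      ∑ k, (1 - 1 / (1 + s * (r k ⬝ᵥ ((regGram s t r {k}ᶜ)⁻¹ *ᵥ r k)))) := by
  have h1 : ∀ k, 1 - 1 / (1 + s * (r k ⬝ᵥ ((regGram s t r {k}ᶜ)⁻¹ *ᵥ r k))) =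
      s * (r k ⬝ᵥ ((regGram s t r Finset.univ)⁻¹ *ᵥ r k)) := by
    intro k
    rw [← (coercive_regGram hs t r _).dotProduct_inv_add_vecMulVec ht hs, ← regGram_insert _ _ _
        (by simp)]
    simp
  simp_rw [h1]
  set G := (regGram s t r Finset.univ)⁻¹ with hG
  have h2 : regGram s t r Finset.univ * G = 1 :=
    mul_nonsing_inv _ ((coercive_regGram hs t r _).isUnit_det ht)
  have h3 := congrArg trace h2
  rw [trace_one, regGram, add_mul, trace_add, smul_mul_assoc, one_mul, trace_smul, smul_mul_assoc,
    trace_smul, Finset.sum_mul, trace_sum, smul_eq_mul, smul_eq_mul, Finset.mul_sum] at h3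
  rw [← h3]
  congr 1
  refine Finset.sum_congr rfl fun k _ => ?_
  rw [vecMulVec_mul, trace_vecMulVec, dotProduct_comm, ← dotProduct_mulVec]

/-- The resolvents of `s A Aᵀ` and `s Aᵀ A` at `-t` have traces differing by
`(n - N) / t`. -/
lemma trace_inv_mul_transpose [Fintype κ] {s t : ℝ} (hs : 0 ≤ s) (ht : 0 < t) (A : Matrix κ ι ℝ) :
    (t • (1 : Matrix κ κ ℝ) + s • (A * Aᵀ))⁻¹.trace =
      (regGram s t (fun k j => A k j) Finset.univ)⁻¹.trace +
          ((Fintype.card κ : ℝ) - Fintype.card ι) / t := by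
  have hR : t • (1 : Matrix κ κ ℝ) + s • (A * Aᵀ) =
      regGram s t (fun k j => Aᵀ k j) Finset.univ := by
    rw [regGram_univ, transpose_transpose]
  have c1 := (coercive_regGram hs t (fun k j => Aᵀ k j) Finset.univ).isUnit_det ht
  have c2 := (coercive_regGram hs t (fun k j => A k j) Finset.univ).isUnit_det ht
  rw [← hR] at c1
  rw [regGram_univ] at c2 ⊢
  set P := t • (1 : Matrix κ κ ℝ) + s • (A * Aᵀ) with hP
  set Q := t • (1 : Matrix ι ι ℝ) + s • (Aᵀ * A) with hQ
  have hPQ : P * A = A * Q := by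
    rw [hP, hQ, Matrix.add_mul, Matrix.mul_add, Matrix.smul_mul, Matrix.one_mul, Matrix.mul_smul,
      Matrix.mul_one, Matrix.smul_mul, Matrix.mul_smul, Matrix.mul_assoc]
  have hinv : A * Q⁻¹ = P⁻¹ * A := by
    calc A * Q⁻¹ = P⁻¹ * P * A * Q⁻¹ := by rw [nonsing_inv_mul _ c1, Matrix.one_mul]
      _ = P⁻¹ * A * (Q * Q⁻¹) := by
        rw [Matrix.mul_assoc P⁻¹, hPQ]; simp only [Matrix.mul_assoc]
      _ = P⁻¹ * A := by rw [mul_nonsing_inv _ c2, Matrix.mul_one]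
  have e1 : (Fintype.card κ : ℝ) = t * P⁻¹.trace + s * (P⁻¹ * (A * Aᵀ)).trace := by
    have h := congrArg trace (nonsing_inv_mul _ c1)
    rwa [trace_one, show P⁻¹ * P = t • P⁻¹ + s • (P⁻¹ * (A * Aᵀ)) by
      conv_lhs => rw [hP]
      rw [Matrix.mul_add, Matrix.mul_smul, Matrix.mul_one, Matrix.mul_smul], trace_add, trace_smul,
      trace_smul, smul_eq_mul, smul_eq_mul, eq_comm] at h
  have e2 : (Fintype.card ι : ℝ) = t * Q⁻¹.trace + s * ((Aᵀ * A) * Q⁻¹).trace := by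
    have h := congrArg trace (mul_nonsing_inv _ c2)
    rwa [trace_one, show Q * Q⁻¹ = t • Q⁻¹ + s • ((Aᵀ * A) * Q⁻¹) by
      conv_lhs => rw [hQ]
      rw [Matrix.add_mul, Matrix.smul_mul, Matrix.one_mul, Matrix.smul_mul], trace_add, trace_smul,
      trace_smul, smul_eq_mul, smul_eq_mul, eq_comm] at h
  have e3 : (P⁻¹ * (A * Aᵀ)).trace = ((Aᵀ * A) * Q⁻¹).trace := by
    rw [Matrix.mul_assoc, hinv, trace_mul_comm Aᵀ, Matrix.mul_assoc]
  rw [e3] at e1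
  field_simp
  linarith

end Resolvent

/-! ### Exponential martingale bounds and conditional independence -/

section Concentration

open Matrix

/-- On `[-a, a]` the convex function `exp (l ·)` lies below its chord. -/
lemma exp_mul_le_cosh_add {a : ℝ} (ha : 0 < a) (l : ℝ) {d : ℝ} (hd : |d| ≤ a) :
    Real.exp (l * d) ≤ Real.cosh (l * a) + d * (Real.sinh (l * a) / a) := by
  obtain ⟨h1, h2⟩ := abs_le.1 hd
  have h0 := convexOn_exp.2
  have hc := @h0 (l * a) (Set.mem_univ _) (-(l * a)) (Set.mem_univ _)
    ((1 + d / a) / 2) ((1 - d / a) / 2)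
    (by have : -1 ≤ d / a := by rw [le_div_iff₀ ha]; linarith
        linarith)
    (by have : d / a ≤ 1 := by rw [div_le_iff₀ ha]; linarith
        linarith) (by ring)
  simp only [smul_eq_mul] at hc
  have e : (1 + d / a) / 2 * (l * a) + (1 - d / a) / 2 * -(l * a) = l * d := by
    field_simp; ring
  rw [e] at hc
  refine hc.trans_eq ?_
  rw [Real.cosh_eq, Real.sinh_eq]
  field_simp
  ring

variable {Ω : Type*} {mΩ : MeasurableSpace Ω} {μ : Measure Ω} [IsProbabilityMeasure μ]

/-- **Azuma's inequality** in exponential form, for the Doob martingale of a bounded random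
variable `X` along a filtration starting from the trivial σ-algebra. -/
lemma integral_exp_condExp_sub_le (𝓕 : ℕ → MeasurableSpace Ω) (hmono : Monotone 𝓕)
    (hle : ∀ k, 𝓕 k ≤ mΩ) (h0 : 𝓕 0 = ⊥) {X : Ω → ℝ} {R : ℝ} (hR : ∀ ω, |X ω| ≤ R)
    {a : ℝ} (ha : 0 < a) {n : ℕ}
    (hinc : ∀ k < n, ∀ᵐ ω ∂μ, |(μ[X | 𝓕 (k + 1)]) ω - (μ[X | 𝓕 k]) ω| ≤ a) (l : ℝ) :
    ∫ ω, Real.exp (l * ((μ[X | 𝓕 n]) ω - ∫ ω', X ω' ∂μ)) ∂μ ≤ Real.exp (n * (l * a) ^ 2 / 2) := by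
  have hbd : ∀ k, ∀ᵐ ω ∂μ, |(μ[X | 𝓕 k]) ω| ≤ R := by
    intro k
    exact ae_bdd_abs_condExp_of_ae_bdd_abs (m := 𝓕 k) (Eventually.of_forall hR)
  set E := ∫ ω', X ω' ∂μ with hE
  -- the exponentials are bounded, measurable at time `k`, hence integrable
  have hsm : ∀ k, StronglyMeasurable[𝓕 k] fun ω => Real.exp (l * ((μ[X | 𝓕 k]) ω - E)) := by
    intro k
    have h : StronglyMeasurable[𝓕 k] fun ω => l * ((μ[X | 𝓕 k]) ω - E) :=
      (stronglyMeasurable_condExp.sub stronglyMeasurable_const).const_mul l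
    exact Real.continuous_exp.comp_stronglyMeasurable h
  have hexpbd : ∀ k, ∀ᵐ ω ∂μ, ‖Real.exp (l * ((μ[X | 𝓕 k]) ω - E))‖ ≤
      Real.exp (|l| * (R + |E|)) := by
    intro k
    filter_upwards [hbd k] with ω hω
    rw [Real.norm_eq_abs, Real.abs_exp, Real.exp_le_exp]
    calc l * ((μ[X | 𝓕 k]) ω - E) ≤ |l * ((μ[X | 𝓕 k]) ω - E)| := le_abs_self _
      _ = |l| * |(μ[X | 𝓕 k]) ω - E| := abs_mul _ _
      _ ≤ |l| * (R + |E|) := by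
        gcongr
        exact (abs_sub _ _).trans (by linarith)
  have hint : ∀ k, Integrable (fun ω => Real.exp (l * ((μ[X | 𝓕 k]) ω - E))) μ := fun k =>
    Integrable.of_bound ((hsm k).mono (hle k)).aestronglyMeasurable _ (hexpbd k)
  have key : ∀ k ≤ n, ∫ ω, Real.exp (l * ((μ[X | 𝓕 k]) ω - E)) ∂μ ≤
      Real.exp (k * (l * a) ^ 2 / 2) := by
    intro k
    induction k with
    | zero =>
      intro _
      rw [h0, condExp_bot, ← hE]
      simp
    | succ k ih =>
      intro hk
      specialize ih (by omega)
      set D : Ω → ℝ := fun ω => (μ[X | 𝓕 (k + 1)]) ω - (μ[X | 𝓕 k]) ω with hD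
      have hDint : Integrable D μ := integrable_condExp.sub integrable_condExp
      have hprod : Integrable (fun ω => Real.exp (l * ((μ[X | 𝓕 k]) ω - E)) * D ω) μ :=
        hDint.bdd_mul ((hsm k).mono (hle k)).aestronglyMeasurable (hexpbd k)
      have hD0 : μ[D | 𝓕 k] =ᵐ[μ] 0 := by
        have h1 := condExp_sub (μ := μ) (m := 𝓕 k) (integrable_condExp (f := X) (m := 𝓕 (k + 1)))
          (integrable_condExp (f := X) (m := 𝓕 k))
        have h2 := condExp_condExp_of_le (μ := μ) (f := X) (hmono (Nat.le_succ k)) (hle (k + 1))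
        have h3 : μ[μ[X | 𝓕 k] | 𝓕 k] = μ[X | 𝓕 k] :=
          condExp_of_stronglyMeasurable (hle k) stronglyMeasurable_condExp integrable_condExp
        refine h1.trans ?_
        filter_upwards [h2] with ω h
        have h' : (μ[μ[X | 𝓕 (k + 1)] | 𝓕 k]) ω = (μ[X | 𝓕 k]) ω := h
        simp [h', h3]
      have hzero : ∫ ω, Real.exp (l * ((μ[X | 𝓕 k]) ω - E)) * D ω ∂μ = 0 := by
        rw [← integral_condExp (hle k)]
        have h1 := condExp_mul_of_stronglyMeasurable_left (μ := μ) (hsm k) hprod hDint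
        refine integral_eq_zero_of_ae (h1.trans ?_)
        filter_upwards [hD0] with ω h
        simp [h]
      calc ∫ ω, Real.exp (l * ((μ[X | 𝓕 (k + 1)]) ω - E)) ∂μ
          ≤ ∫ ω, (Real.cosh (l * a) * Real.exp (l * ((μ[X | 𝓕 k]) ω - E)) +
              (Real.sinh (l * a) / a) * (Real.exp (l * ((μ[X | 𝓕 k]) ω - E)) * D ω)) ∂μ := by
            refine integral_mono_ae (hint _) (((hint k).const_mul _).add (hprod.const_mul _)) ?_
            filter_upwards [hinc k (by omega)] with ω h
            have h1 := exp_mul_le_cosh_add ha l h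
            have h2 : l * ((μ[X | 𝓕 (k + 1)]) ω - E) =
                l * ((μ[X | 𝓕 k]) ω - E) + l * D ω := by simp only [hD]; ring
            rw [h2, Real.exp_add]
            calc _ ≤ Real.exp (l * ((μ[X | 𝓕 k]) ω - E)) *
                  (Real.cosh (l * a) + D ω * (Real.sinh (l * a) / a)) := by gcongr
              _ = _ := by ring
        _ = Real.cosh (l * a) * ∫ ω, Real.exp (l * ((μ[X | 𝓕 k]) ω - E)) ∂μ := by
            rw [integral_add ((hint k).const_mul _) (hprod.const_mul _), integral_const_mul,
              integral_const_mul, hzero, mul_zero, add_zero]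
        _ ≤ Real.exp ((l * a) ^ 2 / 2) * Real.exp (k * (l * a) ^ 2 / 2) := by
            gcongr
            exact Real.cosh_le_exp_half_sq _
        _ = _ := by
            rw [← Real.exp_add]
            congr 1
            push_cast
            ring
  exact key n le_rfl

/-- If `H ≥ F` is independent of `K`, and `Y` is determined by `F` and `K`, then conditioning `Y`
on `H` is the same as conditioning it on `F`. -/
lemma condExp_eq_of_indep {F H K : MeasurableSpace Ω} (hFH : F ≤ H) (hH : H ≤ mΩ) (hK : K ≤ mΩ)
    (hind : Indep H K μ) {Y : Ω → ℝ} (hY : StronglyMeasurable[F ⊔ K] Y) {R : ℝ}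
    (hR : ∀ ω, |Y ω| ≤ R) : μ[Y | H] =ᵐ[μ] μ[Y | F] := by
  have hF : F ≤ mΩ := hFH.trans hH
  have hFK : F ⊔ K ≤ mΩ := sup_le hF hK
  have hYint : Integrable Y μ :=
    Integrable.of_bound (hY.mono hFK).aestronglyMeasurable R (Eventually.of_forall hR)
  refine (ae_eq_condExp_of_forall_setIntegral_eq hH hYint
      (fun _ _ _ => integrable_condExp.integrableOn)
    (fun A hA _ => ?_) (stronglyMeasurable_condExp.mono hFH).aestronglyMeasurable).symm
  have hA' : MeasurableSet[mΩ] A := hH _ hA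
  -- `φ = 1_A - 𝔼[1_A | F]` integrates to zero over every set of `F ⊔ K`
  set ind : Ω → ℝ := A.indicator fun _ => (1 : ℝ) with hind1
  have hindint : Integrable ind μ := (integrable_const (1 : ℝ)).indicator hA'
  set φ : Ω → ℝ := fun ω => ind ω - (μ[ind | F]) ω with hφ
  have hφint : Integrable φ μ := hindint.sub integrable_condExp
  have hφH : StronglyMeasurable[H] φ :=
    (stronglyMeasurable_const.indicator hA).sub (stronglyMeasurable_condExp.mono hFH)
  have hφset : ∀ E, MeasurableSet[F] E → ∫ ω in E, φ ω ∂μ = 0 := by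
    intro E hE
    rw [hφ, integral_sub hindint.integrableOn integrable_condExp.integrableOn,
      setIntegral_condExp hF hindint hE, sub_self]
  have hgen : F ⊔ K = MeasurableSpace.generateFrom
      {s | ∃ B D, MeasurableSet[F] B ∧ MeasurableSet[K] D ∧ s = B ∩ D} := by
    apply le_antisymm
    · refine sup_le (fun s hs => ?_) (fun s hs => ?_)
      · exact MeasurableSpace.measurableSet_generateFrom
          ⟨s, Set.univ, hs, MeasurableSet.univ, by simp⟩
      · exact MeasurableSpace.measurableSet_generateFrom
          ⟨Set.univ, s, MeasurableSet.univ, hs, by simp⟩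
    · refine MeasurableSpace.generateFrom_le ?_
      rintro s ⟨B, D, hB, hD, rfl⟩
      exact MeasurableSet.inter (le_sup_left (a := F) _ hB) (le_sup_right (b := K) _ hD)
  have hpi : IsPiSystem {s | ∃ B D, MeasurableSet[F] B ∧ MeasurableSet[K] D ∧ s = B ∩ D} := by
    rintro _ ⟨B, D, hB, hD, rfl⟩ _ ⟨B', D', hB', hD', rfl⟩ _
    exact ⟨B ∩ B', D ∩ D', hB.inter hB', hD.inter hD', Set.inter_inter_inter_comm _ _ _ _⟩
  have hφFK : ∀ E, MeasurableSet[F ⊔ K] E → ∫ ω in E, φ ω ∂μ = 0 := by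
    refine fun E hE => MeasurableSpace.induction_on_inter (m := F ⊔ K)
      (C := fun E _ => ∫ ω in E, φ ω ∂μ = 0) hgen hpi (by simp) ?_ ?_ ?_ E hE
    · rintro _ ⟨B, D, hB, hD, rfl⟩
      have hBm : MeasurableSet[mΩ] B := hF _ hB
      have hDm : MeasurableSet[mΩ] D := hK _ hD
      have h1 : ∫ ω in B ∩ D, φ ω ∂μ =
          ∫ ω, (B.indicator φ) ω * (D.indicator fun _ => (1 : ℝ)) ω ∂μ := by
        rw [← integral_indicator (hBm.inter hDm)]
        congr 1 with ω
        by_cases hb : ω ∈ B <;> by_cases hd : ω ∈ D <;> simp [hb, hd]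
      have hi : IndepFun (B.indicator φ) (D.indicator fun _ => (1 : ℝ)) μ := by
        rw [IndepFun_iff_Indep]
        refine indep_of_indep_of_le_left (indep_of_indep_of_le_right hind ?_) ?_
        · exact (Measurable.indicator (m := K) measurable_const hD).comap_le
        · exact ((hφH.indicator (hFH _ hB)).measurable).comap_le
      rw [h1, hi.integral_fun_mul_eq_mul_integral ((hφint.indicator hBm).aestronglyMeasurable)
        ((integrable_const (1 : ℝ)).indicator hDm).aestronglyMeasurable,
        integral_indicator hBm, hφset B hB, zero_mul]
    · intro t ht h
      rw [setIntegral_compl (hFK _ ht) hφint, h, sub_zero, ← setIntegral_univ]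
      exact hφset _ MeasurableSet.univ
    · intro f hd hf h
      rw [integral_iUnion (fun i => hFK _ (hf i)) hd hφint.integrableOn]
      simp [h]
  have hφ0 : μ[φ | F ⊔ K] =ᵐ[μ] 0 := by
    refine (ae_eq_condExp_of_forall_setIntegral_eq hFK hφint (fun _ _ _ => integrableOn_zero)
      (fun E hE _ => ?_) stronglyMeasurable_zero.aestronglyMeasurable).symm
    rw [hφFK E hE]; simp
  have hYφ : Integrable (fun ω => Y ω * φ ω) μ :=
    hφint.bdd_mul (hY.mono hFK).aestronglyMeasurable (c := R) (Eventually.of_forall hR)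
  have hzero : ∫ ω, Y ω * φ ω ∂μ = 0 := by
    rw [← integral_condExp hFK]
    have h1 := condExp_mul_of_stronglyMeasurable_left (μ := μ) hY hYφ hφint
    refine integral_eq_zero_of_ae (h1.trans ?_)
    filter_upwards [hφ0] with ω h
    simp [h]
  have hYind : Integrable (fun ω => Y ω * ind ω) μ :=
    hindint.bdd_mul (hY.mono hFK).aestronglyMeasurable (c := R) (Eventually.of_forall hR)
  have hYce : Integrable (fun ω => Y ω * (μ[ind | F]) ω) μ :=
    integrable_condExp.bdd_mul (hY.mono hFK).aestronglyMeasurable (c := R)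
      (Eventually.of_forall hR)
  have e1 : ∫ ω in A, Y ω ∂μ = ∫ ω, Y ω * ind ω ∂μ := by
    rw [← integral_indicator hA']
    congr 1 with ω
    by_cases h : ω ∈ A <;> simp [hind1, h]
  have e2 : ∫ ω, Y ω * ind ω ∂μ = ∫ ω, Y ω * (μ[ind | F]) ω ∂μ := by
    rw [← sub_eq_zero, ← integral_sub hYind hYce, ← hzero]
    congr 1 with ω
    simp only [hφ]; ring
  have hceint : Integrable (fun ω => (μ[Y | F]) ω * ind ω) μ := by
    have : (fun ω => (μ[Y | F]) ω * ind ω) = A.indicator (μ[Y | F]) := by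
      ext ω
      by_cases h : ω ∈ A <;> simp [hind1, h]
    rw [this]
    exact integrable_condExp.indicator hA'
  have e3 : ∫ ω, Y ω * (μ[ind | F]) ω ∂μ = ∫ ω, (μ[Y | F]) ω * (μ[ind | F]) ω ∂μ := by
    rw [← integral_condExp hF]
    exact integral_congr_ae
      (condExp_mul_of_stronglyMeasurable_right stronglyMeasurable_condExp hYce hYint)
  have e4 : ∫ ω, (μ[Y | F]) ω * ind ω ∂μ = ∫ ω, (μ[Y | F]) ω * (μ[ind | F]) ω ∂μ := by
    rw [← integral_condExp hF]
    exact integral_congr_ae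
      (condExp_mul_of_stronglyMeasurable_left stronglyMeasurable_condExp hceint hindint)
  rw [e1, e2, e3, ← e4, ← integral_indicator hA']
  congr 1 with ω
  by_cases h : ω ∈ A <;> simp [hind1, h]

end Concentration

/-! ### Concentration of the resolvent trace -/

section RowSigma

open Matrix

lemma measurable_inv_apply {Ω : Type*} {m : MeasurableSpace Ω} {ι : Type*} [Fintype ι]
    [DecidableEq ι] {M : Ω → Matrix ι ι ℝ} (hM : ∀ i j, Measurable fun ω => M ω i j) (i j : ι) :
    Measurable fun ω => (M ω)⁻¹ i j := by
  have hM' : Measurable (fun ω => (fun i j => M ω i j : ι → ι → ℝ)) :=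
    measurable_pi_iff.2 fun i => measurable_pi_iff.2 fun j => hM i j
  have hc : Continuous (fun x : ι → ι → ℝ => (of x : Matrix ι ι ℝ)) := continuous_id
  have h1 : Measurable fun ω => (M ω).det :=
    (Continuous.matrix_det hc).measurable.comp hM'
  have h2 : Measurable fun ω => (M ω).adjugate i j :=
    ((Continuous.matrix_adjugate hc).matrix_elem i j).measurable.comp hM'
  simp only [inv_def, Ring.inverse_eq_inv', Matrix.smul_apply, smul_eq_mul]
  exact h1.inv.mul h2

variable {Ω : Type*} {n N : ℕ} {A : Ω → Matrix (Fin n) (Fin N) ℝ}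

lemma measurable_rowSigma {I : Set (Fin n)} {i : Fin n} (hi : i ∈ I) (j : Fin N) :
    Measurable[rowSigma A I] fun ω => A ω i j := by
  have h1 : MeasurableSpace.comap (fun ω => (fun j => A ω i j : Fin N → ℝ)) inferInstance ≤
      rowSigma A I := le_iSup₂ (f := fun i (_ : i ∈ I) =>
        MeasurableSpace.comap (fun ω => (fun j => A ω i j : Fin N → ℝ)) inferInstance) i hi
  exact ((measurable_pi_apply j).comp (comap_measurable _)).mono h1 le_rfl

lemma rowSigma_le [mΩ : MeasurableSpace Ω] (hA : ∀ i j, Measurable fun ω => A ω i j)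
    (I : Set (Fin n)) : rowSigma A I ≤ mΩ :=
  iSup₂_le fun i _ => (measurable_pi_iff.2 fun j => hA i j).comap_le

lemma rowSigma_mono {I J : Set (Fin n)} (h : I ⊆ J) : rowSigma A I ≤ rowSigma A J :=
  biSup_mono h

lemma rowSigma_union (I J : Set (Fin n)) :
    rowSigma A (I ∪ J) = rowSigma A I ⊔ rowSigma A J := iSup_union

lemma measurable_inv_regGram_of {m : MeasurableSpace Ω} {I : Finset (Fin n)}
    (hA : ∀ k ∈ I, ∀ j, Measurable fun ω => A ω k j) (s t : ℝ) (i j : Fin N) :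
    Measurable fun ω => (regGram s t (fun k l => A ω k l) I)⁻¹ i j := by
  refine measurable_inv_apply (fun i j => ?_) i j
  simp only [regGram, Matrix.add_apply, Matrix.smul_apply, Matrix.sum_apply, vecMulVec_apply,
    smul_eq_mul]
  exact ((Finset.measurable_fun_sum _ fun k hk =>
    (hA k hk i).mul (hA k hk j)).const_mul _).const_add _

lemma measurable_inv_regGram {I : Finset (Fin n)} {J : Set (Fin n)} (hIJ : ∀ i ∈ I, i ∈ J)
    (s t : ℝ) (i j : Fin N) :
    Measurable[rowSigma A J] fun ω => (regGram s t (fun k l => A ω k l) I)⁻¹ i j :=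
  measurable_inv_regGram_of (m := rowSigma A J) (fun k hk => measurable_rowSigma (hIJ k hk)) s t i j

/-- The normalized trace `(1/n) tr (t + (1/n) ∑_{k ∈ I} r_k r_kᵀ)⁻¹` of the `N × N` resolvent built
from the rows `r_k`, `k ∈ I`, of an `n × N` matrix. -/
noncomputable def rowTrace (t : ℝ) (A : Matrix (Fin n) (Fin N) ℝ) (I : Finset (Fin n)) : ℝ :=
  1 / n * ((regGram (1 / n) t (fun k j => A k j) I)⁻¹).trace

lemma measurable_rowTrace_of {m : MeasurableSpace Ω} {I : Finset (Fin n)}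
    (hA : ∀ k ∈ I, ∀ j, Measurable fun ω => A ω k j) (t : ℝ) :
    Measurable fun ω => rowTrace t (A ω) I :=
  (Finset.measurable_fun_sum _ fun k _ => measurable_inv_regGram_of hA _ t k k).const_mul _

lemma measurable_rowTrace {I : Finset (Fin n)} {J : Set (Fin n)} (hIJ : ∀ i ∈ I, i ∈ J) (t : ℝ) :
    Measurable[rowSigma A J] fun ω => rowTrace t (A ω) I :=
  measurable_rowTrace_of (m := rowSigma A J) (fun k hk => measurable_rowSigma (hIJ k hk)) t

lemma rowTrace_nonneg {t : ℝ} (ht : 0 < t) (A : Matrix (Fin n) (Fin N) ℝ) (I : Finset (Fin n)) :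
    0 ≤ rowTrace t A I :=
  mul_nonneg (by positivity) (Finset.sum_nonneg fun k _ =>
    (coercive_regGram (by positivity) t _ I).inv_apply_self_nonneg ht k)

lemma rowTrace_le {t : ℝ} (ht : 0 < t) (A : Matrix (Fin n) (Fin N) ℝ) (I : Finset (Fin n)) :
    rowTrace t A I ≤ N / n / t := by
  have h : ((regGram (1 / n : ℝ) t (fun k j => A k j) I)⁻¹).trace ≤ ∑ _k : Fin N, 1 / t :=
    Finset.sum_le_sum fun k _ => le_trans (le_abs_self _)
      ((coercive_regGram (by positivity) t _ I).abs_inv_le ht k k)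
  rw [Finset.sum_const, Finset.card_univ, Fintype.card_fin, nsmul_eq_mul] at h
  calc rowTrace t A I ≤ 1 / n * (N * (1 / t)) := by
        unfold rowTrace; gcongr
    _ = _ := by ring

lemma abs_rowTrace_le {t : ℝ} (ht : 0 < t) (A : Matrix (Fin n) (Fin N) ℝ) (I : Finset (Fin n)) :
    |rowTrace t A I| ≤ N / n / t := by
  rw [abs_of_nonneg (rowTrace_nonneg ht A I)]; exact rowTrace_le ht A I

lemma abs_rowTrace_univ_sub_le {t : ℝ} (ht : 0 < t) (A : Matrix (Fin n) (Fin N) ℝ)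
    {I J : Finset (Fin n)} (hIJ : I ∪ J = Finset.univ) :
    |rowTrace t A Finset.univ - rowTrace t A I| ≤ J.card / (t * n) := by
  have h := trace_inv_regGram_union (s := 1 / (n : ℝ)) (by positivity) ht (fun k j => A k j) I J
  rw [hIJ] at h
  have hn : (0 : ℝ) ≤ 1 / n := by positivity
  have e : (J.card : ℝ) / (t * n) = 1 / n * (J.card / t) := by ring
  rw [rowTrace, rowTrace, ← mul_sub, abs_mul, abs_of_nonneg hn, e]
  gcongr
  rw [abs_le]
  constructor
  · linarith [h.2]
  · have : (0 : ℝ) ≤ J.card / t := by positivity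
    linarith [h.1]

/-- Exponential concentration of the normalized resolvent trace for matrices whose rows are
`b`-dependent: revealing one more row changes the conditional expectation by at most
`2 (b + 1) / (t n)`, because the trace without the next `b + 1` rows does not feel it. -/
lemma integral_exp_rowTrace_sub_le [mΩ : MeasurableSpace Ω] {μ : Measure Ω}
    [IsProbabilityMeasure μ] (hA : ∀ i j, Measurable fun ω => A ω i j) {b : ℕ}
    (hind : ∀ I J : Set (Fin n),
      (∀ i ∈ I, ∀ j ∈ J, (b : ℤ) < |((i : ℕ) : ℤ) - ((j : ℕ) : ℤ)|) →
        Indep (rowSigma A I) (rowSigma A J) μ)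
    {t : ℝ} (ht : 0 < t) (hn : 0 < n) (l : ℝ) :
    ∫ ω, Real.exp (l * (rowTrace t (A ω) Finset.univ -
        ∫ ω', rowTrace t (A ω') Finset.univ ∂μ)) ∂μ ≤
      Real.exp (n * (l * (2 * (b + 1) / (t * n))) ^ 2 / 2) := by
  set X : Ω → ℝ := fun ω => rowTrace t (A ω) Finset.univ with hX
  set 𝓕 : ℕ → MeasurableSpace Ω := fun k => rowSigma A {i | (i : ℕ) < k} with h𝓕
  have hle : ∀ k, 𝓕 k ≤ mΩ := fun k => rowSigma_le hA _
  have hXR : ∀ ω, |X ω| ≤ N / n / t := fun ω => abs_rowTrace_le ht _ _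
  have hXm : ∀ I : Finset (Fin n), StronglyMeasurable fun ω => rowTrace t (A ω) I := fun I =>
    (measurable_rowTrace_of (fun k _ j => hA k j) t).stronglyMeasurable
  have hXint : ∀ I : Finset (Fin n), Integrable (fun ω => rowTrace t (A ω) I) μ := fun I =>
    Integrable.of_bound (hXm I).aestronglyMeasurable (N / n / t)
      (Eventually.of_forall fun ω => abs_rowTrace_le ht _ _)
  have hlast : μ[X | 𝓕 n] = X := by
    refine condExp_of_stronglyMeasurable (hle n) ?_ (hXint _)
    exact (measurable_rowTrace (J := {i : Fin n | (i : ℕ) < n})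
      (fun i _ => i.2) t).stronglyMeasurable
  have hmain := integral_exp_condExp_sub_le (μ := μ) 𝓕 (n := n) (X := X)
    (a := 2 * (b + 1) / (t * n))
    (fun k k' hk => rowSigma_mono fun i (hi : (i : ℕ) < k) => lt_of_lt_of_le hi hk) hle
    (by simp [h𝓕, rowSigma]) hXR (by positivity) ?_ l
  · rw [hlast] at hmain
    exact hmain
  intro k hk
  -- the trace without the rows `k, …, k + b`
  set J : Finset (Fin n) := Finset.univ.filter fun i => k ≤ (i : ℕ) ∧ (i : ℕ) ≤ k + b with hJ
  set Y : Ω → ℝ := fun ω => rowTrace t (A ω) Jᶜ with hY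
  have hJcard : (J.card : ℝ) ≤ b + 1 := by
    have h1 : (J.image fun i : Fin n => (i : ℕ)) ⊆ Finset.Icc k (k + b) := by
      intro x hx
      obtain ⟨i, hi, rfl⟩ := Finset.mem_image.1 hx
      simpa [hJ] using hi
    have h2 := Finset.card_le_card h1
    rw [Finset.card_image_of_injective _ Fin.val_injective, Nat.card_Icc] at h2
    have : J.card ≤ b + 1 := by omega
    exact_mod_cast this
  have hXY : ∀ ω, |X ω - Y ω| ≤ (b + 1) / (t * n) := by
    intro ω
    refine (abs_rowTrace_univ_sub_le ht (A ω) (I := Jᶜ) (J := J) ?_).trans ?_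
    · rw [Finset.union_comm]; exact Finset.union_compl J
    · have : (0 : ℝ) < t * n := by positivity
      gcongr
  have hYeq : μ[Y | 𝓕 (k + 1)] =ᵐ[μ] μ[Y | 𝓕 k] := by
    refine condExp_eq_of_indep (K := rowSigma A {i : Fin n | k + b < (i : ℕ)})
      (rowSigma_mono fun i (hi : (i : ℕ) < k) => Nat.lt_succ_of_lt hi) (hle _) (rowSigma_le hA _)
      (hind _ _ ?_) ?_ (fun ω => abs_rowTrace_le ht _ _)
    · intro i hi j hj
      have hi' : (i : ℕ) < k + 1 := hi
      have hj' : k + b < (j : ℕ) := hj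
      rw [lt_abs]
      right
      omega
    · change StronglyMeasurable[rowSigma A {i : Fin n | (i : ℕ) < k} ⊔
        rowSigma A {i : Fin n | k + b < (i : ℕ)}] Y
      rw [← rowSigma_union]
      refine (measurable_rowTrace (fun i hi => ?_) t).stronglyMeasurable
      simp only [hJ, Finset.compl_filter, Finset.mem_filter, Finset.mem_univ, true_and] at hi
      simp only [Set.mem_union, Set.mem_ofPred_eq]
      omega
  have hdiff : ∀ k', ∀ᵐ ω ∂μ, |(μ[X | 𝓕 k']) ω - (μ[Y | 𝓕 k']) ω| ≤ (b + 1) / (t * n) := by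
    intro k'
    have h1 := condExp_sub (hXint Finset.univ) (hXint Jᶜ) (𝓕 k')
    have h2 := ae_bdd_abs_condExp_of_ae_bdd_abs (μ := μ) (m := 𝓕 k') (f := X - Y)
      (R := (b + 1) / (t * n)) (Eventually.of_forall hXY)
    filter_upwards [h1, h2] with ω a1 a2
    have a1' : (μ[X - Y | 𝓕 k']) ω = (μ[X | 𝓕 k']) ω - (μ[Y | 𝓕 k']) ω := a1
    rw [← a1']
    exact a2
  filter_upwards [hdiff k, hdiff (k + 1), hYeq] with ω a1 a2 a3
  rw [a3] at a2
  have e : (μ[X | 𝓕 (k + 1)]) ω - (μ[X | 𝓕 k]) ω =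
      ((μ[X | 𝓕 (k + 1)]) ω - (μ[Y | 𝓕 k]) ω) - ((μ[X | 𝓕 k]) ω - (μ[Y | 𝓕 k]) ω) := by ring
  rw [e]
  refine (abs_sub _ _).trans ((add_le_add a2 a1).trans_eq ?_)
  ring

end RowSigma

/-! ### A moment bound for quadratic forms -/

section QuadraticForm

open Matrix

variable {ι : Type*} [Fintype ι]

/-- Deterministic bound behind the concentration of quadratic forms. Here `m2` and `m4` stand for
the arrays of (conditional) second and fourth mixed moments of a random vector `ζ`, so that the
left-hand side is the second moment of `∑ B i j ζ i ζ j - tr B`. -/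
lemma quadForm_moment_le (B : ι → ι → ℝ) (m2 : ι → ι → ℝ) (m4 : ι → ι → ι → ι → ℝ)
    {b R ε ε' : ℝ} (hε : 0 ≤ ε) (hε' : 0 ≤ ε') (hR : 0 ≤ R) (hb0 : 0 ≤ b)
    (hb : ∀ i j, |B i j| ≤ b) (hsq : ∀ i, ∑ j, B i j ^ 2 ≤ b ^ 2) (hrow : ∀ i, ∑ j, |B i j| ≤ R)
    (hsymm : ∀ i j, B i j = B j i)
    (h2 : ∀ i j, i ≠ j → |m2 i j| ≤ ε)
    (h3 : ∀ i j l, j ≠ l → |m4 i i j l| ≤ ε)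
    (h4 : ∀ i j l m, i ≠ j → i ≠ l → i ≠ m → j ≠ l → j ≠ m → l ≠ m → |m4 i j l m| ≤ ε')
    (hp1 : ∀ i j l m, m4 i j l m = m4 j i l m) (hp2 : ∀ i j l m, m4 i j l m = m4 i l j m)
    (hp3 : ∀ i j l m, m4 i j l m = m4 i j m l) :
    (∑ i, ∑ j, ∑ l, ∑ m, B i j * B l m * m4 i j l m) -
        2 * (∑ i, B i i) * (∑ i, ∑ j, B i j * m2 i j) + (∑ i, B i i) ^ 2 ≤
      ε' * (Fintype.card ι * R) ^ 2 + 2 * (ε * b * (Fintype.card ι * (Fintype.card ι * R))) +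
        3 * b ^ 2 * (∑ i, ∑ j, |m4 i i j j - 1|) + 2 * (Fintype.card ι * b ^ 2) +
        4 * (ε * (Fintype.card ι * R ^ 2)) +
        2 * (Fintype.card ι * b) * (b * (∑ i, |m2 i i - 1|) + ε * (Fintype.card ι * R)) := by
  classical
  set c : ℝ := (Fintype.card ι : ℝ) with hc
  set T := ∑ i, B i i with hT
  set D4 := ∑ i, ∑ j, |m4 i i j j - 1| with hD4
  set D2 := ∑ i, |m2 i i - 1| with hD2
  have hsumc : ∀ {f : ι → ℝ} {K : ℝ}, (∀ i, f i ≤ K) → ∑ i, f i ≤ c * K := by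
    intro f K h
    calc ∑ i, f i ≤ ∑ _i : ι, K := Finset.sum_le_sum fun i _ => h i
      _ = c * K := by simp [hc]
  have hS : ∑ i, ∑ j, |B i j| ≤ c * R := hsumc hrow
  have hS0 : 0 ≤ ∑ i, ∑ j, |B i j| :=
      Finset.sum_nonneg fun i _ => Finset.sum_nonneg fun j _ => abs_nonneg _
  have hcol : ∀ i, ∑ j, |B j i| ≤ R := fun i => by simp_rw [hsymm _ i]; exact hrow i
  have hrow0 : ∀ i, 0 ≤ ∑ j, |B i j| := fun i => Finset.sum_nonneg fun j _ => abs_nonneg _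
  have hTabs : |T| ≤ c * b := (Finset.abs_sum_le_sum_abs _ _).trans (hsumc fun i => hb i i)
  -- the fourth-order part, entry by entry
  have hpt : ∀ i j l m,
      B i j * B l m * (m4 i j l m - (if i = j then 1 else 0) * (if l = m then 1 else 0)) ≤
      ε' * (|B i j| * |B l m|) + (if i = j then ε * b * |B l m| else 0) +
      (if l = m then ε * b * |B i j| else 0) +
      (if i = j then (if l = m then b ^ 2 * |m4 i i l l - 1| else 0) else 0) +
      (if i = l then (if j = m then B i j ^ 2 + b ^ 2 * |m4 i i j j - 1| else 0) else 0) +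
      (if i = m then (if j = l then B i j ^ 2 + b ^ 2 * |m4 i i j j - 1| else 0) else 0) +
      (if i = l then ε * (|B i j| * |B i m|) else 0) +
      (if i = m then ε * (|B i j| * |B l i|) else 0) +
      (if j = l then ε * (|B i j| * |B j m|) else 0) +
      (if j = m then ε * (|B i j| * |B l j|) else 0) := by
    intro i j l m
    have g1 : 0 ≤ ε' * (|B i j| * |B l m|) := by positivity
    have g2 : 0 ≤ (if i = j then ε * b * |B l m| else 0) := by split_ifs <;> positivity
    have g3 : 0 ≤ (if l = m then ε * b * |B i j| else 0) := by split_ifs <;> positivity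
    have g4 : 0 ≤ (if i = j then (if l = m then b ^ 2 * |m4 i i l l - 1| else 0) else 0) := by
      split_ifs <;> positivity
    have g5 : 0 ≤ (if i = l then (if j = m then B i j ^ 2 + b ^ 2 * |m4 i i j j - 1| else 0)
      else 0) := by split_ifs <;> positivity
    have g6 : 0 ≤ (if i = m then (if j = l then B i j ^ 2 + b ^ 2 * |m4 i i j j - 1| else 0)
      else 0) := by split_ifs <;> positivity
    have g7 : 0 ≤ (if i = l then ε * (|B i j| * |B i m|) else 0) := by split_ifs <;> positivity
    have g8 : 0 ≤ (if i = m then ε * (|B i j| * |B l i|) else 0) := by split_ifs <;> positivity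
    have g9 : 0 ≤ (if j = l then ε * (|B i j| * |B j m|) else 0) := by split_ifs <;> positivity
    have g10 : 0 ≤ (if j = m then ε * (|B i j| * |B l j|) else 0) := by split_ifs <;> positivity
    have hle : ∀ {x y z e : ℝ}, |z| ≤ e → x * y * z ≤ e * (|x| * |y|) := by
      intro x y z e hz
      calc x * y * z ≤ |x * y * z| := le_abs_self _
        _ = |z| * (|x| * |y|) := by rw [abs_mul, abs_mul]; ring
        _ ≤ e * (|x| * |y|) := by gcongr
    have hBsq : ∀ i j, B i j ^ 2 ≤ b ^ 2 :=
        fun i j => sq_le_sq' (abs_le.1 (hb i j)).1 (abs_le.1 (hb i j)).2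
    have hpair : ∀ i j, B i j * B i j * m4 i i j j ≤ B i j ^ 2 + b ^ 2 * |m4 i i j j - 1| := by
      intro i j
      have h1 : B i j ^ 2 * (m4 i i j j - 1) ≤ b ^ 2 * |m4 i i j j - 1| :=
        (mul_le_mul_of_nonneg_left (le_abs_self _) (sq_nonneg _)).trans
          (mul_le_mul_of_nonneg_right (hBsq i j) (abs_nonneg _))
      nlinarith
    -- each configuration of coincidences among the indices is controlled by one of the terms
    suffices h : ∃ x ∈ [ε' * (|B i j| * |B l m|),
        (if i = j then ε * b * |B l m| else 0),
        (if l = m then ε * b * |B i j| else 0),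
        (if i = j then (if l = m then b ^ 2 * |m4 i i l l - 1| else 0) else 0),
        (if i = l then (if j = m then B i j ^ 2 + b ^ 2 * |m4 i i j j - 1| else 0) else 0),
        (if i = m then (if j = l then B i j ^ 2 + b ^ 2 * |m4 i i j j - 1| else 0) else 0),
        (if i = l then ε * (|B i j| * |B i m|) else 0),
        (if i = m then ε * (|B i j| * |B l i|) else 0),
        (if j = l then ε * (|B i j| * |B j m|) else 0),
        (if j = m then ε * (|B i j| * |B l j|) else 0)],
        B i j * B l m * (m4 i j l m - (if i = j then 1 else 0) * (if l = m then 1 else 0)) ≤ x by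
      simp only [List.mem_cons, List.not_mem_nil, or_false, exists_eq_or_imp, exists_eq_left] at h
      rcases h with h | h | h | h | h | h | h | h | h | h <;> linarith
    by_cases hij : i = j
    · subst hij
      by_cases hlm : l = m
      · subst hlm
        refine ⟨_, List.getElem_mem (by decide : 3 < 10), ?_⟩
        have h1 := hle (x := B i i) (y := B l l) (z := m4 i i l l - 1) le_rfl
        have h2 : |m4 i i l l - 1| * (|B i i| * |B l l|) ≤ b ^ 2 * |m4 i i l l - 1| := by
          rw [mul_comm, sq]
          have := hb i i
          have := hb l l
          gcongr
        simpa using h1.trans h2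
      · refine ⟨_, List.getElem_mem (by decide : 1 < 10), ?_⟩
        have h1 := hle (x := B i i) (y := B l m) (h3 i l m hlm)
        have h2 : ε * (|B i i| * |B l m|) ≤ ε * b * |B l m| := by
          rw [mul_assoc]
          have := hb i i
          gcongr
        simpa [hlm] using h1.trans h2
    · have hδ : (if i = j then (1 : ℝ) else 0) * (if l = m then 1 else 0) = 0 := by
        rw [if_neg hij, zero_mul]
      rw [hδ, sub_zero]
      by_cases hlm : l = m
      · subst hlm
        refine ⟨_, List.getElem_mem (by decide : 2 < 10), ?_⟩
        have h0 : m4 i j l l = m4 l l i j := by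
          rw [hp2 i j l l, hp1 i l j l, hp3 l i j l, hp2 l i l j]
        have h1 := hle (x := B i j) (y := B l l) (z := m4 i j l l) (h0 ▸ h3 l i j hij)
        have h2 : ε * (|B i j| * |B l l|) ≤ ε * b * |B i j| := by
          rw [mul_comm |B i j|, mul_assoc]
          have := hb l l
          gcongr
        simpa using h1.trans h2
      · by_cases hil : i = l
        · subst hil
          by_cases hjm : j = m
          · subst hjm
            refine ⟨_, List.getElem_mem (by decide : 4 < 10), ?_⟩
            rw [hp2 i j i j]
            simpa using hpair i j
          · refine ⟨_, List.getElem_mem (by decide : 6 < 10), ?_⟩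
            have h1 := hle (x := B i j) (y := B i m) (h3 i j m hjm)
            rw [hp2 i j i m]
            simpa using h1
        · by_cases him : i = m
          · subst him
            by_cases hjl : j = l
            · subst hjl
              refine ⟨_, List.getElem_mem (by decide : 5 < 10), ?_⟩
              rw [hp3 i j j i, hp2 i j i j, hsymm j i]
              simpa using hpair i j
            · refine ⟨_, List.getElem_mem (by decide : 7 < 10), ?_⟩
              have h1 := hle (x := B i j) (y := B l i) (h3 i j l hjl)
              rw [hp3 i j l i, hp2 i j i l]
              simpa using h1
          · by_cases hjl : j = l
            · subst hjl
              refine ⟨_, List.getElem_mem (by decide : 8 < 10), ?_⟩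
              have h1 := hle (x := B i j) (y := B j m) (h3 j i m him)
              rw [hp1 i j j m, hp2 j i j m]
              simpa using h1
            · by_cases hjm : j = m
              · subst hjm
                refine ⟨_, List.getElem_mem (by decide : 9 < 10), ?_⟩
                have h1 := hle (x := B i j) (y := B l j) (h3 j i l hil)
                rw [hp1 i j l j, hp3 j i l j, hp2 j i j l]
                simpa using h1
              · refine ⟨_, List.getElem_mem (by decide : 0 < 10), ?_⟩
                exact hle (h4 i j l m hij hil him hjl hjm hlm)
  have hfour : (∑ i, ∑ j, ∑ l, ∑ m, B i j * B l m * m4 i j l m) - T ^ 2 ≤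
      ε' * (c * R) ^ 2 + 2 * (ε * b * (c * (c * R))) + 3 * b ^ 2 * D4 + 2 * (c * b ^ 2) +
        4 * (ε * (c * R ^ 2)) := by
    have hT2 : T ^ 2 = ∑ i, ∑ j, ∑ l, ∑ m,
        B i j * B l m * ((if i = j then 1 else 0) * (if l = m then 1 else 0)) := by
      have e : ∀ i j l m, B i j * B l m * ((if i = j then 1 else 0) * (if l = m then 1 else 0)) =
          (B i j * (if i = j then 1 else 0)) * (B l m * (if l = m then 1 else 0)) := by
        intros; ring
      simp_rw [e, ← Finset.mul_sum, ← Finset.sum_mul]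
      simp [hT, sq]
    have hsum := Finset.sum_le_sum fun (i : ι) (_ : i ∈ Finset.univ) => Finset.sum_le_sum
      fun (j : ι) (_ : j ∈ Finset.univ) => Finset.sum_le_sum fun l (_ : l ∈ Finset.univ) =>
      Finset.sum_le_sum fun (m : ι) (_ : m ∈ Finset.univ) => hpt i j l m
    have hlhs : (∑ i, ∑ j, ∑ l, ∑ m, B i j * B l m * m4 i j l m) - T ^ 2 =
        ∑ i, ∑ j, ∑ l, ∑ m, B i j * B l m *
          (m4 i j l m - (if i = j then 1 else 0) * (if l = m then 1 else 0)) := by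
      rw [hT2]
      simp only [mul_sub, Finset.sum_sub_distrib]
    rw [hlhs]
    refine hsum.trans ?_
    simp only [Finset.sum_add_distrib]
    have s1 : ∑ i, ∑ j, ∑ l, ∑ m, ε' * (|B i j| * |B l m|) ≤ ε' * (c * R) ^ 2 := by
      simp_rw [← Finset.mul_sum, ← Finset.sum_mul, sq]
      gcongr
    have s2 : ∑ i : ι, ∑ j : ι, ∑ l : ι, ∑ m : ι, (if i = j then ε * b * |B l m| else 0) ≤
        ε * b * (c * (c * R)) := by
      have e : ∀ i : ι, ∑ j : ι, ∑ l : ι, ∑ m : ι, (if i = j then ε * b * |B l m| else 0) ≤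
          ε * b * (c * R) := by
        intro i
        rw [Finset.sum_eq_single i (fun j _ hj => by simp [hj.symm]) (by simp)]
        simp only [if_true, ← Finset.mul_sum]
        gcongr
      calc _ ≤ c * (ε * b * (c * R)) := hsumc e
        _ = _ := by ring
    have s3 : ∑ i : ι, ∑ j : ι, ∑ l : ι, ∑ m : ι, (if l = m then ε * b * |B i j| else 0) ≤
        ε * b * (c * (c * R)) := by
      have e : ∀ i j : ι, ∑ l : ι, ∑ m : ι, (if l = m then ε * b * |B i j| else 0) =
          c * (ε * b * |B i j|) := by
        intro i j
        simp [hc]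
      simp_rw [e, ← Finset.mul_sum]
      calc c * (ε * b * ∑ i, ∑ j, |B i j|) ≤ c * (ε * b * (c * R)) := by gcongr
        _ = _ := by ring
    have s4 : ∑ i : ι, ∑ j : ι, ∑ l : ι, ∑ m : ι,
        (if i = j then (if l = m then b ^ 2 * |m4 i i l l - 1| else 0) else 0) = b ^ 2 * D4 := by
      have e : ∀ i : ι, ∑ j : ι, ∑ l : ι, ∑ m : ι,
          (if i = j then (if l = m then b ^ 2 * |m4 i i l l - 1| else 0) else 0) =
          b ^ 2 * ∑ l, |m4 i i l l - 1| := by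
        intro i
        rw [Finset.sum_eq_single i (fun j _ hj => by simp [hj.symm]) (by simp)]
        simp [Finset.mul_sum]
      simp_rw [e, ← Finset.mul_sum, hD4]
    have hsq2 : ∑ i, ∑ j, (B i j ^ 2 + b ^ 2 * |m4 i i j j - 1|) ≤ c * b ^ 2 + b ^ 2 * D4 := by
      simp only [Finset.sum_add_distrib, ← Finset.mul_sum]
      exact add_le_add_left (hsumc hsq) _
    have s5 : ∑ i : ι, ∑ j : ι, ∑ l : ι, ∑ m : ι,
        (if i = l then (if j = m then B i j ^ 2 + b ^ 2 * |m4 i i j j - 1| else 0) else 0) ≤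
        c * b ^ 2 + b ^ 2 * D4 := by
      refine le_trans (le_of_eq ?_) hsq2
      refine Finset.sum_congr rfl fun i _ => Finset.sum_congr rfl fun j _ => ?_
      rw [Finset.sum_eq_single i (fun l _ hl => by simp [hl.symm]) (by simp)]
      simp
    have s6 : ∑ i : ι, ∑ j : ι, ∑ l : ι, ∑ m : ι,
        (if i = m then (if j = l then B i j ^ 2 + b ^ 2 * |m4 i i j j - 1| else 0) else 0) ≤
        c * b ^ 2 + b ^ 2 * D4 := by
      refine le_trans (le_of_eq ?_) hsq2
      refine Finset.sum_congr rfl fun i _ => Finset.sum_congr rfl fun j _ => ?_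
      rw [Finset.sum_eq_single j (fun l _ hl => by simp [hl.symm]) (by simp)]
      simp
    have s7 : ∑ i : ι, ∑ j : ι, ∑ l : ι, ∑ m : ι, (if i = l then ε * (|B i j| * |B i m|) else 0) ≤
        ε * (c * R ^ 2) := by
      have e : ∀ i : ι, ∑ j : ι, ∑ l : ι, ∑ m : ι, (if i = l then ε * (|B i j| * |B i m|) else 0) ≤
          ε * R ^ 2 := by
        intro i
        have : ∀ j, ∑ l, ∑ m, (if i = l then ε * (|B i j| * |B i m|) else 0) =
            ε * (|B i j| * ∑ m, |B i m|) := by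
          intro j
          rw [Finset.sum_eq_single i (fun l _ hl => by simp [hl.symm]) (by simp)]
          simp [Finset.mul_sum]
        simp_rw [this, ← Finset.mul_sum, ← Finset.sum_mul, sq]
        have := hrow i
        have := hrow0 i
        gcongr
      calc _ ≤ c * (ε * R ^ 2) := hsumc e
        _ = _ := by ring
    have s8 : ∑ i : ι, ∑ j : ι, ∑ l : ι, ∑ m : ι, (if i = m then ε * (|B i j| * |B l i|) else 0) ≤
        ε * (c * R ^ 2) := by
      have e : ∀ i : ι, ∑ j : ι, ∑ l : ι, ∑ m : ι, (if i = m then ε * (|B i j| * |B l i|) else 0) ≤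
          ε * R ^ 2 := by
        intro i
        simp only [Finset.sum_ite_eq, Finset.mem_univ, if_true]
        simp_rw [← Finset.mul_sum, ← Finset.sum_mul, sq]
        have := hrow i
        have := hcol i
        have := hrow0 i
        gcongr
      calc _ ≤ c * (ε * R ^ 2) := hsumc e
        _ = _ := by ring
    have s9 : ∑ i : ι, ∑ j : ι, ∑ l : ι, ∑ m : ι, (if j = l then ε * (|B i j| * |B j m|) else 0) ≤
        ε * (c * R ^ 2) := by
      rw [Finset.sum_comm]
      have e : ∀ j : ι, ∑ i : ι, ∑ l : ι, ∑ m : ι, (if j = l then ε * (|B i j| * |B j m|) else 0) ≤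
          ε * R ^ 2 := by
        intro j
        have : ∀ i, ∑ l, ∑ m, (if j = l then ε * (|B i j| * |B j m|) else 0) =
            ε * (|B i j| * ∑ m, |B j m|) := by
          intro i
          rw [Finset.sum_eq_single j (fun l _ hl => by simp [hl.symm]) (by simp)]
          simp [Finset.mul_sum]
        simp_rw [this, ← Finset.mul_sum, ← Finset.sum_mul, sq]
        have := hrow j
        have := hcol j
        have := hrow0 j
        gcongr
      calc _ ≤ c * (ε * R ^ 2) := hsumc e
        _ = _ := by ring
    have s10 : ∑ i : ι, ∑ j : ι, ∑ l : ι, ∑ m : ι, (if j = m then ε * (|B i j| * |B l j|) else 0) ≤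
        ε * (c * R ^ 2) := by
      rw [Finset.sum_comm]
      have e : ∀ j : ι, ∑ i : ι, ∑ l : ι, ∑ m : ι, (if j = m then ε * (|B i j| * |B l j|) else 0) ≤
          ε * R ^ 2 := by
        intro j
        simp only [Finset.sum_ite_eq, Finset.mem_univ, if_true]
        simp_rw [← Finset.mul_sum, ← Finset.sum_mul, sq]
        have := hcol j
        have : 0 ≤ ∑ i, |B i j| := Finset.sum_nonneg fun i _ => abs_nonneg _
        gcongr
      calc _ ≤ c * (ε * R ^ 2) := hsumc e
        _ = _ := by ring
    linarith
  -- the second-order part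
  have htwo : |(∑ i, ∑ j, B i j * m2 i j) - T| ≤ b * D2 + ε * (c * R) := by
    have e : (∑ i, ∑ j, B i j * m2 i j) - T =
        ∑ i, ∑ j, B i j * (m2 i j - if i = j then 1 else 0) := by
      simp only [mul_sub, Finset.sum_sub_distrib]
      simp [hT]
    have hpt2 : ∀ i j, |B i j * (m2 i j - if i = j then 1 else 0)| ≤
        (if i = j then b * |m2 i i - 1| else 0) + ε * |B i j| := by
      intro i j
      rw [abs_mul]
      by_cases hij : i = j
      · subst hij
        simp only [if_true]
        have h1 : |B i i| * |m2 i i - 1| ≤ b * |m2 i i - 1| := by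
          gcongr; exact hb i i
        have : 0 ≤ ε * |B i i| := by positivity
        linarith
      · simp only [hij, if_false, sub_zero, zero_add]
        rw [mul_comm]
        gcongr
        exact h2 i j hij
    rw [e]
    refine (Finset.abs_sum_le_sum_abs _ _).trans ((Finset.sum_le_sum fun i _ =>
      (Finset.abs_sum_le_sum_abs _ _).trans (Finset.sum_le_sum fun j _ => hpt2 i j)).trans ?_)
    simp only [Finset.sum_add_distrib, Finset.sum_ite_eq, Finset.mem_univ, if_true,
      ← Finset.mul_sum]
    gcongr
  have h5 : -(2 * T * ((∑ i, ∑ j, B i j * m2 i j) - T)) ≤ 2 * (c * b) * (b * D2 + ε * (c * R)) := by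
    refine (neg_le_abs _).trans ?_
    rw [abs_mul, abs_mul, abs_two]
    gcongr
  linarith

end QuadraticForm

/-! ### Quadratic forms in a row -/

section RowQuadraticForm

open Matrix

variable {Ω : Type*} [mΩ : MeasurableSpace Ω] {μ : Measure Ω}

lemma integrable_mul_mul_mul {f g h k : Ω → ℝ} (hf : Measurable f) (hg : Measurable g)
    (hh : Measurable h) (hk : Measurable k) (if4 : Integrable (fun ω => |f ω| ^ 4) μ)
    (ig4 : Integrable (fun ω => |g ω| ^ 4) μ) (ih4 : Integrable (fun ω => |h ω| ^ 4) μ)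
    (ik4 : Integrable (fun ω => |k ω| ^ 4) μ) :
    Integrable (fun ω => f ω * g ω * h ω * k ω) μ := by
  refine Integrable.mono' (((if4.add ig4).add ih4).add ik4)
    (((hf.mul hg).mul hh).mul hk).aestronglyMeasurable (Eventually.of_forall fun ω => ?_)
  simp only [Pi.add_apply, Real.norm_eq_abs, abs_mul]
  set a := |f ω|
  set b := |g ω|
  set c := |h ω|
  set d := |k ω|
  nlinarith [sq_nonneg (a * b - c * d), sq_nonneg (a ^ 2 - b ^ 2), sq_nonneg (c ^ 2 - d ^ 2),
    sq_nonneg (a ^ 2), sq_nonneg (b ^ 2), sq_nonneg (c ^ 2), sq_nonneg (d ^ 2)]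

variable [IsProbabilityMeasure μ]

lemma integrable_mul_of_fourth {f g : Ω → ℝ} (hf : Measurable f) (hg : Measurable g)
    (if4 : Integrable (fun ω => |f ω| ^ 4) μ) (ig4 : Integrable (fun ω => |g ω| ^ 4) μ) :
    Integrable (fun ω => f ω * g ω) μ := by
  have h1 : Integrable (fun _ : Ω => |(1 : ℝ)| ^ 4) μ := integrable_const _
  simpa using integrable_mul_mul_mul hf hg measurable_const measurable_const if4 ig4 h1 h1

/-- Random variables `Z p` in a sum with bounded `m`-measurable weights may be replaced by their
conditional expectations under the integral. -/
lemma integral_sum_mul_condExp {m : MeasurableSpace Ω} (hm : m ≤ mΩ) {P : Type*} [Fintype P]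
    {W Z : P → Ω → ℝ} {K : ℝ} (hW : ∀ p, StronglyMeasurable[m] (W p)) (hK : ∀ p ω, |W p ω| ≤ K)
    (hZ : ∀ p, Integrable (Z p) μ) :
    Integrable (fun ω => ∑ p, W p ω * Z p ω) μ ∧
    Integrable (fun ω => ∑ p, W p ω * (μ[Z p | m]) ω) μ ∧
    ∫ ω, ∑ p, W p ω * Z p ω ∂μ = ∫ ω, ∑ p, W p ω * (μ[Z p | m]) ω ∂μ := by
  have h1 : ∀ p, Integrable (fun ω => W p ω * Z p ω) μ := fun p =>
    (hZ p).bdd_mul ((hW p).mono hm).aestronglyMeasurable (c := K) (Eventually.of_forall (hK p))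
  have h2 : ∀ p, Integrable (fun ω => W p ω * (μ[Z p | m]) ω) μ := fun p =>
    integrable_condExp.bdd_mul ((hW p).mono hm).aestronglyMeasurable (c := K)
      (Eventually.of_forall (hK p))
  refine ⟨integrable_finsetSum _ fun p _ => h1 p, integrable_finsetSum _ fun p _ => h2 p, ?_⟩
  rw [integral_finsetSum _ fun p _ => h1 p, integral_finsetSum _ fun p _ => h2 p]
  refine Finset.sum_congr rfl fun p _ => ?_
  rw [← integral_condExp hm]
  exact integral_congr_ae (condExp_mul_of_stronglyMeasurable_left (hW p) (h1 p) (hZ p))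

variable {n N : ℕ} {A : Ω → Matrix (Fin n) (Fin N) ℝ}

/-- The normalized quadratic form `ξ_k = (1/n) r_kᵀ G r_k` of row `k` in the resolvent `G` built
from the other rows. -/
noncomputable def rowForm (t : ℝ) (A : Matrix (Fin n) (Fin N) ℝ) (k : Fin n) : ℝ :=
  1 / n * (A k ⬝ᵥ ((regGram (1 / n) t (fun k j => A k j) {k}ᶜ)⁻¹ *ᵥ A k))

/-- The mean square distance of `ξ_k` to the normalized trace of its resolvent, bounded in terms of
the conditional mixed moments of row `k` given the other rows. -/
lemma integral_sq_rowForm_sub_le (hA : ∀ i j, Measurable fun ω => A ω i j)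
    (hA4 : ∀ i j, Integrable (fun ω => |A ω i j| ^ 4) μ) (k : Fin n) {t ε ε' : ℝ} (ht : 0 < t)
    (hε : 0 ≤ ε) (hε' : 0 ≤ ε')
    (h2 : ∀ᵐ ω ∂μ, ∀ i j : Fin N, i ≠ j →
      |rowCondExp μ A k (fun ω' => A ω' k i * A ω' k j) ω| ≤ ε)
    (h3 : ∀ᵐ ω ∂μ, ∀ i j l : Fin N, j ≠ l →
      |rowCondExp μ A k (fun ω' => A ω' k i ^ 2 * A ω' k j * A ω' k l) ω| ≤ ε)
    (h4 : ∀ᵐ ω ∂μ, ∀ i j l m : Fin N, [i, j, l, m].Nodup →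
      |rowCondExp μ A k (fun ω' => A ω' k i * A ω' k j * A ω' k l * A ω' k m) ω| ≤ ε') :
    Integrable (fun ω => (rowForm t (A ω) k - rowTrace t (A ω) {k}ᶜ) ^ 2) μ ∧
    ∫ ω, (rowForm t (A ω) k - rowTrace t (A ω) {k}ᶜ) ^ 2 ∂μ ≤ (1 / n) ^ 2 *
      (ε' * (N * (√N / t)) ^ 2 + 2 * (ε * (1 / t) * (N * (N * (√N / t)))) +
        3 * (1 / t) ^ 2 * (∑ i : Fin N, ∑ j : Fin N,
          ∫ ω, |rowCondExp μ A k (fun ω' => A ω' k i ^ 2 * A ω' k j ^ 2) ω - 1| ∂μ) +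
        2 * (N * (1 / t) ^ 2) + 4 * (ε * (N * (√N / t) ^ 2)) +
        2 * (N * (1 / t)) * (1 / t * (∑ i : Fin N,
          ∫ ω, |rowCondExp μ A k (fun ω' => A ω' k i ^ 2) ω - 1| ∂μ) + ε * (N * (√N / t)))) := by
  have hm : rowSigma A {k}ᶜ ≤ mΩ := rowSigma_le hA _
  set B : Ω → Fin N → Fin N → ℝ := fun ω i j =>
    (regGram (1 / (n : ℝ)) t (fun k j => A ω k j) {k}ᶜ)⁻¹ i j with hB
  set b := 1 / t with hb
  have hb0 : 0 ≤ b := by positivity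
  have hco : ∀ ω, Coercive t (regGram (1 / (n : ℝ)) t (fun k j => A ω k j) {k}ᶜ) := fun ω =>
    coercive_regGram (by positivity) t _ _
  have hBm : ∀ i j, StronglyMeasurable[rowSigma A {k}ᶜ] fun ω => B ω i j := fun i j =>
    (measurable_inv_regGram (A := A) (by simp) _ t i j).stronglyMeasurable
  have hBb : ∀ ω i j, |B ω i j| ≤ b := fun ω i j => (hco ω).abs_inv_le ht i j
  have hBsq : ∀ ω i, ∑ j, B ω i j ^ 2 ≤ b ^ 2 := fun ω i => (hco ω).sum_sq_inv_le ht i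
  have hBrow : ∀ ω i, ∑ j, |B ω i j| ≤ √N / t := by
    intro ω i
    have h1 := sq_sum_le_card_mul_sum_sq (s := Finset.univ) (f := fun j => |B ω i j|)
    simp only [sq_abs, Finset.card_univ, Fintype.card_fin] at h1
    have h2 : (∑ j, |B ω i j|) ^ 2 ≤ (√N / t) ^ 2 := by
      rw [div_pow, Real.sq_sqrt (by positivity)]
      refine h1.trans ((mul_le_mul_of_nonneg_left (hBsq ω i) (by positivity)).trans_eq ?_)
      rw [hb]; ring
    exact (abs_le_of_sq_le_sq' h2 (by positivity)).2
  have hBs : ∀ ω i j, B ω i j = B ω j i := fun ω i j =>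
    congrFun (congrFun (hco ω).transpose_inv j) i
  set m2 : Fin N → Fin N → Ω → ℝ := fun i j => rowCondExp μ A k (fun ω' => A ω' k i * A ω' k j)
    with hm2
  set m4 : Fin N → Fin N → Fin N → Fin N → Ω → ℝ := fun i j l q =>
    rowCondExp μ A k (fun ω' => A ω' k i * A ω' k j * A ω' k l * A ω' k q) with hm4
  have hm2sq : ∀ i, m2 i i = rowCondExp μ A k (fun ω' => A ω' k i ^ 2) := fun i => by
    simp only [hm2, sq]
  have hm4sq : ∀ i j, m4 i i j j = rowCondExp μ A k (fun ω' => A ω' k i ^ 2 * A ω' k j ^ 2) :=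
    fun i j => by simp only [hm4, sq, mul_assoc]
  have hm43 : ∀ i j l, m4 i i j l =
      rowCondExp μ A k (fun ω' => A ω' k i ^ 2 * A ω' k j * A ω' k l) :=
    fun i j l => by simp only [hm4, sq]
  set T : Ω → ℝ := fun ω => ∑ i, B ω i i with hT
  have hTm : StronglyMeasurable[rowSigma A {k}ᶜ] T :=
      Finset.stronglyMeasurable_fun_sum _ fun i _ => hBm i i
  have hTb : ∀ ω, |T ω| ≤ N * b := by
    intro ω
    refine (Finset.abs_sum_le_sum_abs _ _).trans
      ((Finset.sum_le_sum fun i _ => hBb ω i i).trans_eq ?_)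
    simp
  -- the integrand as a sum of mixed moments with weights determined by the other rows
  have i4 := integral_sum_mul_condExp (μ := μ) hm
    (W := fun (p : Fin N × Fin N × Fin N × Fin N) ω => B ω p.1 p.2.1 * B ω p.2.2.1 p.2.2.2)
    (Z := fun p ω => A ω k p.1 * A ω k p.2.1 * A ω k p.2.2.1 * A ω k p.2.2.2) (K := b * b)
    (fun p => (hBm _ _).mul (hBm _ _))
    (fun p ω => by rw [abs_mul]; exact mul_le_mul (hBb _ _ _) (hBb _ _ _) (abs_nonneg _) hb0)
    (fun p => integrable_mul_mul_mul (hA _ _) (hA _ _) (hA _ _) (hA _ _) (hA4 _ _) (hA4 _ _)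
      (hA4 _ _) (hA4 _ _))
  have i2 := integral_sum_mul_condExp (μ := μ) hm
    (W := fun (p : Fin N × Fin N) ω => -(2 * T ω) * B ω p.1 p.2)
    (Z := fun p ω => A ω k p.1 * A ω k p.2) (K := 2 * (N * b) * b)
    (fun p => ((hTm.const_mul 2).neg).mul (hBm _ _))
    (fun p ω => by
      rw [abs_mul, abs_neg, abs_mul, abs_two]
      have := hTb ω
      have := hBb ω p.1 p.2
      gcongr)
    (fun p => integrable_mul_of_fourth (hA _ _) (hA _ _) (hA4 _ _) (hA4 _ _))
  have iT : Integrable (fun ω => T ω ^ 2) μ := by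
    refine Integrable.of_bound ((hTm.pow 2).mono hm).aestronglyMeasurable ((N * b) ^ 2)
      (Eventually.of_forall fun ω => ?_)
    rw [Real.norm_eq_abs, abs_pow]
    exact pow_le_pow_left₀ (abs_nonneg _) (hTb ω) 2
  have hsq : ∀ ω, (rowForm t (A ω) k - rowTrace t (A ω) {k}ᶜ) ^ 2 = (1 / n : ℝ) ^ 2 *
      ((∑ p : Fin N × Fin N × Fin N × Fin N, (B ω p.1 p.2.1 * B ω p.2.2.1 p.2.2.2) *
          (A ω k p.1 * A ω k p.2.1 * A ω k p.2.2.1 * A ω k p.2.2.2)) +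
        (∑ p : Fin N × Fin N, (-(2 * T ω) * B ω p.1 p.2) * (A ω k p.1 * A ω k p.2)) +
        T ω ^ 2) := by
    intro ω
    have e1 : rowForm t (A ω) k =
        1 / n * ∑ p : Fin N × Fin N, B ω p.1 p.2 * (A ω k p.1 * A ω k p.2) := by
      rw [rowForm, Fintype.sum_prod_type, dotProduct]
      congr 1
      refine Finset.sum_congr rfl fun i _ => ?_
      rw [mulVec, dotProduct, Finset.mul_sum]
      exact Finset.sum_congr rfl fun j _ => by simp only [hB]; ring
    have e2 : rowTrace t (A ω) {k}ᶜ = 1 / n * T ω := rfl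
    have e3 : (∑ p : Fin N × Fin N × Fin N × Fin N, (B ω p.1 p.2.1 * B ω p.2.2.1 p.2.2.2) *
          (A ω k p.1 * A ω k p.2.1 * A ω k p.2.2.1 * A ω k p.2.2.2)) =
        (∑ p : Fin N × Fin N, B ω p.1 p.2 * (A ω k p.1 * A ω k p.2)) ^ 2 := by
      rw [sq, Finset.sum_mul_sum]
      simp only [Fintype.sum_prod_type]
      refine Finset.sum_congr rfl fun i _ => Finset.sum_congr rfl fun j _ =>
        Finset.sum_congr rfl fun l _ => Finset.sum_congr rfl fun q _ => by ring
    have e4 : (∑ p : Fin N × Fin N, (-(2 * T ω) * B ω p.1 p.2) * (A ω k p.1 * A ω k p.2)) =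
        -(2 * T ω) * ∑ p : Fin N × Fin N, B ω p.1 p.2 * (A ω k p.1 * A ω k p.2) := by
      refine (Finset.sum_congr rfl fun p _ => ?_).trans (Finset.mul_sum _ _ _).symm
      ring
    rw [e1, e2, e3, e4]
    ring
  have hD4int : ∀ i j, Integrable (fun ω => |m4 i i j j ω - 1|) μ := fun i j =>
    (integrable_condExp.sub (integrable_const (1 : ℝ))).abs
  have hD2int : ∀ i, Integrable (fun ω => |m2 i i ω - 1|) μ := fun i =>
    (integrable_condExp.sub (integrable_const (1 : ℝ))).abs
  have iD4 : Integrable (fun ω => ∑ i, ∑ j, |m4 i i j j ω - 1|) μ :=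
    integrable_finsetSum _ fun i _ => integrable_finsetSum _ fun j _ => hD4int i j
  have iD2 : Integrable (fun ω => ∑ i, |m2 i i ω - 1|) μ :=
    integrable_finsetSum _ fun i _ => hD2int i
  simp_rw [hsq]
  refine ⟨((i4.1.add i2.1).add iT).const_mul _, ?_⟩
  rw [integral_const_mul]
  refine mul_le_mul_of_nonneg_left ?_ (by positivity)
  have hadd : ∀ {f g h : Ω → ℝ}, Integrable f μ → Integrable g μ → Integrable h μ →
      ∫ ω, (f ω + g ω + h ω) ∂μ = ∫ ω, f ω ∂μ + ∫ ω, g ω ∂μ + ∫ ω, h ω ∂μ := by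
    intro f g h hf hg hh
    rw [integral_add (f := fun ω => f ω + g ω) (hf.add hg) hh, integral_add hf hg]
  rw [hadd i4.1 i2.1 iT, i4.2.2, i2.2.2, ← hadd i4.2.1 i2.2.1 iT]
  -- integrate the deterministic bound
  set D4 : Ω → ℝ := fun ω => ∑ i, ∑ j, |m4 i i j j ω - 1| with hD4
  set D2 : Ω → ℝ := fun ω => ∑ i, |m2 i i ω - 1| with hD2
  set K0 : ℝ := ε' * (N * (√N / t)) ^ 2 + 2 * (ε * b * (N * (N * (√N / t)))) + 2 * (N * b ^ 2) +
    4 * (ε * (N * (√N / t) ^ 2)) + 2 * (N * b) * (ε * (N * (√N / t))) with hK0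
  have hbound : ∀ᵐ ω ∂μ,
      (∑ p : Fin N × Fin N × Fin N × Fin N, (B ω p.1 p.2.1 * B ω p.2.2.1 p.2.2.2) *
          m4 p.1 p.2.1 p.2.2.1 p.2.2.2 ω) +
        (∑ p : Fin N × Fin N, (-(2 * T ω) * B ω p.1 p.2) * m2 p.1 p.2 ω) + T ω ^ 2 ≤
      K0 + 3 * b ^ 2 * D4 ω + 2 * (N * b) * b * D2 ω := by
    filter_upwards [h2, h3, h4] with ω a2 a3 a4
    have h := quadForm_moment_le (B ω) (fun i j => m2 i j ω) (fun i j l q => m4 i j l q ω) (b := b)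
      (R := √N / t) hε hε' (by positivity) hb0 (hBb ω) (hBsq ω) (hBrow ω) (hBs ω)
      a2 (fun i j l hjl => by rw [hm43]; exact a3 i j l hjl)
      (fun i j l q g1 g2 g3 g4 g5 g6 => a4 i j l q (by simp [g1, g2, g3, g4, g5, g6]))
      (fun i j l q => by simp only [hm4, mul_comm (A _ k i) (A _ k j)])
      (fun i j l q => by simp only [hm4, mul_right_comm (A _ k i) (A _ k j)])
      (fun i j l q => by simp only [hm4, mul_right_comm _ (A _ k l)])
    rw [Fintype.card_fin] at h
    have e2 : (∑ p : Fin N × Fin N, (-(2 * T ω) * B ω p.1 p.2) * m2 p.1 p.2 ω) =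
        -(2 * T ω) * ∑ i, ∑ j, B ω i j * m2 i j ω := by
      refine (Finset.sum_congr rfl fun p _ => ?_).trans
        ((Finset.mul_sum _ _ _).symm.trans (congrArg _ (Fintype.sum_prod_type
          (fun p : Fin N × Fin N => B ω p.1 p.2 * m2 p.1 p.2 ω))))
      ring
    have e4 : (∑ p : Fin N × Fin N × Fin N × Fin N, (B ω p.1 p.2.1 * B ω p.2.2.1 p.2.2.2) *
          m4 p.1 p.2.1 p.2.2.1 p.2.2.2 ω) =
        ∑ i, ∑ j, ∑ l, ∑ q, B ω i j * B ω l q * m4 i j l q ω := by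
      simp only [Fintype.sum_prod_type]
    have e5 : D4 ω = ∑ i, ∑ j, |m4 i i j j ω - 1| := rfl
    have e6 : D2 ω = ∑ i, |m2 i i ω - 1| := rfl
    have e7 : T ω = ∑ i, B ω i i := rfl
    rw [← e5, ← e6, ← e7] at h
    rw [e2, e4, hK0]
    linarith
  refine (integral_mono_ae ((i4.2.1.add i2.2.1).add iT)
    (((integrable_const K0).add (iD4.const_mul _)).add (iD2.const_mul _)) hbound).trans
        (le_of_eq ?_)
  have e : ∫ ω, (K0 + 3 * b ^ 2 * D4 ω + 2 * (N * b) * b * D2 ω) ∂μ =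
      K0 + 3 * b ^ 2 * ∫ ω, D4 ω ∂μ + 2 * (N * b) * b * ∫ ω, D2 ω ∂μ := by
    rw [hadd (integrable_const K0) (iD4.const_mul _) (iD2.const_mul _), integral_const_mul,
      integral_const_mul]
    simp
  have e4 : ∫ ω, D4 ω ∂μ = ∑ i : Fin N, ∑ j : Fin N,
      ∫ ω, |rowCondExp μ A k (fun ω' => A ω' k i ^ 2 * A ω' k j ^ 2) ω - 1| ∂μ := by
    rw [hD4, integral_finsetSum _ fun i _ => integrable_finsetSum _ fun j _ => hD4int i j]
    refine Finset.sum_congr rfl fun i _ => ?_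
    rw [integral_finsetSum _ fun j _ => hD4int i j]
    simp_rw [hm4sq]
  have e2 : ∫ ω, D2 ω ∂μ = ∑ i : Fin N,
      ∫ ω, |rowCondExp μ A k (fun ω' => A ω' k i ^ 2) ω - 1| ∂μ := by
    rw [hD2, integral_finsetSum _ fun i _ => hD2int i]
    simp_rw [hm2sq]
  refine e.trans ?_
  rw [e4, e2, hK0]
  ring

end RowQuadraticForm

/-! ### The Marchenko–Pastur equation -/

section RootEquation

open Matrix

/-- The smaller root `u` of `u² - (1 + c + t) u + c = 0`. The Marchenko–Pastur law has
`∫ (x + t)⁻¹ = (1 - u) / t`. -/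
noncomputable def mpRoot (c t : ℝ) : ℝ := ((1 + c + t) - √((1 + c + t) ^ 2 - 4 * c)) / 2

lemma mpRoot_sq {c t : ℝ} (ht : 0 ≤ t) (hc : 0 < c) :
    mpRoot c t ^ 2 - (1 + c + t) * mpRoot c t + c = 0 := by
  have h : 0 ≤ (1 + c + t) ^ 2 - 4 * c := by nlinarith [sq_nonneg (1 - c)]
  have := Real.sq_sqrt h
  unfold mpRoot
  nlinarith

lemma mpRoot_pos {c t : ℝ} (ht : 0 ≤ t) (hc : 0 < c) : 0 < mpRoot c t := by
  have : √((1 + c + t) ^ 2 - 4 * c) < 1 + c + t := by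
    rw [Real.sqrt_lt' (by positivity)]; linarith
  unfold mpRoot; linarith

lemma mpRoot_lt {c t : ℝ} (ht : 0 < t) (hc : 0 < c) : mpRoot c t < 1 ∧ mpRoot c t < c := by
  have hx : ∀ x : ℝ, 0 < x → (1 + c + t) - 2 * x < √((1 + c + t) ^ 2 - 4 * c) → mpRoot c t < x := by
    intro x _ h; unfold mpRoot; linarith
  constructor
  · refine hx 1 one_pos ?_
    apply Real.lt_sqrt_of_sq_lt
    nlinarith
  · refine hx c hc ?_
    apply Real.lt_sqrt_of_sq_lt
    nlinarith

/-- Stability of the Marchenko–Pastur equation `(t h + 1 - c) (1 + h) = 1` on `h ≥ 0`. -/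
lemma abs_sub_le_of_mp_equation {c t h y : ℝ} (ht : 0 < t) (hc : 0 < c) (hh : 0 < h) (hy : 0 ≤ y)
    (heq : (t * h + 1 - c) * (1 + h) = 1) :
    |y - h| ≤ h / c * |(t * y + 1 - c) * (1 + y) - 1| := by
  have e : (t * y + 1 - c) * (1 + y) - 1 = (y - h) * (t * (y + h) + t + 1 - c) := by
    linear_combination heq
  have h1 : c / h ≤ t * (y + h) + t + 1 - c := by
    rw [div_le_iff₀ hh]
    nlinarith [mul_nonneg (mul_nonneg ht.le hy) hh.le]
  have h0 : 0 < c / h := by positivity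
  rw [e, abs_mul, abs_of_pos (h0.trans_le h1)]
  calc |y - h| = h / c * (|y - h| * (c / h)) := by field_simp
    _ ≤ _ := by gcongr

end RootEquation

/-! ### Convergence of the expected trace -/

section Limits

open Matrix

variable {Ω : Type*} [mΩ : MeasurableSpace Ω] {μ : Measure Ω}

variable {N : ℕ → ℕ} {A : (n : ℕ) → Ω → Matrix (Fin n) (Fin (N n)) ℝ} {β : ℕ → ℕ} {c : ℝ}

lemma ConditionC0.tendsto_block_rate (hA : ConditionC0 μ A β) :
    Tendsto (fun n : ℕ => ((β n : ℝ) + 1) ^ 2 / n) atTop (𝓝 0) := by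
  have h1 : Tendsto (fun n : ℕ => (β n : ℝ) / √n) atTop (𝓝 0) :=
      hA.range_isLittleO.tendsto_div_nhds_zero
  have h2 : Tendsto (fun n : ℕ => 1 / √(n : ℝ)) atTop (𝓝 0) := by
    simpa using (tendsto_one_div_atTop_nhds_zero_nat (𝕜 := ℝ)).sqrt
  have h3 := (h1.add h2).pow 2
  simp only [add_zero, ne_eq, OfNat.ofNat_ne_zero, not_false_eq_true, zero_pow] at h3
  refine h3.congr fun n => ?_
  rw [← add_div, div_pow, Real.sq_sqrt (by positivity)]

lemma ConditionC0.measurable_rowTrace (hA : ConditionC0 μ A β) (t : ℝ) (n : ℕ)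
    (I : Finset (Fin n)) :
    Measurable fun ω => rowTrace t (A n ω) I :=
  measurable_rowTrace_of (fun k _ j => hA.measurable n k j) t

variable [IsProbabilityMeasure μ]

lemma integral_abs_le_sqrt {Y : Ω → ℝ} (hY : Integrable Y μ)
    (hY2 : Integrable (fun ω => Y ω ^ 2) μ) : ∫ ω, |Y ω| ∂μ ≤ √(∫ ω, Y ω ^ 2 ∂μ) := by
  apply Real.le_sqrt_of_sq_le
  set m := ∫ ω, |Y ω| ∂μ with hm
  have h : 0 ≤ ∫ ω, (|Y ω| - m) ^ 2 ∂μ := integral_nonneg fun ω => sq_nonneg _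
  have e : ∫ ω, (|Y ω| - m) ^ 2 ∂μ = ∫ ω, Y ω ^ 2 ∂μ - m ^ 2 := by
    have e1 : ∀ ω, (|Y ω| - m) ^ 2 = (Y ω ^ 2 - 2 * m * |Y ω|) + m ^ 2 := by
      intro ω; rw [sub_sq, sq_abs]; ring
    simp_rw [e1]
    rw [integral_add (f := fun ω => Y ω ^ 2 - 2 * m * |Y ω|) (hY2.sub (hY.abs.const_mul _))
      (integrable_const _), integral_sub hY2 (hY.abs.const_mul _), integral_const_mul, ← hm]
    simp
    ring
  linarith

lemma sq_div_two_add_one_le_cosh (x : ℝ) : x ^ 2 / 2 + 1 ≤ Real.cosh x := by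
  have h1 : Real.cosh x = 1 + 2 * Real.sinh (x / 2) ^ 2 := by
    have h := Real.cosh_two_mul (x / 2)
    rw [Real.cosh_sq, show 2 * (x / 2) = x by ring] at h
    linarith
  have h2 : (x / 2) ^ 2 ≤ Real.sinh (x / 2) ^ 2 := by
    rw [← sq_abs (x / 2), ← sq_abs (Real.sinh _), Real.abs_sinh]
    exact pow_le_pow_left₀ (abs_nonneg _) (Real.self_le_sinh_iff.2 (abs_nonneg _)) 2
  rw [h1]
  linarith

/-- Bounded exponential moments of both signs control the second moment, as
`y² ≤ exp y + exp (-y) - 2`. -/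
lemma integral_sq_le_of_exp {Y : Ω → ℝ} {R s : ℝ} (hYm : Measurable Y) (hR : ∀ ω, |Y ω| ≤ R)
    (h1 : ∫ ω, Real.exp (Y ω) ∂μ ≤ s) (h2 : ∫ ω, Real.exp (-Y ω) ∂μ ≤ s) :
    ∫ ω, Y ω ^ 2 ∂μ ≤ 2 * (s - 1) := by
  have hb : ∀ {Z : Ω → ℝ}, Measurable Z → (∀ ω, |Z ω| ≤ R) →
      Integrable (fun ω => Real.exp (Z ω)) μ := by
    intro Z hZ hZR
    refine Integrable.of_bound hZ.exp.aestronglyMeasurable (Real.exp R)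
      (Eventually.of_forall fun ω => ?_)
    rw [Real.norm_eq_abs, Real.abs_exp]
    exact Real.exp_le_exp.2 ((le_abs_self _).trans (hZR ω))
  have i1 := hb hYm hR
  have i2 : Integrable (fun ω => Real.exp (-Y ω)) μ := hb hYm.neg (fun ω => by simpa using hR ω)
  have i3 : Integrable (fun ω => Y ω ^ 2) μ := by
    refine Integrable.of_bound (hYm.pow_const 2).aestronglyMeasurable (R ^ 2)
      (Eventually.of_forall fun ω => ?_)
    rw [Real.norm_eq_abs, abs_pow]
    exact pow_le_pow_left₀ (abs_nonneg _) (hR ω) 2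
  have hpt : ∀ ω, Y ω ^ 2 ≤ Real.exp (Y ω) + Real.exp (-Y ω) - 2 := by
    intro ω
    have := sq_div_two_add_one_le_cosh (Y ω)
    rw [Real.cosh_eq] at this
    linarith
  have h := integral_mono i3 ((i1.add i2).sub (integrable_const 2)) hpt
  have e : ∫ ω, (Real.exp (Y ω) + Real.exp (-Y ω) - 2) ∂μ =
      ∫ ω, Real.exp (Y ω) ∂μ + ∫ ω, Real.exp (-Y ω) ∂μ - 2 := by
    rw [integral_sub (f := fun ω => Real.exp (Y ω) + Real.exp (-Y ω)) (i1.add i2)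
      (integrable_const _), integral_add i1 i2]
    simp
  have h' : ∫ ω, Y ω ^ 2 ∂μ ≤ ∫ ω, (Real.exp (Y ω) + Real.exp (-Y ω) - 2) ∂μ := h
  linarith

/-- Quadratic forms in the rows concentrate around the traces, uniformly over the rows. -/
lemma exists_rowForm_bound (hA : ConditionC0 μ A β)
    (hN : Tendsto (fun n : ℕ => (N n : ℝ) / n) atTop (𝓝 c)) {t : ℝ} (ht : 0 < t) :
    ∃ δ : ℕ → ℝ, Tendsto δ atTop (𝓝 0) ∧ ∀ᶠ n in atTop, ∀ k : Fin n,
      Integrable (fun ω => (rowForm t (A n ω) k - rowTrace t (A n ω) {k}ᶜ) ^ 2) μ ∧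
      ∫ ω, (rowForm t (A n ω) k - rowTrace t (A n ω) {k}ᶜ) ^ 2 ∂μ ≤ δ n := by
  obtain ⟨γ, hγ, ⟨C, hC⟩, ⟨C', hC'⟩⟩ := hA.weakCorrelation
  obtain ⟨M, hM⟩ := hA.fourthMoment
  set v : ℕ → ℝ := fun n => ⨆ k : Fin n, (1 / (n : ℝ)) * ∑ i : Fin (N n),
      ∫ ω, |rowCondExp μ (A n) k (fun ω' => A n ω' k i ^ 2) ω - 1| ∂μ with hv
  set w : ℕ → ℝ := fun n => ⨆ k : Fin n, (1 / (n : ℝ) ^ 2) * ∑ i : Fin (N n), ∑ j : Fin (N n),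
      ∫ ω, |rowCondExp μ (A n) k (fun ω' => A n ω' k i ^ 2 * A n ω' k j ^ 2) ω - 1| ∂μ with hw
  have hv0 : Tendsto v atTop (𝓝 0) := hA.variance
  have hw0 : Tendsto w atTop (𝓝 0) := hA.rowVariance
  have hγ' : Tendsto (fun n => |γ n|) atTop (𝓝 0) := by simpa using hγ.abs
  set x : ℕ → ℝ := fun n => (N n : ℝ) / n with hx
  have hsx : Tendsto (fun n => √(x n)) atTop (𝓝 (√c)) := hN.sqrt
  have hinv : Tendsto (fun n : ℕ => 1 / (n : ℝ)) atTop (𝓝 0) := tendsto_one_div_atTop_nhds_zero_nat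
  have hsinv : Tendsto (fun n : ℕ => 1 / √(n : ℝ)) atTop (𝓝 0) := by
    simpa using hinv.sqrt
  set δ : ℕ → ℝ := fun n => 1 / t ^ 2 * (|C'| * |γ n| * x n ^ 3 +
    4 * (|C| * |γ n| * (x n ^ 2 * √(x n))) + 3 * w n + 2 * (x n * (1 / n)) +
    4 * (|C| * |γ n| * x n ^ 2 * (1 / √n)) + 2 * (x n * v n)) with hδ
  refine ⟨δ, ?_, ?_⟩
  · have : Tendsto δ atTop (𝓝 (1 / t ^ 2 * (|C'| * 0 * c ^ 3 +
      4 * (|C| * 0 * (c ^ 2 * √c)) + 3 * 0 + 2 * (c * 0) +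
      4 * (|C| * 0 * c ^ 2 * 0) + 2 * (c * 0)))) := by
      refine Tendsto.const_mul _ ?_
      refine Tendsto.add (Tendsto.add (Tendsto.add (Tendsto.add (Tendsto.add ?_ ?_) ?_) ?_) ?_) ?_
      · exact (hγ'.const_mul _).mul (hN.pow 3)
      · exact ((hγ'.const_mul _).mul ((hN.pow 2).mul hsx)).const_mul _
      · exact hw0.const_mul _
      · exact (hN.mul hinv).const_mul _
      · exact (((hγ'.const_mul _).mul (hN.pow 2)).mul hsinv).const_mul _
      · exact (hN.mul hv0).const_mul _
    simpa using this
  filter_upwards [hC, hC', eventually_gt_atTop 0] with n h1 h2 hn k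
  have hn' : (0 : ℝ) < n := by exact_mod_cast hn
  have hsn : 0 < √(n : ℝ) := Real.sqrt_pos.2 hn'
  have hmono : ∀ {a b d : ℝ}, 0 ≤ b → a ≤ d * b → a ≤ |d| * b := fun hb h =>
    h.trans (mul_le_mul_of_nonneg_right (le_abs_self _) hb)
  have hmain := integral_sq_rowForm_sub_le (μ := μ) (A := A n) (hA.measurable n)
    (fun i j => (hM n i j).1) k (ε := |C| * (|γ n| / √n)) (ε' := |C'| * (|γ n| / n)) ht
    (by positivity) (by positivity)
    (h1.mono fun ω h i j hij => hmono (by positivity) (h.1 k i j hij))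
    (h1.mono fun ω h i j l hjl => hmono (by positivity) (h.2 k i j l hjl))
    (h2.mono fun ω h i j l m hd => hmono (by positivity) (h k i j l m hd))
  refine ⟨hmain.1, hmain.2.trans ?_⟩
  have hvk : ∑ i : Fin (N n), ∫ ω, |rowCondExp μ (A n) k (fun ω' => A n ω' k i ^ 2) ω - 1| ∂μ ≤
      n * v n := by
    have := le_ciSup (f := fun k : Fin n => (1 / (n : ℝ)) * ∑ i : Fin (N n),
      ∫ ω, |rowCondExp μ (A n) k (fun ω' => A n ω' k i ^ 2) ω - 1| ∂μ)
      (Set.finite_range _).bddAbove k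
    calc _ = n * ((1 / (n : ℝ)) * ∑ i : Fin (N n),
          ∫ ω, |rowCondExp μ (A n) k (fun ω' => A n ω' k i ^ 2) ω - 1| ∂μ) := by field_simp
      _ ≤ _ := mul_le_mul_of_nonneg_left this hn'.le
  have hwk : ∑ i : Fin (N n), ∑ j : Fin (N n),
      ∫ ω, |rowCondExp μ (A n) k (fun ω' => A n ω' k i ^ 2 * A n ω' k j ^ 2) ω - 1| ∂μ ≤
      n ^ 2 * w n := by
    have := le_ciSup (f := fun k : Fin n => (1 / (n : ℝ) ^ 2) * ∑ i : Fin (N n), ∑ j : Fin (N n),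
      ∫ ω, |rowCondExp μ (A n) k (fun ω' => A n ω' k i ^ 2 * A n ω' k j ^ 2) ω - 1| ∂μ)
      (Set.finite_range _).bddAbove k
    calc _ = n ^ 2 * ((1 / (n : ℝ) ^ 2) * ∑ i : Fin (N n), ∑ j : Fin (N n),
          ∫ ω, |rowCondExp μ (A n) k (fun ω' => A n ω' k i ^ 2 * A n ω' k j ^ 2) ω - 1| ∂μ) := by
            field_simp
      _ ≤ _ := mul_le_mul_of_nonneg_left this (by positivity)
  have hNx : (N n : ℝ) = x n * n := by simp only [hx]; field_simp
  have hx0 : 0 ≤ x n := by simp only [hx]; positivity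
  have hsN : √(N n : ℝ) = √(x n) * √n := by rw [hNx, Real.sqrt_mul hx0]
  calc _ ≤ (1 / (n : ℝ)) ^ 2 * (|C'| * (|γ n| / n) * (N n * (√(N n) / t)) ^ 2 +
        2 * (|C| * (|γ n| / √n) * (1 / t) * (N n * (N n * (√(N n) / t)))) +
        3 * (1 / t) ^ 2 * (n ^ 2 * w n) +
        2 * (N n * (1 / t) ^ 2) + 4 * (|C| * (|γ n| / √n) * (N n * (√(N n) / t) ^ 2)) +
        2 * (N n * (1 / t)) * (1 / t * (n * v n) +
          |C| * (|γ n| / √n) * (N n * (√(N n) / t)))) := by gcongr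
    _ = δ n := by
      simp only [hδ]
      rw [hsN, hNx]
      have e1 : √(n : ℝ) ^ 2 = n := Real.sq_sqrt hn'.le
      have e2 : √(x n) ^ 2 = x n := Real.sq_sqrt hx0
      generalize √(x n) = y at e2 ⊢
      generalize √(n : ℝ) = s at e1 hsn ⊢
      generalize x n = z at e2 ⊢
      generalize (n : ℝ) = r at e1 ⊢
      subst e1 e2
      field_simp
      ring

lemma ConditionC0.integrable_rowTrace (hA : ConditionC0 μ A β) {t : ℝ} (ht : 0 < t) (n : ℕ)
    (I : Finset (Fin n)) : Integrable (fun ω => rowTrace t (A n ω) I) μ :=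
  Integrable.of_bound (hA.measurable_rowTrace t n I).aestronglyMeasurable (N n / n / t)
    (Eventually.of_forall fun _ => abs_rowTrace_le ht _ _)

/-- The normalized trace deviates from its mean by `o(1)` in mean square. -/
lemma integral_sq_rowTrace_sub_le (hA : ConditionC0 μ A β) {t : ℝ} (ht : 0 < t) {n : ℕ}
    (hn : 0 < n) :
    ∫ ω, (rowTrace t (A n ω) Finset.univ - ∫ ω', rowTrace t (A n ω') Finset.univ ∂μ) ^ 2 ∂μ ≤
      2 * (Real.exp (2 / t ^ 2 * (((β n : ℝ) + 1) ^ 2 / n)) - 1) := by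
  have hn' : (0 : ℝ) < n := by exact_mod_cast hn
  have hexp := integral_exp_rowTrace_sub_le (μ := μ) (A := A n) (hA.measurable n) (hA.range_indep n)
    ht hn
  set m := ∫ ω', rowTrace t (A n ω') Finset.univ ∂μ
  have e : ∀ l : ℝ, l ^ 2 = 1 → (n : ℝ) * (l * (2 * ((β n : ℝ) + 1) / (t * n))) ^ 2 / 2 =
      2 / t ^ 2 * (((β n : ℝ) + 1) ^ 2 / n) := by
    intro l hl
    rw [mul_pow, hl]
    field_simp
  refine integral_sq_le_of_exp (R := N n / n / t + |m|)
    ((hA.measurable_rowTrace t n _).sub_const m)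
    (fun ω => (abs_sub _ _).trans (add_le_add_left (abs_rowTrace_le ht _ _) _)) ?_ ?_
  · have := hexp 1
    rw [e 1 (by norm_num)] at this
    simpa using this
  · have := hexp (-1)
    rw [e (-1) (by norm_num)] at this
    simpa using this

/-- The expected normalized trace converges to the positive solution of the Marchenko–Pastur
equation. -/
lemma tendsto_integral_rowTrace (hA : ConditionC0 μ A β) (hc : 0 < c)
    (hN : Tendsto (fun n : ℕ => (N n : ℝ) / n) atTop (𝓝 c)) {t : ℝ} (ht : 0 < t) :
    Tendsto (fun n => ∫ ω, rowTrace t (A n ω) Finset.univ ∂μ) atTop (𝓝 ((c - mpRoot c t) / t)) := by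
  obtain ⟨δ, hδ, hδb⟩ := exists_rowForm_bound hA hN ht
  set h : ℕ → ℝ := fun n => ∫ ω, rowTrace t (A n ω) Finset.univ ∂μ with hh
  have hh0 : ∀ n, 0 ≤ h n := fun n => integral_nonneg fun ω => rowTrace_nonneg ht _ _
  set x : ℕ → ℝ := fun n => (N n : ℝ) / n with hx
  have hhx : ∀ n, h n ≤ x n / t := by
    intro n
    have := integral_mono (hA.integrable_rowTrace ht n Finset.univ)
      (integrable_const (μ := μ) ((N n : ℝ) / n / t)) (fun ω => rowTrace_le ht _ _)
    simpa using this
  -- the defect in the Marchenko–Pastur equation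
  set e : ℕ → ℝ := fun n => √(δ n) + 1 / (t * n) +
    √(2 * (Real.exp (2 / t ^ 2 * (((β n : ℝ) + 1) ^ 2 / n)) - 1)) with he
  have he0 : Tendsto e atTop (𝓝 0) := by
    have h1 : Tendsto (fun n => √(δ n)) atTop (𝓝 0) := by simpa using hδ.sqrt
    have h2 : Tendsto (fun n : ℕ => 1 / (t * n)) atTop (𝓝 0) := by
      have := (tendsto_one_div_atTop_nhds_zero_nat (𝕜 := ℝ)).const_mul (1 / t)
      simp only [mul_zero] at this
      refine this.congr fun n => ?_
      rw [one_div_mul_one_div]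
    have h3 : Tendsto (fun n : ℕ => √(2 * (Real.exp (2 / t ^ 2 * (((β n : ℝ) + 1) ^ 2 / n)) - 1)))
        atTop (𝓝 0) := by
      have := (((hA.tendsto_block_rate.const_mul (2 / t ^ 2)).rexp.sub_const 1).const_mul 2).sqrt
      simpa using this
    have := (h1.add h2).add h3
    rwa [add_zero, add_zero] at this
  have hdef : ∀ᶠ n in atTop, |t * h n + 1 - x n - 1 / (1 + h n)| ≤ e n := by
    filter_upwards [hδb, eventually_gt_atTop 0] with n hb hn
    have hn' : (0 : ℝ) < n := by exact_mod_cast hn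
    have hξ0 : ∀ ω k, 0 ≤ rowForm t (A n ω) k := fun ω k =>
      mul_nonneg (by positivity)
        ((coercive_regGram (by positivity) t _ _).dotProduct_inv_nonneg ht _)
    have hξm : ∀ k, Measurable fun ω => rowForm t (A n ω) k := by
      intro k
      refine (Finset.measurable_fun_sum _ fun i _ => (hA.measurable n k i).mul ?_).const_mul _
      have hG : ∀ j, Measurable fun ω =>
          (regGram (1 / (n : ℝ)) t (fun k j => A n ω k j) {k}ᶜ)⁻¹ i j := fun j =>
        measurable_inv_regGram_of (fun k _ j => hA.measurable n k j) _ t i j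
      exact Finset.measurable_fun_sum (f := fun j ω =>
        (regGram (1 / (n : ℝ)) t (fun k j => A n ω k j) {k}ᶜ)⁻¹ i j * A n ω k j) Finset.univ
        fun j _ => (hG j).mul (hA.measurable n k j)
    have hfm : ∀ k, Measurable fun ω => 1 / (1 + rowForm t (A n ω) k) := fun k =>
      ((hξm k).const_add 1).const_div 1
    have hfi : ∀ k, Integrable (fun ω => 1 / (1 + rowForm t (A n ω) k)) μ := by
      intro k
      refine Integrable.of_bound (hfm k).aestronglyMeasurable 1 (Eventually.of_forall fun ω => ?_)
      have := hξ0 ω k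
      rw [Real.norm_eq_abs, abs_of_nonneg (by positivity), div_le_one (by positivity)]
      linarith
    have hid : t * h n + 1 - x n = 1 / n * ∑ k, ∫ ω, 1 / (1 + rowForm t (A n ω) k) ∂μ := by
      have h0 : ∫ ω, 1 / (n : ℝ) * ∑ k, 1 / (1 + rowForm t (A n ω) k) ∂μ =
          1 / n * ∑ k, ∫ ω, 1 / (1 + rowForm t (A n ω) k) ∂μ := by
        rw [integral_const_mul, integral_finsetSum _ fun k _ => hfi k]
      rw [← h0]
      have h1 : ∀ ω, 1 / (n : ℝ) * ∑ k, 1 / (1 + rowForm t (A n ω) k) =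
          t * rowTrace t (A n ω) Finset.univ + (1 - x n) := by
        intro ω
        have h2 := card_eq_trace_inv_add_sum (s := 1 / (n : ℝ)) (by positivity) ht (A n ω)
        rw [Finset.sum_sub_distrib, Fintype.card_fin] at h2
        simp only [Finset.sum_const, Finset.card_univ, Fintype.card_fin, nsmul_eq_mul,
            mul_one] at h2
        have h3 : ∑ k, 1 / (1 + rowForm t (A n ω) k) = t * (regGram (1 / (n : ℝ)) t (A n ω)
            Finset.univ)⁻¹.trace + n - N n := by
          have h4 : ∑ k, 1 / (1 + rowForm t (A n ω) k) = ∑ k, 1 / (1 + 1 / (n : ℝ) *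
            (A n ω k ⬝ᵥ ((regGram (1 / (n : ℝ)) t (A n ω) {k}ᶜ)⁻¹ *ᵥ A n ω k))) := rfl
          rw [h4]
          linarith
        have h5 : rowTrace t (A n ω) Finset.univ =
          1 / n * (regGram (1 / (n : ℝ)) t (A n ω) Finset.univ)⁻¹.trace := rfl
        rw [h3, h5, hx]
        field_simp
        ring
      rw [integral_congr_ae (Eventually.of_forall h1),
        integral_add ((hA.integrable_rowTrace ht n _).const_mul t) (integrable_const _),
        integral_const_mul]
      simp [hh]
      ring
    have hk : ∀ k, |∫ ω, 1 / (1 + rowForm t (A n ω) k) ∂μ - 1 / (1 + h n)| ≤ e n := by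
      intro k
      set Y1 : Ω → ℝ := fun ω => rowForm t (A n ω) k - rowTrace t (A n ω) {k}ᶜ with hY1
      set Y3 : Ω → ℝ := fun ω => rowTrace t (A n ω) Finset.univ - h n with hY3
      have hY1m : Measurable Y1 := (hξm k).sub (hA.measurable_rowTrace t n _)
      have hY1i2 : Integrable (fun ω => Y1 ω ^ 2) μ := (hb k).1
      have hY1i : Integrable Y1 μ := by
        refine Integrable.mono' (hY1i2.add (integrable_const 1)) hY1m.aestronglyMeasurable
          (Eventually.of_forall fun ω => ?_)
        simp only [Pi.add_apply, Real.norm_eq_abs]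
        nlinarith [sq_nonneg (|Y1 ω| - 1), sq_abs (Y1 ω), abs_nonneg (Y1 ω)]
      have hY3m : Measurable Y3 := (hA.measurable_rowTrace t n _).sub_const _
      have hY3i : Integrable Y3 μ := (hA.integrable_rowTrace ht n _).sub (integrable_const _)
      have hY3i2 : Integrable (fun ω => Y3 ω ^ 2) μ := by
        refine Integrable.of_bound (hY3m.pow_const 2).aestronglyMeasurable
          ((N n / n / t + |h n|) ^ 2) (Eventually.of_forall fun ω => ?_)
        rw [Real.norm_eq_abs, abs_pow]
        exact pow_le_pow_left₀ (abs_nonneg _)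
          ((abs_sub _ _).trans (add_le_add_left (abs_rowTrace_le ht _ _) _)) 2
      have hpt : ∀ ω, |1 / (1 + rowForm t (A n ω) k) - 1 / (1 + h n)| ≤
          |Y1 ω| + 1 / (t * n) + |Y3 ω| := by
        intro ω
        have a1 := hξ0 ω k
        have a2 := hh0 n
        have h1 : |1 / (1 + rowForm t (A n ω) k) - 1 / (1 + h n)| ≤
            |rowForm t (A n ω) k - h n| := by
          rw [div_sub_div _ _ (by positivity) (by positivity), abs_div,
            abs_of_pos (a := (1 + rowForm t (A n ω) k) * (1 + h n)) (by positivity)]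
          rw [show 1 * (1 + h n) - (1 + rowForm t (A n ω) k) * 1 =
              -(rowForm t (A n ω) k - h n) by ring,
            abs_neg]
          exact div_le_self (abs_nonneg _) (by nlinarith [mul_nonneg a1 a2])
        have h2 := abs_rowTrace_univ_sub_le ht (A n ω) (I := {k}ᶜ) (J := {k})
          (by rw [Finset.union_comm]; exact Finset.union_compl _)
        rw [Finset.card_singleton, Nat.cast_one] at h2
        have h3 : rowForm t (A n ω) k - h n = Y1 ω -
          (rowTrace t (A n ω) Finset.univ - rowTrace t (A n ω) {k}ᶜ) + Y3 ω := by
          simp only [hY1, hY3]; ring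
        rw [h3] at h1
        have h4 := abs_add_le (Y1 ω - (rowTrace t (A n ω) Finset.univ - rowTrace t (A n ω) {k}ᶜ))
            (Y3 ω)
        have h5 := abs_sub (Y1 ω) (rowTrace t (A n ω) Finset.univ - rowTrace t (A n ω) {k}ᶜ)
        linarith
      have h1 : ∫ ω, 1 / (1 + rowForm t (A n ω) k) ∂μ - 1 / (1 + h n) =
          ∫ ω, (1 / (1 + rowForm t (A n ω) k) - 1 / (1 + h n)) ∂μ := by
        rw [integral_sub (hfi k) (integrable_const _)]; simp
      rw [h1]
      refine (abs_integral_le_integral_abs).trans ?_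
      refine (integral_mono ((hfi k).sub (integrable_const _)).abs
        ((hY1i.abs.add (integrable_const _)).add hY3i.abs) hpt).trans ?_
      have h2 : ∫ ω, (|Y1 ω| + 1 / (t * n) + |Y3 ω|) ∂μ =
          ∫ ω, |Y1 ω| ∂μ + 1 / (t * n) + ∫ ω, |Y3 ω| ∂μ := by
        rw [integral_add (f := fun ω => |Y1 ω| + 1 / (t * n)) (hY1i.abs.add (integrable_const _))
          hY3i.abs, integral_add hY1i.abs (integrable_const _)]
        simp
      refine (le_of_eq h2).trans ?_
      have h3 := (integral_abs_le_sqrt hY1i hY1i2).trans (Real.sqrt_le_sqrt (hb k).2)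
      have h4 := (integral_abs_le_sqrt hY3i hY3i2).trans
        (Real.sqrt_le_sqrt (integral_sq_rowTrace_sub_le hA ht hn))
      simp only [he]
      linarith
    have hsub : t * h n + 1 - x n - 1 / (1 + h n) =
        1 / n * ∑ k : Fin n, (∫ ω, 1 / (1 + rowForm t (A n ω) k) ∂μ - 1 / (1 + h n)) := by
      rw [hid, Finset.sum_sub_distrib]
      simp only [Finset.sum_const, Finset.card_univ, Fintype.card_fin, nsmul_eq_mul]
      field_simp
    rw [hsub, abs_mul, abs_of_nonneg (by positivity)]
    calc 1 / (n : ℝ) * |∑ k : Fin n, (∫ ω, 1 / (1 + rowForm t (A n ω) k) ∂μ - 1 / (1 + h n))|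
        ≤ 1 / (n : ℝ) * ∑ _k : Fin n, e n := by
          gcongr
          exact (Finset.abs_sum_le_sum_abs _ _).trans (Finset.sum_le_sum fun k _ => hk k)
      _ = e n := by
          simp only [Finset.sum_const, Finset.card_univ, Fintype.card_fin, nsmul_eq_mul]
          field_simp
  -- stability of the limiting equation
  have hroot := mpRoot_sq ht.le hc
  have hlt := (mpRoot_lt ht hc).2
  set H := (c - mpRoot c t) / t with hH
  have hHpos : 0 < H := div_pos (by linarith) ht
  have hHeq : (t * H + 1 - c) * (1 + H) = 1 := by
    rw [hH]
    field_simp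
    nlinarith
  rw [tendsto_iff_dist_tendsto_zero]
  have hbnd : Tendsto (fun n => H / c * ((e n + |x n - c|) * (1 + x n / t))) atTop (𝓝 0) := by
    have h1 : Tendsto (fun n => |x n - c|) atTop (𝓝 0) := by simpa using (hN.sub_const c).abs
    have h2 := ((he0.add h1).mul ((hN.div_const t).const_add 1)).const_mul (H / c)
    simpa using h2
  refine squeeze_zero' (Eventually.of_forall fun n => dist_nonneg) ?_ hbnd
  filter_upwards [hdef] with n hd
  rw [Real.dist_eq]
  refine (abs_sub_le_of_mp_equation ht hc hHpos (hh0 n) hHeq).trans ?_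
  have h0 := hh0 n
  have h1 : (t * h n + 1 - c) * (1 + h n) - 1 =
      ((t * h n + 1 - x n - 1 / (1 + h n)) + (x n - c)) * (1 + h n) := by
    field_simp
    ring
  rw [h1, abs_mul, abs_of_pos (a := 1 + h n) (by positivity)]
  gcongr
  · exact (abs_add_le _ _).trans (add_le_add_left hd _)
  · exact hhx n

end Limits

/-! ### Almost sure convergence of the trace -/

section AlmostSure

lemma exp_neg_div_le {q κ y : ℝ} (hq : 0 < q) (hκ : 0 < κ) (hy : 0 < y) :
    Real.exp (-(κ / y)) ≤ (q / κ) ^ q * y ^ q := by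
  have h1 : κ / y / q ≤ Real.exp (κ / y / q) := by
    have := Real.add_one_le_exp (κ / y / q)
    linarith
  have h2 : (κ / y / q) ^ q ≤ Real.exp (κ / y) := by
    calc (κ / y / q) ^ q ≤ Real.exp (κ / y / q) ^ q := by gcongr
      _ = Real.exp (κ / y) := by
        rw [← Real.exp_mul]
        congr 1
        field_simp
  have h3 : (q / κ) ^ q * y ^ q = ((κ / y / q) ^ q)⁻¹ := by
    rw [← Real.mul_rpow (by positivity) hy.le, ← Real.inv_rpow (by positivity)]
    congr 1
    field_simp
  rw [h3, Real.exp_neg]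
  exact inv_anti₀ (by positivity) h2

variable {Ω : Type*} [mΩ : MeasurableSpace Ω] {μ : Measure Ω} [IsProbabilityMeasure μ]
  {N : ℕ → ℕ} {A : (n : ℕ) → Ω → Matrix (Fin n) (Fin (N n)) ℝ} {β : ℕ → ℕ}

/-- Gaussian-type tail bound for the normalized trace, by optimizing over the exponential
moments. -/
lemma measureReal_rowTrace_sub_le (hA : ConditionC0 μ A β) {t : ℝ} (ht : 0 < t) {n : ℕ}
    (hn : 0 < n) {ε : ℝ} (hε : 0 < ε) :
    μ.real {ω | ε ≤ |rowTrace t (A n ω) Finset.univ -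
        ∫ ω', rowTrace t (A n ω') Finset.univ ∂μ|} ≤
      2 * Real.exp (-(ε ^ 2 * t ^ 2 / 8 / (((β n : ℝ) + 1) ^ 2 / n))) := by
  have hn' : (0 : ℝ) < n := by exact_mod_cast hn
  have hexp := integral_exp_rowTrace_sub_le (μ := μ) (A := A n) (hA.measurable n) (hA.range_indep n)
    ht hn
  set m := ∫ ω', rowTrace t (A n ω') Finset.univ ∂μ
  set Y : Ω → ℝ := fun ω => rowTrace t (A n ω) Finset.univ - m with hY
  set y : ℝ := ((β n : ℝ) + 1) ^ 2 / n with hy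
  have hy0 : 0 < y := by positivity
  -- the minimizer of the Chernoff exponent `-l ε + 2 l² y / t²`
  set l : ℝ := ε * t ^ 2 / (4 * y) with hl
  have hl0 : 0 < l := by positivity
  have e : ∀ l' : ℝ, l' ^ 2 = l ^ 2 → (n : ℝ) * (l' * (2 * ((β n : ℝ) + 1) / (t * n))) ^ 2 / 2 =
      l * ε / 2 := by
    intro l' hl'
    rw [mul_pow, hl', hl, hy]
    field_simp
    ring
  have hb : ∀ {Z : Ω → ℝ}, Measurable Z → (∀ ω, |Z ω| ≤ N n / n / t + |m|) →
      ∫ ω, Real.exp (l * Z ω) ∂μ ≤ Real.exp (l * ε / 2) →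
      μ.real {ω | ε ≤ Z ω} ≤ Real.exp (-(ε ^ 2 * t ^ 2 / 8 / y)) := by
    intro Z hZ hZb h
    have hint : Integrable (fun ω => Real.exp (l * Z ω)) μ := by
      refine Integrable.of_bound (hZ.const_mul l).exp.aestronglyMeasurable
        (Real.exp (l * (N n / n / t + |m|))) (Eventually.of_forall fun ω => ?_)
      rw [Real.norm_eq_abs, Real.abs_exp]
      exact Real.exp_le_exp.2 (mul_le_mul_of_nonneg_left ((le_abs_self _).trans (hZb ω)) hl0.le)
    refine (measure_ge_le_exp_mul_mgf ε hl0.le hint).trans ?_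
    calc Real.exp (-l * ε) * mgf Z μ l ≤ Real.exp (-l * ε) * Real.exp (l * ε / 2) := by
          gcongr
          exact h
      _ = Real.exp (-(ε ^ 2 * t ^ 2 / 8 / y)) := by
          rw [← Real.exp_add]
          congr 1
          rw [hl]
          field_simp
          ring
  have hYm : Measurable Y := (hA.measurable_rowTrace t n _).sub_const m
  have hYb : ∀ ω, |Y ω| ≤ N n / n / t + |m| := fun ω =>
    (abs_sub _ _).trans (add_le_add_left (abs_rowTrace_le ht _ _) _)
  have h1 := hb hYm hYb (by have := hexp l; rwa [e l rfl] at this)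
  have h2 := hb (Z := fun ω => -Y ω) hYm.neg (fun ω => by rw [abs_neg]; exact hYb ω) (by
    have := hexp (-l)
    rw [e (-l) (by ring)] at this
    simpa using this)
  have hsub : {ω | ε ≤ |Y ω|} ⊆ {ω | ε ≤ Y ω} ∪ {ω | ε ≤ -Y ω} := fun ω hω => by
    rcases le_abs.1 (show ε ≤ |Y ω| from hω) with h | h
    · exact Or.inl h
    · exact Or.inr h
  calc μ.real {ω | ε ≤ |Y ω|} ≤ μ.real ({ω | ε ≤ Y ω} ∪ {ω | ε ≤ -Y ω}) := measureReal_mono hsub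
    _ ≤ _ := measureReal_union_le _ _
    _ ≤ _ := by linarith

/-- Under the summability condition on the dependency range, the normalized trace is
asymptotically deterministic almost surely. -/
lemma ae_tendsto_rowTrace_sub (hA : ConditionC0 μ A β)
    (hp : ∃ p : ℝ, 1 < p ∧ Summable (fun n : ℕ => ((β n : ℝ) + 1) ^ p / (n : ℝ) ^ (p / 2)))
    {t : ℝ} (ht : 0 < t) :
    ∀ᵐ ω ∂μ, Tendsto (fun n => rowTrace t (A n ω) Finset.univ -
      ∫ ω', rowTrace t (A n ω') Finset.univ ∂μ) atTop (𝓝 0) := by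
  obtain ⟨p, hp1, hsum⟩ := hp
  set Y : ℕ → Ω → ℝ := fun n ω => rowTrace t (A n ω) Finset.univ -
      ∫ ω', rowTrace t (A n ω') Finset.univ ∂μ with hY
  have key : ∀ ε : ℝ, 0 < ε → ∀ᵐ ω ∂μ, ∀ᶠ n in atTop, |Y n ω| < ε := by
    intro ε hε
    set κ := ε ^ 2 * t ^ 2 / 8 with hκ
    have hκ0 : 0 < κ := by positivity
    set q := p / 2 with hq
    have hq0 : 0 < q := by positivity
    set K : ℕ → ℝ := fun n => 2 * (q / κ) ^ q * (((β n : ℝ) + 1) ^ p / (n : ℝ) ^ (p / 2)) with hK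
    have hKsum : Summable K := hsum.mul_left _
    have hK0 : ∀ n, 0 ≤ K n := fun n => by positivity
    set s : ℕ → Set Ω := fun n => {ω | 0 < n ∧ ε ≤ |Y n ω|} with hs
    have hμ : ∀ n, μ (s n) ≤ ENNReal.ofReal (K n) := by
      intro n
      rcases Nat.eq_zero_or_pos n with rfl | hn
      · simp [hs]
      · have hn' : (0 : ℝ) < n := by exact_mod_cast hn
        have h1 : s n = {ω | ε ≤ |Y n ω|} := by
          ext ω; simp [hs, hn]
        rw [h1, ← ofReal_measureReal]
        refine ENNReal.ofReal_le_ofReal ((measureReal_rowTrace_sub_le hA ht hn hε).trans ?_)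
        have h2 := exp_neg_div_le hq0 hκ0 (y := ((β n : ℝ) + 1) ^ 2 / n) (by positivity)
        have h3 : (((β n : ℝ) + 1) ^ 2 / n) ^ q = ((β n : ℝ) + 1) ^ p / (n : ℝ) ^ (p / 2) := by
          rw [Real.div_rpow (by positivity) hn'.le, ← Real.rpow_natCast_mul (by positivity)]
          congr 2
          rw [hq]; push_cast; ring
        rw [h3] at h2
        calc _ ≤ 2 * ((q / κ) ^ q * (((β n : ℝ) + 1) ^ p / (n : ℝ) ^ (p / 2))) := by gcongr
          _ = K n := by rw [hK]; ring
    have hts : ∑' n, μ (s n) ≠ ∞ := by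
      refine ne_top_of_le_ne_top ?_ (ENNReal.tsum_le_tsum hμ)
      rw [← ENNReal.ofReal_tsum_of_nonneg hK0 hKsum]
      exact ENNReal.ofReal_ne_top
    filter_upwards [ae_eventually_notMem hts] with ω hω
    filter_upwards [hω, eventually_gt_atTop 0] with n h1 h2
    by_contra h3
    exact h1 ⟨h2, not_lt.1 h3⟩
  have key' : ∀ᵐ ω ∂μ, ∀ k : ℕ, ∀ᶠ n in atTop, |Y n ω| < 1 / ((k : ℝ) + 1) :=
    ae_all_iff.2 fun k => key _ (by positivity)
  filter_upwards [key'] with ω hω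
  rw [Metric.tendsto_atTop']
  intro ε hε
  obtain ⟨k, hk⟩ := exists_nat_one_div_lt hε
  obtain ⟨n0, hn0⟩ := eventually_atTop.1 (hω k)
  refine ⟨n0, fun n hn => ?_⟩
  rw [Real.dist_eq, sub_zero]
  exact (hn0 n hn.le).trans hk

end AlmostSure

/-! ### Resolvent functions as test functions -/

section TestFunctions

open unitInterval

/-- The function `y ↦ y / (1 - y / (k + 2))` on `[0, 1]`. In the coordinate `y = 1 / (1 + x)`,
`x ≥ 0`, it is the resolvent function `x ↦ 1 / (x + t)` at `t = (k + 1) / (k + 2)`. -/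
noncomputable def resolventFun (k : ℕ) : C(I, ℝ) where
  toFun y := y / (1 - y / (k + 2))
  continuous_toFun := by
    refine Continuous.div (by fun_prop) (by fun_prop) fun y => ?_
    have h1 : (y : ℝ) ≤ 1 := y.2.2
    have h2 : (y : ℝ) / (k + 2) < 1 := by
      rw [div_lt_one (by positivity)]
      have : (0 : ℝ) ≤ k := by positivity
      linarith
    linarith

/-- The point `t` at which `resolventFun k` evaluates the resolvent. -/
noncomputable def resolventPoint (k : ℕ) : ℝ := (k + 1) / (k + 2)

lemma resolventPoint_pos (k : ℕ) : 0 < resolventPoint k := by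
  unfold resolventPoint; positivity

/-- A closed subspace of `C([0, 1])` containing the constants and the resolvent functions is
everything: expanding `y / (1 - s y) = y + s y² + s² y³ + ⋯` as `s → 0`, all monomials are limits of
linear combinations of resolvent functions, and polynomials are dense. -/
lemma eq_top_of_resolventFun_mem (V : Submodule ℝ C(I, ℝ)) (hV : IsClosed (V : Set C(I, ℝ)))
    (h1 : 1 ∈ V) (hk : ∀ k, resolventFun k ∈ V) : V = ⊤ := by
  set X : C(I, ℝ) := ⟨fun y => (y : ℝ), continuous_subtype_val⟩ with hX
  have hpow : ∀ j : ℕ, X ^ j ∈ V := by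
    intro j
    induction j using Nat.strong_induction_on with
    | _ j ih =>
      rcases j with _ | j
      · simpa using h1
      · set s : ℕ → ℝ := fun k => 1 / ((k : ℝ) + 2) with hs
        have hs0 : ∀ k, 0 < s k := fun k => by simp only [hs]; positivity
        have hs1 : ∀ k, s k ≤ 1 / 2 := fun k => by
          simp only [hs]
          have : (0 : ℝ) ≤ k := by positivity
          exact one_div_le_one_div_of_le (by norm_num) (by linarith)
        set F : ℕ → C(I, ℝ) := fun k => ((s k) ^ j)⁻¹ •
          (resolventFun k - ∑ i ∈ Finset.range j, (s k) ^ i • X ^ (i + 1)) with hF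
        have hFV : ∀ k, F k ∈ V := by
          intro k
          refine V.smul_mem _ (V.sub_mem (hk k) (V.sum_mem fun i hi => V.smul_mem _ (ih _ ?_)))
          have := Finset.mem_range.1 hi
          omega
        have hFval : ∀ k (y : I), F k y = (y : ℝ) ^ (j + 1) / (1 - s k * y) := by
          intro k y
          have hy1 : (y : ℝ) ≤ 1 := y.2.2
          have hy0 : (0 : ℝ) ≤ y := y.2.1
          have hne : 1 - s k * (y : ℝ) ≠ 0 := by
            have : s k * (y : ℝ) ≤ 1 / 2 * 1 := mul_le_mul (hs1 k) hy1 hy0 (by norm_num)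
            linarith
          have hgeom : (∑ i ∈ Finset.range j, (s k) ^ i * (y : ℝ) ^ (i + 1)) =
              y * ((1 - (s k * y) ^ j) / (1 - s k * y)) := by
            have hg := geom_sum_mul_neg (s k * (y : ℝ)) j
            rw [← hg, mul_div_assoc, div_self hne, mul_one, Finset.mul_sum]
            exact Finset.sum_congr rfl fun i _ => by ring
          have hr : resolventFun k y = y / (1 - s k * y) := by
            simp only [resolventFun, ContinuousMap.coe_mk, hs]
            congr 2
            ring
          have hsk := (hs0 k).ne'
          simp only [hF, ContinuousMap.smul_apply, ContinuousMap.sub_apply, ContinuousMap.sum_apply,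
            ContinuousMap.pow_apply, smul_eq_mul, hr]
          have hXy : X y = (y : ℝ) := rfl
          rw [hXy, hgeom]
          field_simp
          ring
        have hlim : Tendsto F atTop (𝓝 (X ^ (j + 1))) := by
          rw [tendsto_iff_norm_sub_tendsto_zero]
          have hs2 : Tendsto (fun k => 2 * s k) atTop (𝓝 0) := by
            have : Tendsto (fun k : ℕ => 1 / ((k : ℝ) + 2)) atTop (𝓝 0) :=
              tendsto_const_nhds.div_atTop
                (tendsto_atTop_add_const_right _ _ tendsto_natCast_atTop_atTop)
            have h := this.const_mul 2
            rwa [mul_zero] at h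
          refine squeeze_zero (fun k => norm_nonneg _) (fun k => ?_) hs2
          rw [ContinuousMap.norm_le _ (by have := hs0 k; positivity)]
          intro y
          have hy1 : (y : ℝ) ≤ 1 := y.2.2
          have hy0 : (0 : ℝ) ≤ y := y.2.1
          have hsy : s k * (y : ℝ) ≤ 1 / 2 * 1 := mul_le_mul (hs1 k) hy1 hy0 (by norm_num)
          have hd : 1 / 2 ≤ 1 - s k * (y : ℝ) := by linarith
          have hXy : X y = (y : ℝ) := rfl
          rw [ContinuousMap.sub_apply, hFval, ContinuousMap.pow_apply, hXy]
          have e : (y : ℝ) ^ (j + 1) / (1 - s k * y) - (y : ℝ) ^ (j + 1) =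
              (y : ℝ) ^ (j + 2) * s k / (1 - s k * y) := by
            have : 1 - s k * (y : ℝ) ≠ 0 := by linarith
            field_simp
            ring
          have hs0k := hs0 k
          rw [e, Real.norm_eq_abs, abs_of_nonneg (div_nonneg (by positivity) (by linarith)),
            div_le_iff₀ (by linarith)]
          have hp : (y : ℝ) ^ (j + 2) ≤ 1 := pow_le_one₀ hy0 hy1
          nlinarith
        exact hV.mem_of_tendsto hlim (Eventually.of_forall hFV)
  have hpoly : (polynomialFunctions I : Set C(I, ℝ)) ⊆ V := by
    rintro _ ⟨p, -, rfl⟩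
    have e : (Polynomial.toContinuousMapOnAlgHom I) p = ∑ i ∈ p.support, p.coeff i • X ^ i := by
      ext y
      simp [Polynomial.toContinuousMapOnAlgHom, Polynomial.eval_eq_sum, Polynomial.sum, hX]
    change (Polynomial.toContinuousMapOnAlgHom I) p ∈ V
    rw [e]
    exact V.sum_mem fun i _ => V.smul_mem _ (hpow i)
  rw [eq_top_iff]
  intro φ _
  have hφ : φ ∈ (polynomialFunctions I).topologicalClosure := by
    rw [polynomialFunctions_closure_eq_top']
    trivial
  exact closure_minimal hpoly hV hφ

/-- Convergence of uniformly bounded linear functionals on `C([0, 1])` may be tested on the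
constants and on the resolvent functions. -/
lemma tendsto_of_tendsto_resolventFun {L : ℕ → C(I, ℝ) →ₗ[ℝ] ℝ} {L₀ : C(I, ℝ) →ₗ[ℝ] ℝ}
    (hb : ∀ n φ, |L n φ| ≤ ‖φ‖) (hb₀ : ∀ φ, |L₀ φ| ≤ ‖φ‖)
    (h1 : Tendsto (fun n => L n 1) atTop (𝓝 (L₀ 1)))
    (hk : ∀ k, Tendsto (fun n => L n (resolventFun k)) atTop (𝓝 (L₀ (resolventFun k))))
    (φ : C(I, ℝ)) : Tendsto (fun n => L n φ) atTop (𝓝 (L₀ φ)) := by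
  let V : Submodule ℝ C(I, ℝ) :=
    { carrier := {φ | Tendsto (fun n => L n φ) atTop (𝓝 (L₀ φ))}
      add_mem' := fun {a b} ha hb => by
        simpa using (show Tendsto _ _ _ from ha).add (show Tendsto _ _ _ from hb)
      zero_mem' := by simp
      smul_mem' := fun r a ha => by
        simpa using (show Tendsto _ _ _ from ha).const_mul r }
  have hV : IsClosed (V : Set C(I, ℝ)) := by
    refine isClosed_of_closure_subset fun φ hφ => ?_
    change Tendsto (fun n => L n φ) atTop (𝓝 (L₀ φ))
    rw [Metric.tendsto_atTop']
    intro ε hε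
    obtain ⟨ψ, hψ, hd⟩ := Metric.mem_closure_iff.1 hφ (ε / 3) (by positivity)
    have hψ' : Tendsto (fun n => L n ψ) atTop (𝓝 (L₀ ψ)) := hψ
    obtain ⟨n0, hn0⟩ := Metric.tendsto_atTop'.1 hψ' (ε / 3) (by positivity)
    refine ⟨n0, fun n hn => ?_⟩
    have h1 := hn0 n hn
    rw [dist_eq_norm] at hd
    rw [Real.dist_eq] at h1 ⊢
    have h2 := hb n (φ - ψ)
    have h3 := hb₀ (φ - ψ)
    rw [map_sub] at h2 h3
    have e : L n φ - L₀ φ = (L n φ - L n ψ) + (L n ψ - L₀ ψ) - (L₀ φ - L₀ ψ) := by ring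
    rw [e]
    have h4 := abs_sub ((L n φ - L n ψ) + (L n ψ - L₀ ψ)) (L₀ φ - L₀ ψ)
    have h5 := abs_add_le (L n φ - L n ψ) (L n ψ - L₀ ψ)
    linarith
  have hT := eq_top_of_resolventFun_mem V hV h1 hk
  have : φ ∈ V := hT ▸ Submodule.mem_top
  exact this

/-- The coordinate `y = 1 / (1 + x)` identifying `[0, ∞)` with `(0, 1]`. -/
noncomputable def cayley (x : ℝ) : I := Set.projIcc 0 1 zero_le_one (1 / (1 + x))

lemma measurable_cayley : Measurable cayley :=
  continuous_projIcc.measurable.comp ((measurable_const.add measurable_id).const_div 1)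

lemma coe_cayley {x : ℝ} (hx : 0 ≤ x) : (cayley x : ℝ) = 1 / (1 + x) := by
  rw [cayley, Set.projIcc_of_mem zero_le_one (x := 1 / (1 + x))]
  refine ⟨by positivity, ?_⟩
  rw [div_le_one (by positivity)]
  linarith

lemma resolventFun_cayley (k : ℕ) {x : ℝ} (hx : 0 ≤ x) :
    resolventFun k (cayley x) = 1 / (x + resolventPoint k) := by
  simp only [resolventFun, ContinuousMap.coe_mk, coe_cayley hx, resolventPoint]
  have h1 : (1 : ℝ) - 1 / (1 + x) / (k + 2) = (x + (k + 1) / (k + 2)) / (1 + x) := by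
    field_simp
    ring
  have h2 : 1 + x ≠ 0 := by positivity
  rw [h1, div_div_div_cancel_right₀ h2]

/-- A continuous function between the indicator functions of `[0, x]` and `[0, x']`. -/
lemma exists_between_indicators {x x' : ℝ} (hx : 0 ≤ x) (hxx' : x < x') :
    ∃ φ : C(I, ℝ), ∀ z : ℝ, 0 ≤ z →
      (if z ≤ x then 1 else 0) ≤ φ (cayley z) ∧ φ (cayley z) ≤ (if z ≤ x' then 1 else 0) := by
  set a := 1 / (1 + x) with ha
  set b := 1 / (1 + x') with hb
  have hab : 0 < a - b := by
    rw [sub_pos]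
    exact one_div_lt_one_div_of_lt (by linarith) (by linarith)
  refine ⟨⟨fun y => max 0 (min 1 (((y : ℝ) - b) / (a - b))), by fun_prop⟩, fun z hz => ?_⟩
  simp only [ContinuousMap.coe_mk, coe_cayley hz]
  constructor
  · split_ifs with h
    · have h1 : a ≤ 1 / (1 + z) := one_div_le_one_div_of_le (by linarith) (by linarith)
      have h2 : 1 ≤ (1 / (1 + z) - b) / (a - b) := by
        rw [le_div_iff₀ hab]; linarith
      rw [min_eq_left h2]
      exact le_max_right _ _
    · exact le_max_left _ _
  · split_ifs with h
    · exact max_le zero_le_one (min_le_left _ _)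
    · have h1 : 1 / (1 + z) ≤ b := one_div_le_one_div_of_le (by linarith) (by linarith)
      refine max_le le_rfl ((min_le_right _ _).trans ?_)
      exact div_nonpos_of_nonpos_of_nonneg (by linarith) hab.le

end TestFunctions

/-! ### Spectral means and the empirical spectral distribution -/

section Spectral

open Matrix unitInterval

variable {n N : ℕ}

lemma isHermitian_normGram (A : Matrix (Fin n) (Fin N) ℝ) : (normGram A).IsHermitian := by
  simp [IsHermitian, normGram]

lemma eigenvalues_normGram_nonneg (A : Matrix (Fin n) (Fin N) ℝ) (i : Fin n) :
    0 ≤ (isHermitian_normGram A).eigenvalues i := by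
  have h : (normGram A).PosSemidef := by
    have := posSemidef_self_mul_conjTranspose A
    rw [conjTranspose_eq_transpose_of_trivial] at this
    exact this.smul (by positivity)
  exact h.eigenvalues_nonneg i

/-- The mean of `φ (1 / (1 + λ))` over the eigenvalues `λ` of `(1/n) A Aᵀ`, as a linear functional
of `φ`. -/
noncomputable def specMean (A : Matrix (Fin n) (Fin N) ℝ) : C(I, ℝ) →ₗ[ℝ] ℝ where
  toFun φ := (∑ i, φ (cayley ((isHermitian_normGram A).eigenvalues i))) / n
  map_add' φ ψ := by simp [Finset.sum_add_distrib, add_div]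
  map_smul' r φ := by simp [← Finset.mul_sum, mul_div_assoc]

lemma specMean_apply (A : Matrix (Fin n) (Fin N) ℝ) (φ : C(I, ℝ)) :
    specMean A φ = (∑ i, φ (cayley ((isHermitian_normGram A).eigenvalues i))) / n := rfl

lemma abs_specMean_le (A : Matrix (Fin n) (Fin N) ℝ) (φ : C(I, ℝ)) : |specMean A φ| ≤ ‖φ‖ := by
  rw [specMean_apply, abs_div, Nat.abs_cast]
  rcases Nat.eq_zero_or_pos n with rfl | hn
  · simp
  · rw [div_le_iff₀ (by exact_mod_cast hn)]
    refine (Finset.abs_sum_le_sum_abs _ _).trans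
      ((Finset.sum_le_sum fun i _ => φ.norm_coe_le_norm _).trans_eq ?_)
    simp [mul_comm]

lemma specMean_one (A : Matrix (Fin n) (Fin N) ℝ) (hn : 0 < n) : specMean A 1 = 1 := by
  have : (n : ℝ) ≠ 0 := by positivity
  simp [specMean_apply, this]

lemma esd_eq_sum (A : Matrix (Fin n) (Fin N) ℝ) (x : ℝ) :
    esd (normGram A) x =
      (∑ i, if (isHermitian_normGram A).eigenvalues i ≤ x then (1 : ℝ) else 0) / n := by
  rw [esd, (isHermitian_normGram A).roots_charpoly_eq_eigenvalues, Multiset.filter_map,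
    Multiset.card_map]
  congr 1
  rw [Finset.sum_boole]
  rfl

lemma esd_mono (A : Matrix (Fin n) (Fin N) ℝ) : Monotone (esd (normGram A)) := by
  intro x y hxy
  rw [esd_eq_sum, esd_eq_sum]
  gcongr with i
  split_ifs with h1 h2
  · exact le_rfl
  · exact absurd (h1.trans hxy) h2
  · exact zero_le_one
  · exact le_rfl

lemma esd_nonneg (A : Matrix (Fin n) (Fin N) ℝ) (x : ℝ) : 0 ≤ esd (normGram A) x := by
  unfold esd; positivity

lemma esd_le_one (A : Matrix (Fin n) (Fin N) ℝ) (x : ℝ) : esd (normGram A) x ≤ 1 := by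
  rw [esd_eq_sum]
  refine div_le_one_of_le₀ ?_ (by positivity)
  calc _ ≤ ∑ _i : Fin n, (1 : ℝ) := Finset.sum_le_sum fun i _ => by split_ifs <;> norm_num
    _ = n := by simp

lemma esd_of_neg (A : Matrix (Fin n) (Fin N) ℝ) {x : ℝ} (hx : x < 0) : esd (normGram A) x = 0 := by
  rw [esd_eq_sum]
  have : ∀ i, ¬ (isHermitian_normGram A).eigenvalues i ≤ x := fun i h =>
    absurd (eigenvalues_normGram_nonneg A i) (by linarith)
  simp [this]

lemma le_esd_zero (A : Matrix (Fin n) (Fin N) ℝ) (hn : 0 < n) :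
    1 - (N : ℝ) / n ≤ esd (normGram A) 0 := by
  have hn' : (0 : ℝ) < n := by exact_mod_cast hn
  have hrank : (normGram A).rank ≤ N := by
    have h1 : normGram A = A * ((1 / (n : ℝ)) • Aᵀ) := by rw [normGram, Matrix.mul_smul]
    rw [h1]
    exact (rank_mul_le_left _ _).trans ((rank_le_width A))
  rw [(isHermitian_normGram A).rank_eq_card_non_zero_eigs, Fintype.card_subtype] at hrank
  have hpos : ∀ i, (isHermitian_normGram A).eigenvalues i ≠ 0 ∨
      (isHermitian_normGram A).eigenvalues i ≤ 0 := fun i => by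
    by_cases h : (isHermitian_normGram A).eigenvalues i = 0
    · exact Or.inr h.le
    · exact Or.inl h
  have h2 : (n : ℝ) ≤ N +
      ∑ i, if (isHermitian_normGram A).eigenvalues i ≤ 0 then (1 : ℝ) else 0 := by
    calc (n : ℝ) = ∑ _i : Fin n, (1 : ℝ) := by simp
      _ ≤ ∑ i, ((if (isHermitian_normGram A).eigenvalues i ≠ 0 then (1 : ℝ) else 0) +
          if (isHermitian_normGram A).eigenvalues i ≤ 0 then (1 : ℝ) else 0) := by
        refine Finset.sum_le_sum fun i _ => ?_
        rcases hpos i with h | h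
        · rw [if_pos h]; split_ifs <;> norm_num
        · rw [if_pos h]; split_ifs <;> norm_num
      _ ≤ _ := by
        rw [Finset.sum_add_distrib]
        gcongr
        rw [Finset.sum_boole]
        exact_mod_cast hrank
  rw [esd_eq_sum, le_div_iff₀ hn', sub_mul, div_mul_cancel₀ _ hn'.ne']
  linarith

/-- The trace of the resolvent of a real symmetric matrix in terms of its eigenvalues. -/
lemma trace_inv_add_smul_one {M : Matrix (Fin n) (Fin n) ℝ} (hM : M.IsHermitian) {t : ℝ}
    (ht : ∀ i, 0 < hM.eigenvalues i + t) :
    (t • (1 : Matrix (Fin n) (Fin n) ℝ) + M)⁻¹.trace = ∑ i, 1 / (hM.eigenvalues i + t) := by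
  set U : Matrix (Fin n) (Fin n) ℝ := (hM.eigenvectorUnitary : Matrix (Fin n) (Fin n) ℝ) with hU
  have hUU : U * star U = 1 := by simp [hU]
  have hUU' : star U * U = 1 := by simp [hU]
  have hspec : M = U * diagonal hM.eigenvalues * star U := by
    have := hM.spectral_theorem
    simpa [Unitary.conjStarAlgAut_apply, Function.comp_def] using this
  have hinv : (t • (1 : Matrix (Fin n) (Fin n) ℝ) + M)⁻¹ =
      U * diagonal (fun i => 1 / (hM.eigenvalues i + t)) * star U := by
    apply inv_eq_right_inv
    have h1 : t • (1 : Matrix (Fin n) (Fin n) ℝ) + M =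
        U * diagonal (fun i => hM.eigenvalues i + t) * star U := by
      have h2 : diagonal (fun i => hM.eigenvalues i + t) =
          diagonal hM.eigenvalues + t • (1 : Matrix (Fin n) (Fin n) ℝ) := by
        rw [smul_one_eq_diagonal, diagonal_add]
      rw [h2, Matrix.mul_add, Matrix.add_mul, ← hspec, Matrix.mul_smul, Matrix.mul_one,
        Matrix.smul_mul, hUU, add_comm]
    rw [h1]
    calc U * diagonal (fun i => hM.eigenvalues i + t) * star U *
          (U * diagonal (fun i => 1 / (hM.eigenvalues i + t)) * star U)
        = U * diagonal (fun i => hM.eigenvalues i + t) * (star U * U) *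
          diagonal (fun i => 1 / (hM.eigenvalues i + t)) * star U := by
          simp only [Matrix.mul_assoc]
      _ = U * (diagonal (fun i => hM.eigenvalues i + t) *
          diagonal (fun i => 1 / (hM.eigenvalues i + t))) * star U := by
          rw [hUU', Matrix.mul_one]; simp only [Matrix.mul_assoc]
      _ = 1 := by
          rw [diagonal_mul_diagonal]
          have : (fun i => (hM.eigenvalues i + t) * (1 / (hM.eigenvalues i + t))) = fun _ => 1 := by
            ext i
            exact mul_one_div_cancel (ht i).ne'
          rw [this, diagonal_one, Matrix.mul_one, hUU]
  rw [hinv, Matrix.trace_mul_comm, ← Matrix.mul_assoc, hUU', Matrix.one_mul, trace_diagonal]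

/-- The spectral means of the resolvent functions are normalized traces of resolvents. -/
lemma specMean_resolventFun (A : Matrix (Fin n) (Fin N) ℝ) (hn : 0 < n) (k : ℕ) :
    specMean A (resolventFun k) =
      rowTrace (resolventPoint k) A Finset.univ + (1 - (N : ℝ) / n) / resolventPoint k := by
  have ht := resolventPoint_pos k
  have hn' : (0 : ℝ) < n := by exact_mod_cast hn
  have h0 := eigenvalues_normGram_nonneg A
  rw [specMean_apply]
  simp_rw [fun i => resolventFun_cayley k (h0 i)]
  rw [← trace_inv_add_smul_one (isHermitian_normGram A) (fun i => by have := h0 i; positivity),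
    normGram, trace_inv_mul_transpose (by positivity) ht, rowTrace, Fintype.card_fin,
    Fintype.card_fin]
  field_simp

lemma esd_le_specMean_le (A : Matrix (Fin n) (Fin N) ℝ) {x x' : ℝ} {φ : C(I, ℝ)}
    (hφ : ∀ z : ℝ, 0 ≤ z →
      (if z ≤ x then 1 else 0) ≤ φ (cayley z) ∧ φ (cayley z) ≤ (if z ≤ x' then 1 else 0)) :
    esd (normGram A) x ≤ specMean A φ ∧ specMean A φ ≤ esd (normGram A) x' := by
  have h0 := eigenvalues_normGram_nonneg A
  rw [esd_eq_sum, esd_eq_sum, specMean_apply]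
  constructor
  · gcongr with i
    exact (hφ _ (h0 i)).1
  · gcongr with i
    exact (hφ _ (h0 i)).2

variable {Ω : Type*} [mΩ : MeasurableSpace Ω] {A : Ω → Matrix (Fin n) (Fin N) ℝ}

lemma measurable_specMean (hA : ∀ i j, Measurable fun ω => A ω i j) (φ : C(I, ℝ)) :
    Measurable fun ω => specMean (A ω) φ := by
  rcases Nat.eq_zero_or_pos n with rfl | hn
  · simp [specMean_apply]
  let V : Submodule ℝ C(I, ℝ) :=
    { carrier := {φ | Measurable fun ω => specMean (A ω) φ}
      add_mem' := fun {a b} ha hb => by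
        simpa using Measurable.fun_add ha hb
      zero_mem' := by simp
      smul_mem' := fun r a ha => by
        simpa using (show Measurable _ from ha).const_mul r }
  have hV : IsClosed (V : Set C(I, ℝ)) := by
    refine IsSeqClosed.isClosed fun ψ φ hψ hlim => ?_
    refine measurable_of_tendsto_metrizable (f := fun m ω => specMean (A ω) (ψ m)) hψ ?_
    rw [tendsto_pi_nhds]
    intro ω
    rw [tendsto_iff_norm_sub_tendsto_zero] at hlim ⊢
    refine squeeze_zero (fun _ => norm_nonneg _) (fun m => ?_) hlim
    rw [← map_sub]
    exact abs_specMean_le _ _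
  have h1 : (1 : C(I, ℝ)) ∈ V := by
    change Measurable fun ω => specMean (A ω) 1
    simp_rw [fun ω => specMean_one (A ω) hn]
    exact measurable_const
  have hk : ∀ k, resolventFun k ∈ V := by
    intro k
    change Measurable fun ω => specMean (A ω) (resolventFun k)
    simp_rw [fun ω => specMean_resolventFun (A ω) hn k]
    exact (measurable_rowTrace_of (fun k _ j => hA k j) _).add_const _
  have hT := eq_top_of_resolventFun_mem V hV h1 hk
  have : φ ∈ V := hT ▸ Submodule.mem_top
  exact this

lemma measurable_esd (hA : ∀ i j, Measurable fun ω => A ω i j) (x : ℝ) :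
    Measurable fun ω => esd (normGram (A ω)) x := by
  rcases lt_or_ge x 0 with hx | hx
  · simp_rw [fun ω => esd_of_neg (A ω) hx]
    exact measurable_const
  choose φ hφ using fun m : ℕ => exists_between_indicators hx
    (show x < x + 1 / ((m : ℝ) + 1) by have : (0 : ℝ) < 1 / ((m : ℝ) + 1) := by positivity
                                       linarith)
  refine measurable_of_tendsto_metrizable (f := fun m ω => specMean (A ω) (φ m))
    (fun m => measurable_specMean hA _) ?_
  rw [tendsto_pi_nhds]
  intro ω
  rw [esd_eq_sum]
  simp_rw [specMean_apply]
  refine Tendsto.div_const (tendsto_finsetSum _ fun i _ => ?_) _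
  have h0 := eigenvalues_normGram_nonneg (A ω) i
  set z := (isHermitian_normGram (A ω)).eigenvalues i
  refine tendsto_const_nhds.congr' ?_
  by_cases hz : z ≤ x
  · refine Eventually.of_forall fun m => ?_
    have h := hφ m z h0
    rw [if_pos hz] at h
    rw [if_pos hz]
    refine le_antisymm h.1 (h.2.trans ?_)
    split_ifs <;> norm_num
  · -- the indicators of `[0, x + 1 / (m + 1)]` eventually miss `z`
    have hlim := (tendsto_one_div_add_atTop_nhds_zero_nat (𝕜 := ℝ)).const_add x
    rw [add_zero] at hlim
    filter_upwards [hlim.eventually_lt_const (not_le.1 hz)] with m hm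
    have h := hφ m z h0
    rw [if_neg hz, if_neg (not_le.2 hm)] at h
    rw [if_neg hz]
    exact le_antisymm h.1 h.2

end Spectral

/-! ### A trigonometric integral -/

section TrigIntegral

open Real

lemma integral_cos_intCast_mul {j : ℤ} (hj : j ≠ 0) : ∫ θ in (0 : ℝ)..π, cos (j * θ) = 0 := by
  have hj' : (j : ℝ) ≠ 0 := by exact_mod_cast hj
  rw [intervalIntegral.integral_comp_mul_left (fun x => cos x) hj', integral_cos]
  simp [sin_int_mul_pi]

lemma integral_sin_mul_sin (k : ℕ) :
    ∫ θ in (0 : ℝ)..π, sin θ * sin ((k + 1 : ℕ) * θ) = if k = 0 then π / 2 else 0 := by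
  have h : ∀ θ : ℝ, sin θ * sin ((k + 1 : ℕ) * θ) =
      (cos ((k : ℤ) * θ) - cos (((k : ℤ) + 2 : ℤ) * θ)) / 2 := by
    intro θ
    have h1 : ((k : ℤ) : ℝ) * θ = ((k + 1 : ℕ) : ℝ) * θ - θ := by push_cast; ring
    have h2 : (((k : ℤ) + 2 : ℤ) : ℝ) * θ = ((k + 1 : ℕ) : ℝ) * θ + θ := by push_cast; ring
    rw [h1, h2, cos_sub, cos_add]
    ring
  have hc : ∀ j : ℤ, IntervalIntegrable (fun θ : ℝ => cos (j * θ)) volume 0 π := fun j =>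
    (by fun_prop : Continuous fun θ : ℝ => cos (j * θ)).intervalIntegrable _ _
  simp_rw [h]
  rw [intervalIntegral.integral_div, intervalIntegral.integral_sub (hc _) (hc _),
    integral_cos_intCast_mul (j := (k : ℤ) + 2) (by omega)]
  split_ifs with hk
  · subst hk; simp
  · rw [integral_cos_intCast_mul (j := (k : ℤ)) (by omega)]; simp

/-- Partial sums of the conjugate Poisson kernel `∑ (-q)ᵏ sin ((k + 1) θ)`. -/
lemma mul_sum_sin (q θ : ℝ) (K : ℕ) :
    (1 + q ^ 2 + 2 * q * cos θ) * ∑ k ∈ Finset.range K, (-q) ^ k * sin ((k + 1 : ℕ) * θ) =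
      sin θ - (-q) ^ K * (sin ((K + 1 : ℕ) * θ) + q * sin (K * θ)) := by
  induction K with
  | zero => simp
  | succ K ih =>
    rw [Finset.sum_range_succ, mul_add, ih]
    have h1 : ((K + 1 + 1 : ℕ) : ℝ) * θ = ((K + 1 : ℕ) : ℝ) * θ + θ := by push_cast; ring
    have h2 : (K : ℝ) * θ = ((K + 1 : ℕ) : ℝ) * θ - θ := by push_cast; ring
    rw [h1, h2, sin_add, sin_sub, pow_succ]
    ring

lemma one_add_sq_add_cos_ge (q θ : ℝ) : sin θ ^ 2 ≤ 1 + q ^ 2 + 2 * q * cos θ := by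
  nlinarith [sin_sq_add_cos_sq θ, sq_nonneg (q + cos θ)]

lemma integrableOn_sin_sq_div (q : ℝ) :
    IntegrableOn (fun θ => sin θ ^ 2 / (1 + q ^ 2 + 2 * q * cos θ)) (Set.Icc 0 π) := by
  have hm : Measurable fun θ : ℝ => sin θ ^ 2 / (1 + q ^ 2 + 2 * q * cos θ) := by fun_prop
  refine Measure.integrableOn_of_bounded (M := 1) (by simp) hm.aestronglyMeasurable
    (Eventually.of_forall fun θ => ?_)
  have h := one_add_sq_add_cos_ge q θ
  rw [norm_eq_abs, abs_of_nonneg (div_nonneg (sq_nonneg _) ((sq_nonneg _).trans h))]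
  exact div_le_one_of_le₀ h ((sq_nonneg _).trans h)

/-- For `q < 1` the integrand is `sin θ` times the conjugate Poisson kernel, and all terms of its
expansion but the first are orthogonal to `sin θ`; for `q = 1` it simplifies to
`(1 - cos θ) / 2`. -/
lemma integral_sin_sq_div {q : ℝ} (hq : 0 < q) (hq1 : q ≤ 1) :
    ∫ θ in (0 : ℝ)..π, sin θ ^ 2 / (1 + q ^ 2 + 2 * q * cos θ) = π / 2 := by
  rcases hq1.lt_or_eq with hq1 | rfl
  · set D : ℝ → ℝ := fun θ => 1 + q ^ 2 + 2 * q * cos θ with hD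
    have hDge : ∀ θ, (1 - q) ^ 2 ≤ D θ := fun θ => by
      simp only [hD]
      nlinarith [neg_one_le_cos θ]
    have hq2 : 0 < (1 - q) ^ 2 := by
      have : 0 < 1 - q := by linarith
      positivity
    have hDpos : ∀ θ, 0 < D θ := fun θ => lt_of_lt_of_le hq2 (hDge θ)
    have hDc : Continuous D := by fun_prop
    set R : ℕ → ℝ → ℝ := fun K θ =>
      (-q) ^ K * (sin θ * (sin ((K + 1 : ℕ) * θ) + q * sin (K * θ)) / D θ) with hR
    have hRc : ∀ K, Continuous (R K) := fun K => by
      refine Continuous.mul continuous_const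
        (Continuous.div (by fun_prop) hDc fun θ => (hDpos θ).ne')
    have hdec : ∀ K θ, sin θ ^ 2 / D θ =
        (∑ k ∈ Finset.range K, (-q) ^ k * (sin θ * sin ((k + 1 : ℕ) * θ))) + R K θ := by
      intro K θ
      have h := mul_sum_sin q θ K
      have h2 : ∑ k ∈ Finset.range K, (-q) ^ k * (sin θ * sin ((k + 1 : ℕ) * θ)) =
          sin θ * ∑ k ∈ Finset.range K, (-q) ^ k * sin ((k + 1 : ℕ) * θ) := by
        rw [Finset.mul_sum]
        exact Finset.sum_congr rfl fun k _ => by ring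
      have hne := (hDpos θ).ne'
      rw [h2]
      simp only [hR]
      rw [div_eq_iff hne, add_mul]
      have h3 : (-q) ^ K * (sin θ * (sin ((K + 1 : ℕ) * θ) + q * sin (K * θ)) / D θ) * D θ =
          (-q) ^ K * (sin θ * (sin ((K + 1 : ℕ) * θ) + q * sin (K * θ))) := by
        field_simp
      rw [h3]
      have h' : D θ * ∑ k ∈ Finset.range K, (-q) ^ k * sin ((k + 1 : ℕ) * θ) =
        sin θ - (-q) ^ K * (sin ((K + 1 : ℕ) * θ) + q * sin (K * θ)) := h
      linear_combination -sin θ * h'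
    have hint : ∀ K, ∫ θ in (0 : ℝ)..π, sin θ ^ 2 / D θ =
        π / 2 + ∫ θ in (0 : ℝ)..π, R (K + 1) θ := by
      intro K
      simp_rw [hdec (K + 1)]
      rw [intervalIntegral.integral_add
        ((by fun_prop : Continuous fun θ => ∑ k ∈ Finset.range (K + 1),
          (-q) ^ k * (sin θ * sin ((k + 1 : ℕ) * θ))).intervalIntegrable _ _)
        ((hRc _).intervalIntegrable _ _), intervalIntegral.integral_finsetSum]
      · congr 1
        simp_rw [intervalIntegral.integral_const_mul, integral_sin_mul_sin]
        rw [Finset.sum_eq_single 0 (fun k _ hk => by simp [hk]) (by simp)]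
        simp
      · intro k _
        exact (by fun_prop : Continuous fun θ => (-q) ^ k *
          (sin θ * sin ((k + 1 : ℕ) * θ))).intervalIntegrable _ _
    have hRb : ∀ K, |∫ θ in (0 : ℝ)..π, R K θ| ≤ q ^ K * (2 / (1 - q) ^ 2) * π := by
      intro K
      have h := intervalIntegral.norm_integral_le_of_norm_le_const (a := (0 : ℝ)) (b := π)
        (f := R K)
        (C := q ^ K * (2 / (1 - q) ^ 2)) (fun θ _ => by
          simp only [hR]
          rw [norm_eq_abs, abs_mul, abs_pow, abs_neg, abs_of_pos hq, abs_div, abs_of_pos (hDpos θ)]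
          have h1 : |sin θ * (sin ((K + 1 : ℕ) * θ) + q * sin (K * θ))| ≤ 2 := by
            rw [abs_mul]
            have a1 := abs_sin_le_one θ
            have a2 : |sin ((K + 1 : ℕ) * θ) + q * sin (K * θ)| ≤ 2 := by
              refine (abs_add_le _ _).trans ?_
              rw [abs_mul, abs_of_pos hq]
              have b1 := abs_sin_le_one (((K + 1 : ℕ) : ℝ) * θ)
              have b2 := abs_sin_le_one ((K : ℝ) * θ)
              nlinarith [abs_nonneg (sin ((K : ℝ) * θ))]
            calc _ ≤ 1 * 2 := mul_le_mul a1 a2 (abs_nonneg _) zero_le_one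
              _ = 2 := one_mul _
          have h2 := hDge θ
          gcongr)
      rwa [norm_eq_abs, sub_zero, abs_of_pos pi_pos] at h
    have hlim : Tendsto (fun K : ℕ => q ^ (K + 1) * (2 / (1 - q) ^ 2) * π) atTop (𝓝 0) := by
      have := (((tendsto_pow_atTop_nhds_zero_of_lt_one hq.le hq1).comp
        (tendsto_add_atTop_nat 1)).mul_const (2 / (1 - q) ^ 2)).mul_const π
      simpa using this
    have hle : |(∫ θ in (0 : ℝ)..π, sin θ ^ 2 / D θ) - π / 2| ≤ 0 := by
      refine ge_of_tendsto' hlim fun K => ?_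
      rw [hint K, add_sub_cancel_left]
      exact hRb _
    have := abs_nonpos_iff.1 hle
    linarith
  · have h : ∀ θ ∈ Set.uIoo (0 : ℝ) π, sin θ ^ 2 / (1 + 1 ^ 2 + 2 * 1 * cos θ) =
        (1 - cos θ) / 2 := by
      intro θ hθ
      rw [Set.uIoo_of_le pi_pos.le] at hθ
      have h1 : -1 < cos θ := by
        rw [← cos_pi]
        exact cos_lt_cos_of_nonneg_of_le_pi hθ.1.le le_rfl hθ.2
      have h2 : (1 + 1 ^ 2 + 2 * 1 * cos θ) ≠ 0 := by linarith
      rw [div_eq_iff h2, sin_sq]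
      ring
    rw [intervalIntegral.integral_congr_uIoo h, intervalIntegral.integral_div,
      intervalIntegral.integral_sub (by simp) (continuous_cos.intervalIntegrable _ _), integral_cos]
    simp

end TrigIntegral

/-! ### The Marchenko–Pastur law -/

section Law

open Real unitInterval

variable {c : ℝ}

lemma bijOn_add_mul_cos (hc : 0 < c) :
    Set.BijOn (fun θ => 1 + c + 2 * √c * cos θ) (Set.Icc 0 π)
      (Set.Icc ((1 - √c) ^ 2) ((1 + √c) ^ 2)) := by
  have hs := sqrt_pos.2 hc
  have hs2 : √c ^ 2 = c := sq_sqrt hc.le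
  have h : Set.BijOn (fun y => 1 + c + 2 * √c * y) (Set.Icc (-1) 1)
      (Set.Icc ((1 - √c) ^ 2) ((1 + √c) ^ 2)) := by
    refine ⟨fun y hy => ⟨?_, ?_⟩, fun y _ z _ hyz => ?_, fun x hx =>
      ⟨(x - (1 + c)) / (2 * √c), ⟨?_, ?_⟩, ?_⟩⟩
    · have := hy.1
      nlinarith
    · have := hy.2
      nlinarith
    · have h2 : 2 * √c * y = 2 * √c * z := by simpa using hyz
      exact mul_left_cancel₀ (by positivity) h2
    · rw [le_div_iff₀ (by positivity)]
      have := hx.1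
      nlinarith
    · rw [div_le_iff₀ (by positivity)]
      have := hx.2
      nlinarith
    · field_simp
      ring
  exact h.comp bijOn_cos

/-- The substitution `x = 1 + c + 2√c cos θ` turns the Stieltjes transform of the absolutely
continuous part of the Marchenko–Pastur law into a trigonometric integral with parameter
`q = u / √c`, where `u` is the small root of `u² - (1 + c + w) u + c = 0`. -/
lemma integral_sqrt_div_add (hc : 0 < c) {w u : ℝ} (hu : 0 < u) (huc : u ≤ √c)
    (h : u ^ 2 - (1 + c + w) * u + c = 0) :
    IntegrableOn (fun x => √((x - (1 - √c) ^ 2) * ((1 + √c) ^ 2 - x)) / (2 * π * (x + w)))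
      (Set.Icc ((1 - √c) ^ 2) ((1 + √c) ^ 2)) ∧
    ∫ x in Set.Icc ((1 - √c) ^ 2) ((1 + √c) ^ 2),
      √((x - (1 - √c) ^ 2) * ((1 + √c) ^ 2 - x)) / (2 * π * (x + w)) = u := by
  set s := √c with hs_def
  have hs : 0 < s := sqrt_pos.2 hc
  have hs2 : s ^ 2 = c := sq_sqrt hc.le
  set q := u / s with hq_def
  have hq : 0 < q := by positivity
  have hq1 : q ≤ 1 := (div_le_one hs).2 huc
  have hbij := bijOn_add_mul_cos hc
  have hder : ∀ θ ∈ Set.Icc 0 π, HasDerivWithinAt (fun θ => 1 + c + 2 * s * cos θ)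
      (2 * s * -sin θ) (Set.Icc 0 π) θ := fun θ _ =>
    (((hasDerivAt_cos θ).const_mul (2 * s)).const_add (1 + c)).hasDerivWithinAt
  have hpt : ∀ θ ∈ Set.Icc 0 π, |2 * s * -sin θ| • (√((1 + c + 2 * s * cos θ - (1 - s) ^ 2) *
      ((1 + s) ^ 2 - (1 + c + 2 * s * cos θ))) / (2 * π * (1 + c + 2 * s * cos θ + w))) =
      2 * u / π * (sin θ ^ 2 / (1 + q ^ 2 + 2 * q * cos θ)) := by
    intro θ hθ
    have hsin : 0 ≤ sin θ := sin_nonneg_of_mem_Icc hθ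
    have h1 : (1 + c + 2 * s * cos θ - (1 - s) ^ 2) * ((1 + s) ^ 2 - (1 + c + 2 * s * cos θ)) =
        (2 * s * sin θ) ^ 2 := by
      rw [mul_pow, sin_sq, ← hs2]
      ring
    have h2 : 1 + c + 2 * s * cos θ + w = s / q * (1 + q ^ 2 + 2 * q * cos θ) := by
      have h3 : 1 + c + w = u + c / u := by
        field_simp
        linarith
      have h4 : s / q * (1 + q ^ 2 + 2 * q * cos θ) = s ^ 2 / u + u + 2 * s * cos θ := by
        rw [hq_def]
        field_simp
      rw [h4, hs2]
      linarith
    rw [h1, h2, sqrt_sq (by positivity), mul_neg, abs_neg, abs_of_nonneg (by positivity),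
      smul_eq_mul, ← mul_assoc (2 * π), ← div_div, ← mul_div_assoc, ← mul_div_assoc]
    rw [hq_def]
    field_simp
  have hint := (integrableOn_sin_sq_div q).const_mul (2 * u / π)
  refine ⟨?_, ?_⟩
  · rw [← hbij.image_eq, integrableOn_image_iff_integrableOn_abs_deriv_smul measurableSet_Icc hder
      hbij.injOn]
    exact IntegrableOn.congr_fun hint (fun θ hθ => (hpt θ hθ).symm) measurableSet_Icc
  · rw [← hbij.image_eq, integral_image_eq_integral_abs_deriv_smul measurableSet_Icc hder
      hbij.injOn, setIntegral_congr_fun measurableSet_Icc hpt, integral_const_mul,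
      integral_Icc_eq_integral_Ioc, ← intervalIntegral.integral_of_le pi_pos.le,
      integral_sin_sq_div hq hq1]
    field_simp

lemma mpDensity_eq_indicator (c : ℝ) :
    mpDensity c = (Set.Icc ((1 - √c) ^ 2) ((1 + √c) ^ 2)).indicator
      fun x => √((x - (1 - √c) ^ 2) * ((1 + √c) ^ 2 - x)) / (2 * π * (x + 0)) := by
  ext x
  simp only [mpDensity, Set.indicator, Set.mem_Icc, add_zero]

lemma min_one_le_sqrt (hc : 0 < c) : min 1 c ≤ √c := by
  rcases le_total 1 c with h | h
  · exact (min_le_left _ _).trans (one_le_sqrt.2 h)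
  · refine (min_le_right _ _).trans ?_
    rw [le_sqrt hc.le hc.le]
    nlinarith

lemma min_one_quadratic (c : ℝ) : (min 1 c) ^ 2 - (1 + c + 0) * min 1 c + c = 0 := by
  rcases le_total 1 c with h | h
  · rw [min_eq_left h]; ring
  · rw [min_eq_right h]; ring

lemma mpRoot_le_sqrt (hc : 0 < c) {t : ℝ} (ht : 0 < t) : mpRoot c t ≤ √c := by
  have h0 := mpRoot_pos ht.le hc
  obtain ⟨h1, h2⟩ := mpRoot_lt ht hc
  rw [le_sqrt h0.le hc.le]
  nlinarith

lemma integrable_mpDensity (hc : 0 < c) : Integrable (mpDensity c) := by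
  rw [mpDensity_eq_indicator, integrable_indicator_iff measurableSet_Icc]
  exact (integral_sqrt_div_add hc (lt_min one_pos hc) (min_one_le_sqrt hc)
    (min_one_quadratic c)).1

/-- The mass of the absolutely continuous part. -/
lemma integral_mpDensity (hc : 0 < c) : ∫ x, mpDensity c x = min 1 c := by
  rw [mpDensity_eq_indicator, integral_indicator measurableSet_Icc]
  exact (integral_sqrt_div_add hc (lt_min one_pos hc) (min_one_le_sqrt hc)
    (min_one_quadratic c)).2

lemma mpDensity_of_nonpos {x : ℝ} (hx : x ≤ 0) : mpDensity c x = 0 := by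
  unfold mpDensity
  split_ifs with h
  · -- only `x = 0` is possible here, where the quotient vanishes by convention
    have : x = 0 := le_antisymm hx ((sq_nonneg _).trans h.1)
    simp [this]
  · rfl

lemma mpDensity_nonneg (c x : ℝ) : 0 ≤ mpDensity c x := by
  rcases le_total x 0 with hx | hx
  · rw [mpDensity_of_nonpos hx]
  · unfold mpDensity
    split_ifs
    · positivity
    · exact le_rfl

lemma measurable_mpDensity (c : ℝ) : Measurable (mpDensity c) := by
  rw [mpDensity_eq_indicator]
  exact Measurable.indicator (by fun_prop) measurableSet_Icc

lemma min_one_add_max_one_sub (c : ℝ) : min 1 c + max (1 - c) 0 = 1 := by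
  rcases le_total 1 c with h | h
  · rw [min_eq_left h, max_eq_right (by linarith)]; ring
  · rw [min_eq_right h, max_eq_left (by linarith)]; ring

lemma isProbabilityMeasure_mpLaw (hc : 0 < c) : IsProbabilityMeasure (mpLaw c) := by
  constructor
  rw [mpLaw, Measure.add_apply, withDensity_apply _ MeasurableSet.univ, Measure.restrict_univ,
    ← ofReal_integral_eq_lintegral_ofReal (integrable_mpDensity hc)
      (Eventually.of_forall (mpDensity_nonneg c)), integral_mpDensity hc, Measure.smul_apply,
    measure_univ, smul_eq_mul, mul_one]
  have h : ENNReal.ofReal (1 - c) = ENNReal.ofReal (max (1 - c) 0) := by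
    rcases le_total (1 - c) 0 with h | h
    · rw [max_eq_right h, ENNReal.ofReal_of_nonpos h, ENNReal.ofReal_zero]
    · rw [max_eq_left h]
  rw [h, ← ENNReal.ofReal_add (lt_min one_pos hc).le (le_max_right _ _),
    min_one_add_max_one_sub, ENNReal.ofReal_one]

lemma integral_mpLaw (hc : 0 < c) {g : ℝ → ℝ} (hg : Measurable g) {K : ℝ} (hK : ∀ x, |g x| ≤ K) :
    ∫ x, g x ∂mpLaw c = (∫ x, mpDensity c x * g x) + max (1 - c) 0 * g 0 := by
  have := isProbabilityMeasure_mpLaw hc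
  have hi : Integrable g (mpLaw c) := Integrable.of_bound hg.aestronglyMeasurable K
    (Eventually.of_forall hK)
  have hi' := integrable_add_measure.1 hi
  rw [mpLaw, integral_add_measure hi'.1 hi'.2, integral_smul_measure, integral_dirac,
    integral_withDensity_eq_integral_toReal_smul (measurable_mpDensity c).ennreal_ofReal
      (Eventually.of_forall fun x => ENNReal.ofReal_lt_top)]
  simp [ENNReal.toReal_ofReal', mpDensity_nonneg]

lemma mpCDF_eq (hc : 0 < c) (x : ℝ) : mpCDF c x =
    (∫ y in Set.Iic x, mpDensity c y) + if 0 ≤ x then max (1 - c) 0 else 0 := by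
  have := isProbabilityMeasure_mpLaw hc
  have h1 : mpCDF c x = ∫ y, (Set.Iic x).indicator 1 y ∂mpLaw c := by
    rw [integral_indicator_one measurableSet_Iic, mpCDF]
  rw [h1, integral_mpLaw hc (K := 1) (measurable_one.indicator measurableSet_Iic),
    ← integral_indicator measurableSet_Iic]
  · congr 1
    · congr 1
      ext y
      simp [Set.indicator]
    · simp [Set.indicator]
  · intro y
    simp only [Set.indicator]
    split_ifs <;> simp

lemma mpCDF_of_neg (hc : 0 < c) {x : ℝ} (hx : x < 0) : mpCDF c x = 0 := by
  rw [mpCDF_eq hc, if_neg (not_le.2 hx), add_zero]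
  exact setIntegral_eq_zero_of_forall_eq_zero fun y hy =>
    mpDensity_of_nonpos ((show y ≤ x from hy).trans hx.le)

lemma mpCDF_zero (hc : 0 < c) : mpCDF c 0 = max (1 - c) 0 := by
  rw [mpCDF_eq hc, if_pos le_rfl,
    setIntegral_eq_zero_of_forall_eq_zero (t := Set.Iic 0) fun y hy =>
      mpDensity_of_nonpos (show y ≤ 0 from hy), zero_add]

lemma mpCDF_of_ge (hc : 0 < c) {x : ℝ} (hx : (1 + √c) ^ 2 ≤ x) : mpCDF c x = 1 := by
  rw [mpCDF_eq hc, if_pos ((sq_nonneg _).trans hx), setIntegral_eq_integral_of_forall_compl_eq_zero,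
    integral_mpDensity hc, min_one_add_max_one_sub]
  intro y hy
  have hy' : x < y := not_le.1 hy
  rw [mpDensity, if_neg]
  rintro ⟨-, h⟩
  linarith

lemma continuousOn_mpCDF (hc : 0 < c) : ContinuousOn (mpCDF c) (Set.Ici 0) := by
  have hi := integrable_mpDensity hc
  have h : Continuous fun x => (∫ y in (0 : ℝ)..x, mpDensity c y) + mpCDF c 0 :=
    (intervalIntegral.continuous_primitive (fun a b => hi.intervalIntegrable) 0).add
      continuous_const
  refine h.continuousOn.congr fun x hx => ?_
  have hx0 : (0 : ℝ) ≤ x := hx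
  dsimp only
  rw [mpCDF_eq hc, mpCDF_eq hc, if_pos hx0, if_pos le_rfl,
    ← intervalIntegral.integral_Iic_sub_Iic hi.integrableOn hi.integrableOn]
  ring

/-- Integration of `φ (1 / (1 + x))` against the Marchenko–Pastur law, as a linear functional
of `φ`. -/
noncomputable def mpMean (c : ℝ) (hc : 0 < c) : C(I, ℝ) →ₗ[ℝ] ℝ :=
  have := isProbabilityMeasure_mpLaw hc
  have hi (φ : C(I, ℝ)) : Integrable (fun x => φ (cayley x)) (mpLaw c) :=
    Integrable.of_bound (φ.measurable.comp measurable_cayley).aestronglyMeasurable ‖φ‖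
      (Eventually.of_forall fun _ => φ.norm_coe_le_norm _)
  { toFun φ := ∫ x, φ (cayley x) ∂mpLaw c
    map_add' φ ψ := integral_add (hi φ) (hi ψ)
    map_smul' r _ := integral_const_mul r _ }

lemma mpMean_apply (hc : 0 < c) (φ : C(I, ℝ)) : mpMean c hc φ = ∫ x, φ (cayley x) ∂mpLaw c := rfl

lemma abs_mpMean_le (hc : 0 < c) (φ : C(I, ℝ)) : |mpMean c hc φ| ≤ ‖φ‖ := by
  have := isProbabilityMeasure_mpLaw hc
  have h := norm_integral_le_of_norm_le_const (μ := mpLaw c) (f := fun x => φ (cayley x))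
    (Eventually.of_forall fun x => φ.norm_coe_le_norm (cayley x))
  simpa [mpMean_apply] using h

lemma mpMean_one (hc : 0 < c) : mpMean c hc 1 = 1 := by
  have := isProbabilityMeasure_mpLaw hc
  simp [mpMean_apply]

/-- The Stieltjes transform of the Marchenko–Pastur law on the negative half-line. -/
lemma mpMean_resolventFun (hc : 0 < c) (k : ℕ) :
    mpMean c hc (resolventFun k) = (1 - mpRoot c (resolventPoint k)) / resolventPoint k := by
  have ht := resolventPoint_pos k
  set t := resolventPoint k with ht_def
  obtain ⟨i0, e0⟩ := integral_sqrt_div_add hc (lt_min one_pos hc) (min_one_le_sqrt hc)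
    (min_one_quadratic c)
  obtain ⟨i1, e1⟩ := integral_sqrt_div_add hc (mpRoot_pos ht.le hc) (mpRoot_le_sqrt hc ht)
    (mpRoot_sq ht.le hc)
  rw [mpMean_apply, integral_mpLaw hc (g := fun x => resolventFun k (cayley x))
    ((resolventFun k).measurable.comp measurable_cayley)
    (fun x => (resolventFun k).norm_coe_le_norm (cayley x)), resolventFun_cayley k le_rfl, ← ht_def]
  have hpt : ∀ x, mpDensity c x * resolventFun k (cayley x) =
      (Set.Icc ((1 - √c) ^ 2) ((1 + √c) ^ 2)).indicator (fun x => (1 / t) *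
        (√((x - (1 - √c) ^ 2) * ((1 + √c) ^ 2 - x)) / (2 * π * (x + 0)) -
          √((x - (1 - √c) ^ 2) * ((1 + √c) ^ 2 - x)) / (2 * π * (x + t)))) x := by
    intro x
    rw [mpDensity_eq_indicator]
    by_cases hx : x ∈ Set.Icc ((1 - √c) ^ 2) ((1 + √c) ^ 2)
    · have hx0 : 0 ≤ x := (sq_nonneg _).trans hx.1
      rw [Set.indicator_of_mem hx, Set.indicator_of_mem hx, resolventFun_cayley k hx0, ← ht_def]
      rcases hx0.eq_or_lt with rfl | hx0
      · -- `0` lies in the support only if `c = 1`, and there the square root vanishes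
        have : (1 - √c) ^ 2 = 0 := le_antisymm hx.1 (sq_nonneg _)
        simp [this]
      · have h1 : x + t ≠ 0 := by positivity
        field_simp
        ring
    · rw [Set.indicator_of_notMem hx, Set.indicator_of_notMem hx, zero_mul]
  simp_rw [hpt]
  rw [integral_indicator measurableSet_Icc, integral_const_mul, integral_sub i0 i1, e0, e1,
      zero_add]
  rw [eq_sub_of_add_eq (min_one_add_max_one_sub c)]
  ring

lemma ae_nonneg_mpLaw (c : ℝ) : ∀ᵐ x ∂mpLaw c, 0 ≤ x := by
  have h : {x : ℝ | ¬ 0 ≤ x} = Set.Iio 0 := by ext; simp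
  rw [ae_iff, h, mpLaw, Measure.add_apply, withDensity_apply _ measurableSet_Iio,
    setLIntegral_congr_fun (g := fun _ => 0) measurableSet_Iio fun x hx => by
      rw [mpDensity_of_nonpos (show x < 0 from hx).le, ENNReal.ofReal_zero]]
  simp

lemma mpCDF_le_mpMean_le (hc : 0 < c) {x x' : ℝ} {φ : C(I, ℝ)}
    (hφ : ∀ z : ℝ, 0 ≤ z →
      (if z ≤ x then 1 else 0) ≤ φ (cayley z) ∧ φ (cayley z) ≤ (if z ≤ x' then 1 else 0)) :
    mpCDF c x ≤ mpMean c hc φ ∧ mpMean c hc φ ≤ mpCDF c x' := by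
  have := isProbabilityMeasure_mpLaw hc
  have hind : ∀ y, mpCDF c y = ∫ z, (Set.Iic y).indicator 1 z ∂mpLaw c := fun y => by
    rw [integral_indicator_one measurableSet_Iic, mpCDF]
  have hi : ∀ y, Integrable ((Set.Iic y).indicator (1 : ℝ → ℝ)) (mpLaw c) := fun y =>
    (integrable_const (1 : ℝ)).indicator measurableSet_Iic
  have hiφ : Integrable (fun x => φ (cayley x)) (mpLaw c) :=
    Integrable.of_bound (φ.measurable.comp measurable_cayley).aestronglyMeasurable ‖φ‖
      (Eventually.of_forall fun _ => φ.norm_coe_le_norm _)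
  rw [hind, hind, mpMean_apply]
  constructor
  · refine integral_mono_ae (hi x) hiφ ?_
    filter_upwards [ae_nonneg_mpLaw c] with z hz
    simpa [Set.indicator] using (hφ z hz).1
  · refine integral_mono_ae hiφ (hi x') ?_
    filter_upwards [ae_nonneg_mpLaw c] with z hz
    simpa [Set.indicator] using (hφ z hz).2

end Law

/-! ### Uniform convergence of distribution functions -/

section UniformConvergence

/-- A form of Pólya's theorem: if the distribution functions `F n` of laws on `[0, ∞)` are
eventually squeezed between shifts of a distribution function `G` that is continuous on `[0, ∞)`,
and if no mass at the origin is lost, then `F n → G` uniformly. -/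
lemma tendsto_supDist_zero {F : ℕ → ℝ → ℝ} {G : ℝ → ℝ} {b : ℝ} (hb : 0 ≤ b)
    (hF : ∀ n, Monotone (F n)) (hF0 : ∀ n x, x < 0 → F n x = 0) (hF1 : ∀ n x, F n x ≤ 1)
    (hG0 : ∀ x, x < 0 → G x = 0) (hG1 : ∀ x, b ≤ x → G x = 1)
    (hGc : ContinuousOn G (Set.Ici 0))
    (h : ∀ x x', 0 ≤ x → x < x' → ∀ ε > 0, ∀ᶠ n in atTop,
      F n x ≤ G x' + ε ∧ G x - ε ≤ F n x')
    (h0 : ∀ ε > 0, ∀ᶠ n in atTop, G 0 - ε ≤ F n 0) :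
    Tendsto (fun n => supDist (F n) G) atTop (𝓝 0) := by
  rw [ENNReal.tendsto_nhds_zero]
  intro ε' hε'
  obtain ⟨r, hr0, hrε⟩ := ENNReal.lt_iff_exists_nnreal_btwn.1 hε'
  have hr : (0 : ℝ) < r := by exact_mod_cast hr0
  set ε : ℝ := r / 2 with hε_def
  have hε : 0 < ε := by positivity
  have huc : UniformContinuousOn G (Set.Icc 0 (b + 3)) :=
    isCompact_Icc.uniformContinuousOn_of_continuous (hGc.mono fun x hx => hx.1)
  obtain ⟨δ, hδ, hGδ⟩ := Metric.uniformContinuousOn_iff.1 huc ε hε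
  -- consecutive grid points are at distance `s`, and `[0, K s]` covers the support of `G`
  set s : ℝ := min 1 (δ / 3) with hs_def
  have hs : 0 < s := by positivity
  have hs1 : s ≤ 1 := min_le_left _ _
  have hsδ : 2 * s < δ := by
    have : s ≤ δ / 3 := min_le_right _ _
    linarith
  set K := ⌈b / s⌉₊ with hK_def
  have hKb : b ≤ K * s := (div_le_iff₀ hs).1 (Nat.le_ceil _)
  have hKb' : K * s < b + s := by
    have h1 := Nat.ceil_lt_add_one (div_nonneg hb hs.le)
    have h2 : (K : ℝ) * s < (b / s + 1) * s := mul_lt_mul_of_pos_right h1 hs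
    rwa [add_mul, div_mul_cancel₀ _ hs.ne', one_mul] at h2
  have hgrid : ∀ᶠ n in atTop, ∀ i ∈ Finset.range (K + 2),
      F n (i * s) ≤ G ((i + 1) * s) + ε ∧ G (i * s) - ε ≤ F n ((i + 1) * s) := by
    rw [Filter.eventually_all_finset]
    intro i _
    exact h _ _ (by positivity) (by nlinarith) ε hε
  filter_upwards [hgrid, h0 ε hε] with n hn hn0
  refine (iSup_le fun x => ?_).trans hrε.le
  rw [← ENNReal.ofReal_coe_nnreal]
  refine ENNReal.ofReal_le_ofReal ?_
  have hrr : (r : ℝ) = 2 * ε := by rw [hε_def]; ring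
  rw [hrr, abs_le]
  rcases lt_or_ge x 0 with hx | hx
  · rw [hF0 n x hx, hG0 x hx]
    constructor <;> linarith
  set i := ⌊x / s⌋₊ with hi_def
  have hi1 : i * s ≤ x := (le_div_iff₀ hs).1 (Nat.floor_le (div_nonneg hx hs.le))
  have hi2 : x < (i + 1) * s := (div_lt_iff₀ hs).1 (Nat.lt_floor_add_one _)
  rcases lt_or_ge K i with hKi | hKi
  · have hKi' : (K : ℝ) + 1 ≤ i := by exact_mod_cast hKi
    have hbx : b ≤ x := by nlinarith
    have h1 := (hn K (by simp)).2
    rw [hG1 _ hKb] at h1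
    have h2 := hF n (show ((K : ℝ) + 1) * s ≤ x by nlinarith)
    rw [hG1 x hbx]
    have := hF1 n x
    constructor <;> linarith
  · have hKi' : (i : ℝ) ≤ K := by exact_mod_cast hKi
    have his : (i : ℝ) * s ≤ K * s := mul_le_mul_of_nonneg_right hKi' hs.le
    have hxm : x ∈ Set.Icc 0 (b + 3) := ⟨hx, by nlinarith⟩
    constructor
    · rcases Nat.eq_zero_or_pos i with hi0 | hipos
      · have h1 := hF n hx
        have h2 := hGδ x hxm 0 ⟨le_rfl, by linarith⟩ (by
          rw [Real.dist_eq, sub_zero, abs_of_nonneg hx]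
          rw [hi0] at hi2
          norm_num at hi2
          linarith)
        rw [Real.dist_eq] at h2
        have := (abs_lt.1 h2).2
        linarith
      · obtain ⟨j, hj⟩ : ∃ j, i = j + 1 := ⟨i - 1, by omega⟩
        have hjr : (i : ℝ) = j + 1 := by rw [hj]; push_cast; ring
        have h1 := (hn j (Finset.mem_range.2 (by omega))).2
        rw [← hjr] at h1
        have h2 := hF n hi1
        have e1 : (i : ℝ) * s = j * s + s := by rw [hjr]; ring
        have hj0 : (0 : ℝ) ≤ j * s := by positivity
        have h3 := hGδ x hxm (j * s) ⟨hj0, by nlinarith⟩ (by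
          rw [Real.dist_eq, abs_lt]
          constructor <;> linarith)
        rw [Real.dist_eq] at h3
        have := (abs_lt.1 h3).2
        linarith
    · have h1 := (hn (i + 1) (Finset.mem_range.2 (by omega))).1
      push_cast at h1
      have h2 := hF n hi2.le
      have h3 := hGδ (((i : ℝ) + 1 + 1) * s) ⟨by positivity, by nlinarith⟩ x hxm (by
        rw [Real.dist_eq, abs_lt]
        constructor <;> linarith)
      rw [Real.dist_eq] at h3
      have := (abs_lt.1 h3).2
      linarith

open unitInterval

/-- Uniform convergence to the Marchenko–Pastur distribution function follows from convergence of
the Stieltjes transforms at the points `resolventPoint k`. -/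
lemma tendsto_supDist_mpCDF {c : ℝ} (hc : 0 < c) {N : ℕ → ℕ}
    (hN : Tendsto (fun n : ℕ => (N n : ℝ) / n) atTop (𝓝 c))
    {F : ℕ → ℝ → ℝ} {L : ℕ → C(I, ℝ) →ₗ[ℝ] ℝ}
    (hF : ∀ n, Monotone (F n)) (hF0 : ∀ n x, x < 0 → F n x = 0) (hFnn : ∀ n, 0 ≤ F n 0)
    (hF1 : ∀ n x, F n x ≤ 1) (hFz : ∀ᶠ n : ℕ in atTop, 1 - (N n : ℝ) / n ≤ F n 0)
    (hL : ∀ n φ, |L n φ| ≤ ‖φ‖) (hL1 : ∀ᶠ n in atTop, L n 1 = 1)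
    (hLk : ∀ k, Tendsto (fun n => L n (resolventFun k)) atTop
      (𝓝 ((1 - mpRoot c (resolventPoint k)) / resolventPoint k)))
    (hFL : ∀ n x x' φ, (∀ z : ℝ, 0 ≤ z →
      (if z ≤ x then 1 else 0) ≤ φ (cayley z) ∧ φ (cayley z) ≤ (if z ≤ x' then 1 else 0)) →
      F n x ≤ L n φ ∧ L n φ ≤ F n x') :
    Tendsto (fun n => supDist (F n) (mpCDF c)) atTop (𝓝 0) := by
  have hlim : ∀ φ, Tendsto (fun n => L n φ) atTop (𝓝 (mpMean c hc φ)) := by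
    refine tendsto_of_tendsto_resolventFun hL (abs_mpMean_le hc) ?_ fun k => ?_
    · rw [mpMean_one]
      exact tendsto_const_nhds.congr' (hL1.mono fun n hn => hn.symm)
    · rw [mpMean_resolventFun]
      exact hLk k
  refine tendsto_supDist_zero (sq_nonneg (1 + √c)) hF hF0 hF1
    (fun x hx => mpCDF_of_neg hc hx) (fun x hx => mpCDF_of_ge hc hx) (continuousOn_mpCDF hc)
    (fun x x' hx hxx' ε hε => ?_) fun ε hε => ?_
  · obtain ⟨φ, hφ⟩ := exists_between_indicators hx hxx'
    obtain ⟨h1, h2⟩ := mpCDF_le_mpMean_le hc hφ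
    filter_upwards [(hlim φ).eventually_lt_const (lt_add_of_pos_right _ hε),
      (hlim φ).eventually_const_lt (sub_lt_self _ hε)] with n hn1 hn2
    obtain ⟨h3, h4⟩ := hFL n x x' φ hφ
    constructor <;> linarith
  · have h1 : Tendsto (fun n => max (1 - (N n : ℝ) / n) 0) atTop (𝓝 (max (1 - c) 0)) :=
      (hN.const_sub 1).max tendsto_const_nhds
    rw [mpCDF_zero hc]
    filter_upwards [hFz, h1.eventually_const_lt (sub_lt_self _ hε)] with n hn1 hn2
    exact hn2.le.trans (max_le hn1 (hFnn n))

variable {Ω : Type*} [MeasurableSpace Ω] {μ : Measure Ω} [IsProbabilityMeasure μ]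

lemma integrable_esd {n N : ℕ} {A : Ω → Matrix (Fin n) (Fin N) ℝ}
    (hA : ∀ i j, Measurable fun ω => A ω i j) (x : ℝ) :
    Integrable (fun ω => esd (normGram (A ω)) x) μ :=
  Integrable.of_bound (measurable_esd hA x).aestronglyMeasurable 1
    (Eventually.of_forall fun ω => by
      rw [Real.norm_eq_abs, abs_of_nonneg (esd_nonneg _ _)]
      exact esd_le_one _ _)

lemma integrable_specMean {n N : ℕ} {A : Ω → Matrix (Fin n) (Fin N) ℝ}
    (hA : ∀ i j, Measurable fun ω => A ω i j) (φ : C(I, ℝ)) :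
    Integrable (fun ω => specMean (A ω) φ) μ :=
  Integrable.of_bound (measurable_specMean hA φ).aestronglyMeasurable ‖φ‖
    (Eventually.of_forall fun _ => abs_specMean_le _ _)

/-- The expectation of `specMean`, as a linear functional. -/
noncomputable def meanSpecMean (μ : Measure Ω) [IsProbabilityMeasure μ] {n N : ℕ}
    {A : Ω → Matrix (Fin n) (Fin N) ℝ} (hA : ∀ i j, Measurable fun ω => A ω i j) :
    C(I, ℝ) →ₗ[ℝ] ℝ where
  toFun φ := ∫ ω, specMean (A ω) φ ∂μ
  map_add' φ ψ := by
    simp_rw [map_add]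
    exact integral_add (integrable_specMean hA φ) (integrable_specMean hA ψ)
  map_smul' r _ := by
    simp_rw [map_smul]
    exact integral_const_mul r _

lemma meanSpecMean_apply {n N : ℕ} {A : Ω → Matrix (Fin n) (Fin N) ℝ}
    (hA : ∀ i j, Measurable fun ω => A ω i j) (φ : C(I, ℝ)) :
    meanSpecMean μ hA φ = ∫ ω, specMean (A ω) φ ∂μ := rfl

lemma tendsto_add_stieltjes {N : ℕ → ℕ} {c : ℝ}
    (hN : Tendsto (fun n : ℕ => (N n : ℝ) / n) atTop (𝓝 c)) {T : ℕ → ℝ} {t u : ℝ}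
    (hT : Tendsto T atTop (𝓝 ((c - u) / t))) :
    Tendsto (fun n : ℕ => T n + (1 - (N n : ℝ) / n) / t) atTop (𝓝 ((1 - u) / t)) := by
  have h := hT.add ((hN.const_sub 1).div_const t)
  have e : (c - u) / t + (1 - c) / t = (1 - u) / t := by ring
  rwa [e] at h

variable {N : ℕ → ℕ} {A : (n : ℕ) → Ω → Matrix (Fin n) (Fin (N n)) ℝ} {β : ℕ → ℕ} {c : ℝ}

lemma tendsto_supDist_mean (hA : ConditionC0 μ A β) (hc : 0 < c)
    (hN : Tendsto (fun n : ℕ => (N n : ℝ) / n) atTop (𝓝 c)) :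
    Tendsto (fun n : ℕ => supDist (fun x => ∫ ω, esd (normGram (A n ω)) x ∂μ) (mpCDF c))
      atTop (𝓝 0) := by
  have hm := hA.measurable
  refine tendsto_supDist_mpCDF hc hN (L := fun n => meanSpecMean μ (hm n))
    (fun n x y hxy => ?_) (fun n x hx => ?_) (fun n => ?_) (fun n x => ?_) ?_ (fun n φ => ?_) ?_
    (fun k => ?_) (fun n x x' φ hφ => ?_)
  · exact integral_mono (integrable_esd (hm n) x) (integrable_esd (hm n) y)
      fun ω => esd_mono (A n ω) hxy
  · simp_rw [fun ω => esd_of_neg (A n ω) hx]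
    exact integral_zero _ _
  · exact integral_nonneg fun ω => esd_nonneg _ _
  · calc _ ≤ ∫ _ω, (1 : ℝ) ∂μ := integral_mono (integrable_esd (hm n) x) (integrable_const 1)
          fun ω => esd_le_one (A n ω) x
      _ = 1 := by simp
  · filter_upwards [eventually_gt_atTop 0] with n hn
    calc 1 - (N n : ℝ) / n = ∫ _ω, (1 - (N n : ℝ) / n) ∂μ := by simp
      _ ≤ _ := integral_mono (integrable_const _) (integrable_esd (hm n) 0)
          fun ω => le_esd_zero (A n ω) hn
  · have h := norm_integral_le_of_norm_le_const (μ := μ) (f := fun ω => specMean (A n ω) φ)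
      (Eventually.of_forall fun ω => abs_specMean_le (A n ω) φ)
    simpa [meanSpecMean_apply] using h
  · filter_upwards [eventually_gt_atTop 0] with n hn
    simp [meanSpecMean_apply, specMean_one _ hn]
  · refine (tendsto_add_stieltjes hN
      (tendsto_integral_rowTrace hA hc hN (resolventPoint_pos k))).congr' ?_
    filter_upwards [eventually_gt_atTop 0] with n hn
    simp_rw [meanSpecMean_apply, fun ω => specMean_resolventFun (A n ω) hn k]
    rw [integral_add (hA.integrable_rowTrace (resolventPoint_pos k) n _) (integrable_const _)]
    simp
  · exact ⟨integral_mono (integrable_esd (hm n) x) (integrable_specMean (hm n) φ)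
      fun ω => (esd_le_specMean_le (A n ω) hφ).1,
      integral_mono (integrable_specMean (hm n) φ) (integrable_esd (hm n) x')
      fun ω => (esd_le_specMean_le (A n ω) hφ).2⟩

lemma ae_tendsto_supDist (hA : ConditionC0 μ A β) (hc : 0 < c)
    (hN : Tendsto (fun n : ℕ => (N n : ℝ) / n) atTop (𝓝 c))
    (hp : ∃ p : ℝ, 1 < p ∧ Summable (fun n : ℕ => ((β n : ℝ) + 1) ^ p / (n : ℝ) ^ (p / 2))) :
    ∀ᵐ ω ∂μ, Tendsto (fun n : ℕ => supDist (esd (normGram (A n ω))) (mpCDF c)) atTop (𝓝 0) := by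
  filter_upwards [ae_all_iff.2 fun k => ae_tendsto_rowTrace_sub hA hp (resolventPoint_pos k)]
    with ω hω
  refine tendsto_supDist_mpCDF hc hN (L := fun n => specMean (A n ω))
    (fun n => esd_mono _) (fun n x hx => esd_of_neg _ hx) (fun n => esd_nonneg _ _)
    (fun n => esd_le_one _) ?_ (fun n => abs_specMean_le _) ?_ (fun k => ?_)
    (fun n x x' φ hφ => esd_le_specMean_le _ hφ)
  · filter_upwards [eventually_gt_atTop 0] with n hn using le_esd_zero _ hn
  · filter_upwards [eventually_gt_atTop 0] with n hn using specMean_one _ hn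
  · have h := (hω k).add (tendsto_integral_rowTrace hA hc hN (resolventPoint_pos k))
    simp only [sub_add_cancel, zero_add] at h
    refine (tendsto_add_stieltjes hN h).congr' ?_
    filter_upwards [eventually_gt_atTop 0] with n hn
    rw [specMean_resolventFun _ hn]

end UniformConvergence

end MarchenkoPastur

theorem theorem1 {Ω : Type*} [MeasurableSpace Ω] (μ : Measure Ω) [IsProbabilityMeasure μ]
    (N : ℕ → ℕ) (A : (n : ℕ) → Ω → Matrix (Fin n) (Fin (N n)) ℝ) (β : ℕ → ℕ) (c : ℝ)
    (hA : MarchenkoPastur.ConditionC0 μ A β) (hc : 0 < c)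
    (hN : Tendsto (fun n : ℕ => (N n : ℝ) / n) atTop (𝓝 c)) :
    Tendsto (fun n : ℕ => MarchenkoPastur.supDist
        (fun x => ∫ ω, MarchenkoPastur.esd (MarchenkoPastur.normGram (A n ω)) x ∂μ)
        (MarchenkoPastur.mpCDF c))
      atTop (𝓝 0) ∧
    ((∃ p : ℝ, 1 < p ∧
        Summable (fun n : ℕ => ((β n : ℝ) + 1) ^ p / (n : ℝ) ^ (p / 2))) →
      ∀ᵐ ω ∂μ, Tendsto (fun n : ℕ => MarchenkoPastur.supDist
          (MarchenkoPastur.esd (MarchenkoPastur.normGram (A n ω)))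
          (MarchenkoPastur.mpCDF c))
        atTop (𝓝 0)) := by
  exact ⟨MarchenkoPastur.tendsto_supDist_mean hA hc hN,
    MarchenkoPastur.ae_tendsto_supDist hA hc hN⟩
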